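/- Let $p\ge 1$ and let $P=\mathrm{ES}(f;\mu,\Sigma)$ be the elliptically symmetric distribution on $\mathbb R^p$ with density $g(x)=c|\Sigma|^{-1/2}f\big((x-\mu)^T\Sigma^{-1}(x-\mu)\big)$, where $\Sigma$ is symmetric positive definite and $f:[0,\infty)\to[0,\infty)$ is non-increasing. Let $x_1,x_2,\dots$ be i.i.d. with law $P$, and let $P_n=\frac1n\sum_{i\le n}\delta_{x_i}$. Let $h=h_n$ be integers with $\lfloor (n+p+1)/2\rfloor\le h_n\le n$ for all large $n$ and $\alpha_n=h_n/n\to\alpha>0$. Assume that any centred ellipsoid $\{x:(x-\mu)^T\Sigma^{-1}(x-\mu)\le s\}$ such that $f$ is constant on $(0,s)$ has $P$-probability at most $\alpha$ (this holds in particular if $f$ is not constant near $0$, i.e. if $\mu$ is the only mode of $g$). For a probability measure $Q$ on $\mathbb R^p$ let $$D(x;Q)=\Big(1+\sup_{\|u\|=1}\frac{|u^Tx-\operatorname{med}(u^Ty)|}{\operatorname{MAD}(u^Ty)}\Big)^{-1},\qquad y\sim Q,$$ be the projection depth, where the median is the midpoint of the interval of all medians and $\operatorname{MAD}(V)=\operatorname{med}|V-\operatorname{med}V|$.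 Let $D_{\alpha_n}$ be a level with $P\{x:D(x;P)\ge D_{\alpha_n}\}=\alpha_n$, and let $\hat E_{\alpha_n,\mathrm{depth}}=\{x\in\mathbb R^p: D(x;P_n)\ge D_{\alpha_n}\}$ be the sample $\alpha_n$-trimmed region. Let $\hat H_n\subset\{1,\dots,n\}$ minimize the determinant of the sample covariance matrix of $(x_i)_{i\in H}$ over all index sets $H$ of size $h_n$, and let $\hat E_{\alpha_n,\mathrm{MCD}}=\{x_i:i\in\hat H_n\}$ be the MCD subset. Then the two sets are asymptotically equivalent: with $A\,\triangle\,B=(A\cup B)\setminus(A\cap B)$, $$P_n\big(\hat E_{\alpha_n,\mathrm{depth}}\,\triangle\,\hat E_{\alpha_n,\mathrm{MCD}}\big)\to 0\quad\text{almost surely as } n\to\infty,$$ and the probability that an observation $x_J$, with $J$ chosen uniformly at random from $\{1,\dots,n\}$, lies in $\hat E_{\alpha_n,\mathrm{depth}}\,\triangle\,\hat E_{\alpha_n,\mathrm{MCD}}$ (that is, the expectation of the left-hand side) also tends to $0$. -/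

import Mathlib

open MeasureTheory ProbabilityTheory Filter Topology
open scoped ENNReal Matrix

noncomputable section

namespace RobustDepth

/-- The squared Mahalanobis distance `(x - m)ᵀ S⁻¹ (x - m)`. -/
def mahalSq {p : ℕ} (m : EuclideanSpace ℝ (Fin p)) (S : Matrix (Fin p) (Fin p) ℝ)
    (x : EuclideanSpace ℝ (Fin p)) : ℝ :=
  (x - m).ofLp ⬝ᵥ (S⁻¹ *ᵥ (x - m).ofLp)

/-- `P` is the elliptically symmetric distribution `ES(f; m, S)` with non-increasing radial
function `f : [0, ∞) → [0, ∞)` (the values of `f` at negative arguments are never used):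
the probability measure with Lebesgue density `c |S|^(-1/2) f((x - m)ᵀ S⁻¹ (x - m))`. -/
structure IsES {p : ℕ} (f : ℝ → ℝ) (m : EuclideanSpace ℝ (Fin p))
    (S : Matrix (Fin p) (Fin p) ℝ) (P : Measure (EuclideanSpace ℝ (Fin p))) : Prop where
  posDef : S.PosDef
  nonneg : ∀ s, 0 ≤ s → 0 ≤ f s
  antitone : AntitoneOn f (Set.Ici 0)
  prob : IsProbabilityMeasure P
  density : ∃ c : ℝ, 0 < c ∧
    P = volume.withDensity
      (fun x => ENNReal.ofReal (c * S.det ^ (-(1 / 2) : ℝ) * f (mahalSq m S x)))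

/-- The median of a probability measure on the line: the midpoint of the interval of all
medians, whose end points are the lower and the upper median. For the empirical distribution
of `n` numbers it is the usual sample median. -/
def median (ν : Measure ℝ) : ℝ :=
  (sInf {t : ℝ | 1 / 2 ≤ ν (Set.Iic t)} + sSup {t : ℝ | 1 / 2 ≤ ν (Set.Ici t)}) / 2

/-- The median absolute deviation from the median, `med |V - med V|`. -/
def mad (ν : Measure ℝ) : ℝ :=
  median (ν.map (fun t => |t - median ν|))

/-- `sup_{‖u‖ = 1} |uᵀx - med(uᵀy)| / MAD(uᵀy)` for `y ∼ P`, as an extended number, so that an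
infinite supremum is not lost. -/
def projOutlyingness {p : ℕ} (P : Measure (EuclideanSpace ℝ (Fin p)))
    (x : EuclideanSpace ℝ (Fin p)) : ℝ≥0∞ :=
  ⨆ u ∈ Metric.sphere (0 : EuclideanSpace ℝ (Fin p)) 1,
    ENNReal.ofReal |inner ℝ u x - median (P.map (fun y => inner ℝ u y))| /
      ENNReal.ofReal (mad (P.map (fun y => inner ℝ u y)))

/-- The projection depth of `x` with respect to `P`, a number in `[0, 1]`. -/
def projDepth {p : ℕ} (P : Measure (EuclideanSpace ℝ (Fin p)))
    (x : EuclideanSpace ℝ (Fin p)) : ℝ :=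
  ((1 + projOutlyingness P x)⁻¹).toReal

/-- The region of all points whose projection depth with respect to `P` is at least `d`. -/
def depthRegion {p : ℕ} (P : Measure (EuclideanSpace ℝ (Fin p))) (d : ℝ) :
    Set (EuclideanSpace ℝ (Fin p)) :=
  {x | d ≤ projDepth P x}

/-- The empirical distribution of the points `x 0, …, x (n - 1)`. -/
def empiricalMeasure {p n : ℕ} (x : Fin n → EuclideanSpace ℝ (Fin p)) :
    Measure (EuclideanSpace ℝ (Fin p)) :=
  (n : ℝ≥0∞)⁻¹ • ∑ i, Measure.dirac (x i)

/-- The mean of the observations with index in `H`. -/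
def sampleMean {p n : ℕ} (x : Fin n → EuclideanSpace ℝ (Fin p)) (H : Finset (Fin n)) :
    EuclideanSpace ℝ (Fin p) :=
  (H.card : ℝ)⁻¹ • ∑ i ∈ H, x i

/-- The sample covariance matrix of the observations with index in `H`. -/
def sampleCov {p n : ℕ} (x : Fin n → EuclideanSpace ℝ (Fin p)) (H : Finset (Fin n)) :
    Matrix (Fin p) (Fin p) ℝ :=
  ((H.card : ℝ) - 1)⁻¹ •
    ∑ i ∈ H, Matrix.vecMulVec (x i - sampleMean x H).ofLp (x i - sampleMean x H).ofLp

/-- `H` solves the minimum covariance determinant problem for subsets of size `h`. -/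
def IsMCDIndexSet {p n : ℕ} (x : Fin n → EuclideanSpace ℝ (Fin p)) (h : ℕ)
    (H : Finset (Fin n)) : Prop :=
  H.card = h ∧
    ∀ K : Finset (Fin n), K.card = h → (sampleCov x H).det ≤ (sampleCov x K).det

/-- The set of the observations with index in `H`. -/
def obsSubset {p n : ℕ} (x : Fin n → EuclideanSpace ℝ (Fin p)) (H : Finset (Fin n)) :
    Set (EuclideanSpace ℝ (Fin p)) :=
  {y | ∃ i ∈ H, x i = y}

end RobustDepth

end

open RobustDepth

/-!
The only probabilistic input is that almost surely the empirical laws converge weakly to `P` and the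
observations are pairwise distinct; everything after that is deterministic. Depth regions,
minimizers of the determinant of the sample covariance and the condition on central ellipsoids are
all equivariant under affine maps, so whitening by `N` with `Σ⁻¹ = NᵀN` reduces the theorem to a
spherical law, with density `g(‖x‖²)` for a non-increasing `g`
(`RobustDepth.IsES.exists_isSpherical_map`). There both random sets are shown to be, up to a
vanishing fraction of the observations, the ball `B` about the origin of mass `α`.

*Depth.* Weak convergence gives convergence in the Lévy–Prokhorov metric. A half-space bound in that
metric is uniform over directions, and the one-dimensional marginals of the spherical law are one
and the same symmetric atomless law, whose support has no gaps; its median and MAD are therefore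
unique and stable. So medians and MADs of all projections converge uniformly, and the sample depth
is uniformly close on bounded sets to the population depth, a strictly decreasing function of the
norm (`exists_projDepth_eq`). The sample region then contains asymptotically every ball of mass less
than `α`, and its mass tends to `α`.

*Minimum covariance determinant.* For the minimizing set `H`, with covariance matrix `C`, let `x ↦ L
x - b` be the affine map with `|det L| = 1` that makes the covariance of `(x i)`, `i ∈ H`, a
multiple of the identity; by the inequality of arithmetic and geometric means its trace is `p (det
C)^(1/p)`, which is at most the normalized sum of squares over any comparison set of the same size
(`exists_affine_sum_norm_sq_le`). If `r` is the radius of `B`, a comparison set lying between two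
balls of radius near `r` shows that `L x - b` nearly maximizes the bounded continuous functional `∫
(r² - ‖L x - b‖²)₊ dP`. The layer-cake formula expresses it by the masses of the preimages of the
centred balls of radius less than `r`. Such a preimage has the volume of the ball, so a
non-increasing radial density gives it no more mass than the ball. Equality for all radii forces `L
x - b` to be a linear isometry (`IsSpherical.integral_truncated_lt`) if the density strictly
decreases across some sphere of radius at most `r` (`IsSpherical.exists_strict_radius`); otherwise
the density would be constant on a ball of mass greater than `α`, which is the excluded case. By
compactness near maximizers are near isometries (`eventually_near_isometry`), so observations in a
ball of radius less than `r` that are not in `H` would have to contribute to the loss a deficit that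
tends to zero: they are a vanishing fraction (`tendsto_card_notMem_mcd`).

The case `α = 1` is simpler, as then `H` misses only a vanishing fraction of all observations.

Two sets of mass tending to `α`, both containing, up to a vanishing fraction, every ball of mass
less than `α`, have a symmetric difference of vanishing mass. The convergence of the expectation
follows by dominated convergence.
-/

open RobustDepth

/-! ### Empirical distributions -/

theorem empiricalMeasure_apply {p n : ℕ} (x : Fin n → EuclideanSpace ℝ (Fin p))
    (A : Set (EuclideanSpace ℝ (Fin p))) [DecidablePred fun i => x i ∈ A] :
    empiricalMeasure x A = (n : ℝ≥0∞)⁻¹ * (Finset.univ.filter fun i => x i ∈ A).card := by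
  classical
  simp only [empiricalMeasure, Measure.smul_apply, Measure.finsetSum_apply, smul_eq_mul,
    Measure.dirac_apply, Set.indicator_apply, Pi.one_apply]
  congr 1
  rw [Finset.card_filter]
  push_cast
  exact Finset.sum_congr rfl fun i _ => by congr

theorem empiricalMeasure_real_apply {p n : ℕ} (x : Fin n → EuclideanSpace ℝ (Fin p))
    (A : Set (EuclideanSpace ℝ (Fin p))) [DecidablePred fun i => x i ∈ A] :
    (empiricalMeasure x).real A = ((Finset.univ.filter fun i => x i ∈ A).card : ℝ) / n := by
  rw [measureReal_def, empiricalMeasure_apply, ENNReal.toReal_mul, ENNReal.toReal_inv,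
    ENNReal.toReal_natCast, ENNReal.toReal_natCast, div_eq_inv_mul]

theorem isProbabilityMeasure_empiricalMeasure {p n : ℕ} (hn : 0 < n)
    (x : Fin n → EuclideanSpace ℝ (Fin p)) : IsProbabilityMeasure (empiricalMeasure x) := by
  classical
  constructor
  rw [empiricalMeasure_apply]
  simp only [Set.mem_univ, Finset.filter_true, Finset.card_univ, Fintype.card_fin]
  exact ENNReal.inv_mul_cancel (by exact_mod_cast hn.ne') (ENNReal.natCast_ne_top n)

theorem integral_empiricalMeasure {p n : ℕ} (x : Fin n → EuclideanSpace ℝ (Fin p))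
    (φ : EuclideanSpace ℝ (Fin p) → ℝ) :
    ∫ y, φ y ∂(empiricalMeasure x) = (∑ i, φ (x i)) / n := by
  rw [empiricalMeasure, integral_smul_measure, integral_finsetSum_measure]
  · simp [integral_dirac, div_eq_inv_mul]
  · intro i _
    exact integrable_dirac (by simp)

/-- The empirical distribution of the first `n` terms of a sequence as a bundled probability
measure; for `n = 0` it takes the arbitrary value `δ_{x 0}`. -/
noncomputable def empiricalProb {p : ℕ} (x : ℕ → EuclideanSpace ℝ (Fin p)) (n : ℕ) :
    ProbabilityMeasure (EuclideanSpace ℝ (Fin p)) :=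
  if hn : 0 < n then
    ⟨empiricalMeasure fun i : Fin n => x i, isProbabilityMeasure_empiricalMeasure hn _⟩
  else ⟨Measure.dirac (x 0), inferInstance⟩

theorem coe_empiricalProb {p : ℕ} (x : ℕ → EuclideanSpace ℝ (Fin p)) {n : ℕ} (hn : 0 < n) :
    (empiricalProb x n : Measure (EuclideanSpace ℝ (Fin p))) =
      empiricalMeasure fun i : Fin n => x i := by
  simp [empiricalProb, hn]

theorem ae_tendsto_empiricalMeasure_real {p : ℕ} {P : Measure (EuclideanSpace ℝ (Fin p))}
    {Ω : Type*} [MeasurableSpace Ω] {Pr : Measure Ω} [IsProbabilityMeasure Pr]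
    {X : ℕ → Ω → EuclideanSpace ℝ (Fin p)} (hXm : ∀ i, Measurable (X i))
    (hXlaw : ∀ i, Pr.map (X i) = P) (hXind : iIndepFun X Pr)
    {A : Set (EuclideanSpace ℝ (Fin p))} (hA : MeasurableSet A) :
    ∀ᵐ ω ∂Pr, Tendsto (fun n : ℕ => (empiricalMeasure fun i : Fin n => X i ω).real A) atTop
      (𝓝 (P.real A)) := by
  classical
  have hφ : Measurable (A.indicator fun _ => (1 : ℝ)) := measurable_const.indicator hA
  have h := strong_law_ae_real (μ := Pr) (fun i ω => A.indicator (fun _ => (1 : ℝ)) (X i ω))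
    (Integrable.of_bound (hφ.comp (hXm 0)).aestronglyMeasurable 1 (ae_of_all _ fun ω => by
      simp only [Set.indicator_apply]; split_ifs <;> simp))
    (fun i j hij => (hXind.indepFun hij).comp hφ hφ)
    (fun i => (IdentDistrib.mk (hXm i).aemeasurable (hXm 0).aemeasurable
      (by rw [hXlaw i, hXlaw 0])).comp hφ)
  filter_upwards [h] with ω hω
  have e1 : ∫ a, A.indicator (fun _ => (1 : ℝ)) (X 0 a) ∂Pr = P.real A := by
    rw [← hXlaw 0, ← integral_map (φ := X 0) (f := A.indicator fun _ => (1 : ℝ))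
      (hXm 0).aemeasurable hφ.aestronglyMeasurable, integral_indicator_const _ hA]
    simp
  rw [e1] at hω
  refine hω.congr fun n => ?_
  rw [empiricalMeasure_real_apply, Finset.card_filter, Nat.cast_sum,
    ← Fin.sum_univ_eq_sum_range (fun i => A.indicator (fun _ => (1 : ℝ)) (X i ω)) n]
  congr 1
  refine Finset.sum_congr rfl fun i _ => ?_
  simp [Set.indicator_apply]

/-- The empirical distributions of an i.i.d. sequence converge weakly almost surely: by the
strong law they converge on the countable `π`-system of finite intersections of the members of
a countable basis. -/
theorem ae_tendsto_empiricalProb {p : ℕ} {P : Measure (EuclideanSpace ℝ (Fin p))}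
    [hP : IsProbabilityMeasure P]
    {Ω : Type*} [MeasurableSpace Ω] {Pr : Measure Ω} [IsProbabilityMeasure Pr]
    {X : ℕ → Ω → EuclideanSpace ℝ (Fin p)} (hXm : ∀ i, Measurable (X i))
    (hXlaw : ∀ i, Pr.map (X i) = P) (hXind : iIndepFun X Pr) :
    ∀ᵐ ω ∂Pr, Tendsto (fun n => empiricalProb (fun i => X i ω) n) atTop
      (𝓝 (⟨P, hP⟩ : ProbabilityMeasure (EuclideanSpace ℝ (Fin p)))) := by
  set 𝓑 := TopologicalSpace.countableBasis (EuclideanSpace ℝ (Fin p))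
  set S : Set (Set (EuclideanSpace ℝ (Fin p))) := Set.sInter '' {F | F.Finite ∧ F ⊆ 𝓑} with hSdef
  have hSc : S.Countable :=
    (Set.countable_ofPred_finite_subset (TopologicalSpace.countable_countableBasis _)).image _
  have hSm : ∀ s ∈ S, MeasurableSet s := by
    rintro _ ⟨F, ⟨hF, hFB⟩, rfl⟩
    exact MeasurableSet.sInter hF.countable fun t ht =>
      (TopologicalSpace.isOpen_of_mem_countableBasis (hFB ht)).measurableSet
  have hSpi : IsPiSystem S := by
    rintro _ ⟨F, ⟨hF, hFB⟩, rfl⟩ _ ⟨G, ⟨hG, hGB⟩, rfl⟩ _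
    exact ⟨F ∪ G, ⟨hF.union hG, Set.union_subset hFB hGB⟩, by rw [Set.sInter_union]⟩
  have hall : ∀ᵐ ω ∂Pr, ∀ s ∈ S,
      Tendsto (fun n : ℕ => (empiricalMeasure fun i : Fin n => X i ω).real s) atTop
        (𝓝 (P.real s)) :=
    (ae_ball_iff hSc).2 fun s hs => ae_tendsto_empiricalMeasure_real hXm hXlaw hXind (hSm s hs)
  filter_upwards [hall] with ω hω
  refine hSpi.tendsto_probabilityMeasure_of_tendsto_of_mem hSm ?_ ?_
  · intro u hu x hx
    obtain ⟨t, ht, hxt, htu⟩ :=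
      (TopologicalSpace.isBasis_countableBasis _).exists_subset_of_mem_open hx hu
    exact ⟨t, ⟨{t}, ⟨Set.finite_singleton t, by simpa using ht⟩, by simp⟩,
      (TopologicalSpace.isOpen_of_mem_countableBasis ht).mem_nhds hxt, htu⟩
  · intro s hs
    rw [← NNReal.tendsto_coe]
    refine ((hω s hs).congr' ?_)
    filter_upwards [eventually_gt_atTop 0] with n hn
    rw [measureReal_def, ← coe_empiricalProb (fun i => X i ω) hn]
    rfl

/-- An i.i.d. sequence from a law without atoms has no ties. -/
theorem ae_injective_of_nullSingletonClass {p : ℕ} {P : Measure (EuclideanSpace ℝ (Fin p))}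
    [NullSingletonClass P]
    {Ω : Type*} [MeasurableSpace Ω] {Pr : Measure Ω} [IsProbabilityMeasure Pr]
    {X : ℕ → Ω → EuclideanSpace ℝ (Fin p)} (hXm : ∀ i, Measurable (X i))
    (hXlaw : ∀ i, Pr.map (X i) = P) (hXind : iIndepFun X Pr) :
    ∀ᵐ ω ∂Pr, Function.Injective fun i => X i ω := by
  have key : ∀ i j, i ≠ j → ∀ᵐ ω ∂Pr, X i ω ≠ X j ω := by
    intro i j hij
    have h1 := (indepFun_iff_map_prod_eq_prod_map_map (hXm i).aemeasurable
      (hXm j).aemeasurable).1 (hXind.indepFun hij)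
    rw [hXlaw, hXlaw] at h1
    have hPp : IsProbabilityMeasure P := by
      rw [← hXlaw 0]; exact Measure.isProbabilityMeasure_map (hXm 0).aemeasurable
    have h2 : (P.prod P) (Set.diagonal _) = 0 := by
      rw [Measure.measure_prod_null measurableSet_diagonal]
      refine ae_of_all _ fun x => ?_
      have : Prod.mk x ⁻¹' Set.diagonal (EuclideanSpace ℝ (Fin p)) = {x} := by
        ext y; simp [eq_comm]
      change P _ = 0
      rw [this]; simp
    rw [← h1, Measure.map_apply ((hXm i).prodMk (hXm j)) measurableSet_diagonal] at h2
    rw [ae_iff]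
    simpa [Set.preimage, Set.mem_diagonal_iff] using h2
  have : ∀ᵐ ω ∂Pr, ∀ i j, i ≠ j → X i ω ≠ X j ω := by
    simp only [ae_all_iff]
    exact fun i j hij => key i j hij
  filter_upwards [this] with ω hω i j hij
  by_contra hne
  exact hω i j hne hij

/-- Weak convergence bounds the measures of all Borel sets at once, through the Lévy-Prokhorov
metric. -/
theorem eventually_real_le_thickening_add {E : Type*} [PseudoMetricSpace E] [MeasurableSpace E]
    [OpensMeasurableSpace E] [TopologicalSpace.SeparableSpace E]
    {μ : ℕ → ProbabilityMeasure E} {P : ProbabilityMeasure E} (h : Tendsto μ atTop (𝓝 P))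
    {δ : ℝ} (hδ : 0 < δ) :
    ∀ᶠ n in atTop, ∀ B, MeasurableSet B →
      (μ n : Measure E).real B ≤ (P : Measure E).real (Metric.thickening δ B) + δ := by
  have h1 := (LevyProkhorov.probabilityMeasureHomeomorph (Ω := E)).continuous.continuousAt.tendsto.comp h
  have h2 := (EMetric.tendsto_nhds.1 h1) (ENNReal.ofReal δ) (by simpa using hδ)
  filter_upwards [h2] with n hn B hB
  have h3 : levyProkhorovEDist (μ n : Measure E) (P : Measure E) < ENNReal.ofReal δ := hn
  have h4 := left_measure_le_of_levyProkhorovEDist_lt h3 hB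
  rw [ENNReal.toReal_ofReal hδ.le] at h4
  have h5 := ENNReal.toReal_mono (by finiteness) h4
  rwa [ENNReal.toReal_add (by finiteness) (by finiteness), ENNReal.toReal_ofReal hδ.le] at h5

/-! ### Medians of laws on the line -/

theorem half_le_iff_real {ν : Measure ℝ} [IsFiniteMeasure ν] {s : Set ℝ} :
    1 / 2 ≤ ν s ↔ 1 / 2 ≤ ν.real s := by
  rw [measureReal_def, ← ENNReal.ofReal_le_iff_le_toReal (by finiteness)]
  norm_num [ENNReal.ofReal_div_of_pos]

theorem real_Ioi_eq_one_sub {ν : Measure ℝ} [IsProbabilityMeasure ν] (a : ℝ) :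
    ν.real (Set.Ioi a) = 1 - ν.real (Set.Iic a) := by
  rw [← Set.compl_Iic, probReal_compl_eq_one_sub measurableSet_Iic]

theorem real_Ici_eq_one_sub {ν : Measure ℝ} [IsProbabilityMeasure ν] (a : ℝ) :
    ν.real (Set.Ici a) = 1 - ν.real (Set.Iio a) := by
  rw [← Set.compl_Iio, probReal_compl_eq_one_sub measurableSet_Iio]

theorem exists_lt_real_Iic (ν : Measure ℝ) [IsProbabilityMeasure ν] {c : ℝ} (hc : c < 1) :
    ∃ t, c < ν.real (Set.Iic t) := by
  have := (tendsto_cdf_atTop ν).eventually_const_lt hc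
  obtain ⟨t, ht⟩ := this.exists
  exact ⟨t, by rwa [cdf_eq_real] at ht⟩

theorem exists_real_Iic_lt (ν : Measure ℝ) [IsProbabilityMeasure ν] {c : ℝ} (hc : 0 < c) :
    ∃ t, ν.real (Set.Iic t) < c := by
  have := (tendsto_cdf_atBot ν).eventually_lt_const hc
  obtain ⟨t, ht⟩ := this.exists
  exact ⟨t, by rwa [cdf_eq_real] at ht⟩

theorem lowerMedianSet_nonempty (ν : Measure ℝ) [IsProbabilityMeasure ν] :
    {t : ℝ | 1 / 2 ≤ ν (Set.Iic t)}.Nonempty := by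
  obtain ⟨t, ht⟩ := exists_lt_real_Iic ν (c := 1 / 2) (by norm_num)
  exact ⟨t, half_le_iff_real.2 ht.le⟩

theorem lowerMedianSet_bddBelow (ν : Measure ℝ) [IsProbabilityMeasure ν] :
    BddBelow {t : ℝ | 1 / 2 ≤ ν (Set.Iic t)} := by
  obtain ⟨t, ht⟩ := exists_real_Iic_lt ν (c := 1 / 2) (by norm_num)
  refine ⟨t, fun s hs => le_of_not_gt fun hst => ?_⟩
  have h1 : ν.real (Set.Iic s) ≤ ν.real (Set.Iic t) := measureReal_mono (Set.Iic_subset_Iic.2 hst.le)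
  have h2 := half_le_iff_real.1 hs
  linarith

theorem upperMedianSet_nonempty (ν : Measure ℝ) [IsProbabilityMeasure ν] :
    {t : ℝ | 1 / 2 ≤ ν (Set.Ici t)}.Nonempty := by
  obtain ⟨t, ht⟩ := exists_real_Iic_lt ν (c := 1 / 2) (by norm_num)
  refine ⟨t, half_le_iff_real.2 ?_⟩
  have h1 : ν.real (Set.Ioi t) ≤ ν.real (Set.Ici t) := measureReal_mono Set.Ioi_subset_Ici_self
  rw [real_Ioi_eq_one_sub] at h1
  linarith

theorem upperMedianSet_bddAbove (ν : Measure ℝ) [IsProbabilityMeasure ν] :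
    BddAbove {t : ℝ | 1 / 2 ≤ ν (Set.Ici t)} := by
  obtain ⟨t, ht⟩ := exists_lt_real_Iic ν (c := 1 / 2) (by norm_num)
  refine ⟨t, fun s hs => le_of_not_gt fun hst => ?_⟩
  have h1 : ν.real (Set.Ici s) ≤ ν.real (Set.Ioi t) :=
    measureReal_mono (Set.Ici_subset_Ioi.2 hst)
  rw [real_Ioi_eq_one_sub] at h1
  have h2 := half_le_iff_real.1 hs
  linarith

theorem le_median {ν : Measure ℝ} [IsProbabilityMeasure ν] {a : ℝ}
    (h : ν.real (Set.Iic a) < 1 / 2) : a ≤ median ν := by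
  have h1 : a ≤ sInf {t : ℝ | 1 / 2 ≤ ν (Set.Iic t)} := by
    refine le_csInf (lowerMedianSet_nonempty ν) fun t ht => le_of_not_gt fun hta => ?_
    have h2 : ν.real (Set.Iic t) ≤ ν.real (Set.Iic a) :=
      measureReal_mono (Set.Iic_subset_Iic.2 hta.le)
    have h3 := half_le_iff_real.1 ht
    linarith
  have h2 : a ≤ sSup {t : ℝ | 1 / 2 ≤ ν (Set.Ici t)} := by
    refine le_csSup (upperMedianSet_bddAbove ν) (half_le_iff_real.2 ?_)
    have h1 : ν.real (Set.Ioi a) ≤ ν.real (Set.Ici a) := measureReal_mono Set.Ioi_subset_Ici_self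
    rw [real_Ioi_eq_one_sub] at h1
    linarith
  unfold median
  linarith

theorem median_le {ν : Measure ℝ} [IsProbabilityMeasure ν] {b : ℝ}
    (h : ν.real (Set.Ici b) < 1 / 2) : median ν ≤ b := by
  have h1 : sSup {t : ℝ | 1 / 2 ≤ ν (Set.Ici t)} ≤ b := by
    refine csSup_le (upperMedianSet_nonempty ν) fun t ht => le_of_not_gt fun hta => ?_
    have h2 : ν.real (Set.Ici t) ≤ ν.real (Set.Ici b) :=
      measureReal_mono (Set.Ici_subset_Ici.2 hta.le)
    have h3 := half_le_iff_real.1 ht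
    linarith
  have h2 : sInf {t : ℝ | 1 / 2 ≤ ν (Set.Iic t)} ≤ b := by
    refine csInf_le (lowerMedianSet_bddBelow ν) (half_le_iff_real.2 ?_)
    have h1 : ν.real (Set.Iio b) ≤ ν.real (Set.Iic b) := measureReal_mono Set.Iio_subset_Iic_self
    rw [real_Ici_eq_one_sub] at h
    linarith
  unfold median
  linarith

theorem median_map_affine (ν : Measure ℝ) [IsProbabilityMeasure ν] {a : ℝ} (ha : 0 < a) (b : ℝ) :
    median (ν.map fun t => a * t + b) = a * median ν + b := by
  have hm : Measurable fun t : ℝ => a * t + b := by fun_prop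
  have hmono : Monotone fun t : ℝ => a * t + b := fun s t hst => by
    have := mul_le_mul_of_nonneg_left hst ha.le
    simpa using this
  have hc : Continuous fun t : ℝ => a * t + b := by fun_prop
  have e1 : {t : ℝ | 1 / 2 ≤ (ν.map fun t => a * t + b) (Set.Iic t)} =
      (fun t => a * t + b) '' {t : ℝ | 1 / 2 ≤ ν (Set.Iic t)} := by
    ext t
    simp only [Set.mem_ofPred_eq, Set.mem_image]
    rw [Measure.map_apply hm measurableSet_Iic]
    have hpre : (fun t => a * t + b) ⁻¹' Set.Iic t = Set.Iic ((t - b) / a) := by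
      ext s
      simp only [Set.mem_preimage, Set.mem_Iic]
      rw [le_div_iff₀ ha]
      constructor <;> intro h <;> linarith
    rw [hpre]
    constructor
    · intro h
      exact ⟨_, h, by field_simp; ring⟩
    · rintro ⟨s, hs, rfl⟩
      convert! hs using 3
      field_simp; ring
  have e2 : {t : ℝ | 1 / 2 ≤ (ν.map fun t => a * t + b) (Set.Ici t)} =
      (fun t => a * t + b) '' {t : ℝ | 1 / 2 ≤ ν (Set.Ici t)} := by
    ext t
    simp only [Set.mem_ofPred_eq, Set.mem_image]
    rw [Measure.map_apply hm measurableSet_Ici]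
    have hpre : (fun t => a * t + b) ⁻¹' Set.Ici t = Set.Ici ((t - b) / a) := by
      ext s
      simp only [Set.mem_preimage, Set.mem_Ici]
      rw [div_le_iff₀ ha]
      constructor <;> intro h <;> linarith
    rw [hpre]
    constructor
    · intro h
      exact ⟨_, h, by field_simp; ring⟩
    · rintro ⟨s, hs, rfl⟩
      convert! hs using 3
      field_simp; ring
  unfold median
  rw [e1, e2, ← hmono.map_csInf_of_continuousAt hc.continuousAt (lowerMedianSet_nonempty ν)
    (lowerMedianSet_bddBelow ν), ← hmono.map_csSup_of_continuousAt hc.continuousAt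
    (upperMedianSet_nonempty ν) (upperMedianSet_bddAbove ν)]
  ring

theorem mad_map_affine (ν : Measure ℝ) [IsProbabilityMeasure ν] {a : ℝ} (ha : 0 < a) (b : ℝ) :
    mad (ν.map fun t => a * t + b) = a * mad ν := by
  have hm : Measurable fun t : ℝ => |t - median ν| := by fun_prop
  have : IsProbabilityMeasure (ν.map fun t => |t - median ν|) :=
    Measure.isProbabilityMeasure_map hm.aemeasurable
  unfold mad
  rw [median_map_affine ν ha b, Measure.map_map (by fun_prop) (by fun_prop)]
  have h := median_map_affine (ν.map fun t => |t - median ν|) ha 0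
  rw [Measure.map_map (by fun_prop) hm, add_zero] at h
  rw [← h]
  congr 2
  ext t
  simp only [Function.comp_apply, add_zero]
  rw [show a * t + b - (a * median ν + b) = a * (t - median ν) by ring, abs_mul, abs_of_pos ha]

/-! ### Atomless laws on the line -/

theorem continuous_real_Iic (ν : Measure ℝ) [IsProbabilityMeasure ν] [NullSingletonClass ν] :
    Continuous fun t => ν.real (Set.Iic t) := by
  have h : Continuous (cdf ν) := by
    refine continuous_iff_continuousAt.2 fun t => ?_
    have h1 := (cdf ν).measure_singleton t
    rw [measure_cdf, measure_singleton, eq_comm, ENNReal.ofReal_eq_zero] at h1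
    rw [(cdf ν).mono.continuousAt_iff_leftLim_eq_rightLim, (cdf ν).rightLim_eq]
    exact le_antisymm ((cdf ν).mono.leftLim_le le_rfl) (by linarith)
  convert! h using 2 with t
  rw [cdf_eq_real]

theorem exists_real_Iic_eq (ν : Measure ℝ) [IsProbabilityMeasure ν] [NullSingletonClass ν]
    {β : ℝ} (h0 : 0 < β) (h1 : β < 1) : ∃ t, ν.real (Set.Iic t) = β := by
  obtain ⟨a, ha⟩ := exists_real_Iic_lt ν h0
  obtain ⟨b, hb⟩ := exists_lt_real_Iic ν h1
  exact mem_range_of_exists_le_of_exists_ge (continuous_real_Iic ν) ⟨a, ha.le⟩ ⟨b, hb.le⟩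

theorem real_Icc_eq_sub (ν : Measure ℝ) [IsProbabilityMeasure ν] [NullSingletonClass ν]
    {a b : ℝ} (h : a ≤ b) : ν.real (Set.Icc a b) = ν.real (Set.Iic b) - ν.real (Set.Iic a) := by
  have h1 : ν.real (Set.Icc a b) = ν.real (Set.Ioc a b) :=
    measureReal_congr Ioc_ae_eq_Icc.symm
  rw [h1, ← Set.Iic_sdiff_Iic, measureReal_sdiff (Set.Iic_subset_Iic.2 h) measurableSet_Iic]

/-- An atomless law on the line gives uniformly small mass to short intervals. -/
theorem exists_forall_real_Icc_le (ν : Measure ℝ) [IsProbabilityMeasure ν] [NullSingletonClass ν]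
    {ε : ℝ} (hε : 0 < ε) : ∃ δ > 0, ∀ c, ν.real (Set.Icc (c - δ) (c + δ)) ≤ ε := by
  obtain ⟨a, ha⟩ := exists_real_Iic_lt ν hε
  obtain ⟨b, hb⟩ := exists_lt_real_Iic ν (c := 1 - ε) (by linarith)
  have huc := (isCompact_Icc (a := a - 2) (b := b + 2)).uniformContinuousOn_of_continuous
    (continuous_real_Iic ν).continuousOn
  obtain ⟨δ, hδ, huc⟩ := Metric.uniformContinuousOn_iff.1 huc ε hε
  refine ⟨min (δ / 3) 1, by positivity, fun c => ?_⟩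
  set η := min (δ / 3) 1 with hη
  have hη0 : 0 < η := by positivity
  have hη1 : η ≤ 1 := min_le_right _ _
  have hηδ : η ≤ δ / 3 := min_le_left _ _
  rw [real_Icc_eq_sub ν (by linarith)]
  have hmono : Monotone fun t => ν.real (Set.Iic t) := fun s t hst =>
    measureReal_mono (Set.Iic_subset_Iic.2 hst)
  by_cases h1 : b ≤ c - η
  · have := hmono h1
    have h2 : ν.real (Set.Iic (c + η)) ≤ 1 := measureReal_le_one
    simp only at this
    linarith
  by_cases h3 : c + η ≤ a
  · have := hmono h3
    have h2 : 0 ≤ ν.real (Set.Iic (c - η)) := measureReal_nonneg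
    simp only at this
    linarith
  push Not at h1 h3
  have := huc (c + η) ⟨by linarith, by linarith⟩ (c - η) ⟨by linarith, by linarith⟩
    (by rw [Real.dist_eq, abs_of_pos] <;> linarith)
  rw [Real.dist_eq] at this
  exact (le_abs_self _).trans this.le

/-! ### Spherical laws -/

/-- `P` is the spherical law with Lebesgue density `g (‖x‖ ^ 2)`, where `g` is nonnegative and
non-increasing on `[0, ∞)`. -/
structure IsSpherical {E : Type*} [NormedAddCommGroup E] [InnerProductSpace ℝ E]
    [FiniteDimensional ℝ E] [MeasurableSpace E] [BorelSpace E] (g : ℝ → ℝ) (P : Measure E) :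
    Prop where
  nonneg : ∀ s, 0 ≤ s → 0 ≤ g s
  antitone : AntitoneOn g (Set.Ici 0)
  prob : IsProbabilityMeasure P
  density : P = volume.withDensity fun x => ENNReal.ofReal (g (‖x‖ ^ 2))

theorem real_neg_Iic {ν : Measure ℝ} (hsymm : ν.map Neg.neg = ν) (a : ℝ) :
    ν.real (Set.Iic (-a)) = ν.real (Set.Ici a) := by
  conv_rhs => rw [← hsymm]
  rw [measureReal_def, measureReal_def, Measure.map_apply measurable_neg measurableSet_Ici]
  congr 2
  ext t
  simp

/-- A symmetric atomless law on the line without gaps in its support puts less than half of its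
mass on each of the half-lines beyond `ε > 0`, so that `0` is its only median. -/
theorem real_Ici_lt_half {ν : Measure ℝ} [IsProbabilityMeasure ν] [NullSingletonClass ν]
    (hsymm : ν.map Neg.neg = ν)
    (hgap : ∀ a b, 0 ≤ a → a < b → 0 < ν (Set.Ioi a) → 0 < ν (Set.Ioo a b)) {ε : ℝ} (hε : 0 < ε) :
    ν.real (Set.Ici ε) < 1 / 2 := by
  have h0 : ν.real (Set.Iic 0) = ν.real (Set.Ici 0) := by simpa using real_neg_Iic hsymm 0
  have h1 : ν.real (Set.Ioi 0) = ν.real (Set.Ici 0) := measureReal_congr Ioi_ae_eq_Ici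
  have h2 := real_Ioi_eq_one_sub (ν := ν) 0
  have h3 : ν.real (Set.Ioi 0) = 1 / 2 := by linarith
  have h4 : 0 < ν (Set.Ioi 0) := by
    rw [pos_iff_ne_zero]
    intro h
    rw [measureReal_def, h] at h3
    norm_num at h3
  have h5 : 0 < ν.real (Set.Ioo 0 ε) :=
    ENNReal.toReal_pos (hgap 0 ε le_rfl hε h4).ne' (by finiteness)
  have h6 : ν.real (Set.Ioi 0) = ν.real (Set.Ioo 0 ε) + ν.real (Set.Ici ε) := by
    rw [← measureReal_union (by
      rw [Set.disjoint_left]; intro t ht ht'; exact absurd ht.2 (not_lt.2 ht')) measurableSet_Ici,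
      Set.Ioo_union_Ici_eq_Ioi hε]
  linarith

/-- The absolute value of a symmetric atomless law without gaps has a unique positive median. -/
theorem exists_median_abs {ν : Measure ℝ} [IsProbabilityMeasure ν] [NullSingletonClass ν]
    (hsymm : ν.map Neg.neg = ν)
    (hgap : ∀ a b, 0 ≤ a → a < b → 0 < ν (Set.Ioi a) → 0 < ν (Set.Ioo a b)) :
    ∃ κ > 0, ∀ ε > 0, ν.real {t | |t| ≤ κ - ε} < 1 / 2 ∧ ν.real {t | κ + ε ≤ |t|} < 1 / 2 := by
  obtain ⟨κ, hκ⟩ := exists_real_Iic_eq ν (β := 3 / 4) (by norm_num) (by norm_num)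
  have hIoi : ν.real (Set.Ioi κ) = 1 / 4 := by rw [real_Ioi_eq_one_sub, hκ]; norm_num
  have h0 : ν.real (Set.Iic 0) = ν.real (Set.Ici 0) := by simpa using real_neg_Iic hsymm 0
  have h1 : ν.real (Set.Ioi 0) = ν.real (Set.Ici 0) := measureReal_congr Ioi_ae_eq_Ici
  have h2 := real_Ioi_eq_one_sub (ν := ν) 0
  have hκ0 : 0 < κ := by
    by_contra hneg
    have := measureReal_mono (μ := ν) (Set.Iic_subset_Iic.2 (not_lt.1 hneg))
    linarith
  have hpos : ∀ a, a ≤ κ → 0 < ν (Set.Ioi a) := fun a ha => by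
    refine lt_of_lt_of_le ?_ (measure_mono (Set.Ioi_subset_Ioi ha))
    rw [pos_iff_ne_zero]
    intro h
    rw [measureReal_def, h] at hIoi
    norm_num at hIoi
  refine ⟨κ, hκ0, fun ε hε => ⟨?_, ?_⟩⟩
  · by_cases hneg : κ - ε < 0
    · have : {t : ℝ | |t| ≤ κ - ε} = ∅ := by
        ext t
        simp only [Set.mem_ofPred_eq, Set.mem_empty_iff_false, iff_false, not_le]
        exact hneg.trans_le (abs_nonneg t)
      rw [this]; norm_num
    · push Not at hneg
      have h3 : {t : ℝ | |t| ≤ κ - ε} = Set.Icc (-(κ - ε)) (κ - ε) := by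
        ext t; simp [abs_le]
      have h4 : 0 < ν.real (Set.Ioo (κ - ε) κ) :=
        ENNReal.toReal_pos (hgap _ _ hneg (by linarith) (hpos _ (by linarith))).ne' (by finiteness)
      have h5 : ν.real (Set.Ioo (κ - ε) κ) ≤ ν.real (Set.Icc (κ - ε) κ) :=
        measureReal_mono Set.Ioo_subset_Icc_self
      rw [real_Icc_eq_sub ν (by linarith)] at h5
      rw [h3, real_Icc_eq_sub ν (by linarith), real_neg_Iic hsymm, real_Ici_eq_one_sub]
      have h6 : ν.real (Set.Iio (κ - ε)) = ν.real (Set.Iic (κ - ε)) :=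
        measureReal_congr Iio_ae_eq_Iic
      linarith
  · have h3 : {t : ℝ | κ + ε ≤ |t|} = Set.Iic (-(κ + ε)) ∪ Set.Ici (κ + ε) := by
      ext t
      simp only [Set.mem_ofPred_eq, le_abs, Set.mem_union, Set.mem_Iic, Set.mem_Ici]
      constructor
      · rintro (h | h)
        · right; exact h
        · left; linarith
      · rintro (h | h)
        · right; linarith
        · left; exact h
    have h4 : 0 < ν.real (Set.Ioo κ (κ + ε)) :=
      ENNReal.toReal_pos (hgap _ _ hκ0.le (by linarith) (hpos _ le_rfl)).ne' (by finiteness)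
    have h5 : ν.real (Set.Ioo κ (κ + ε)) ≤ ν.real (Set.Icc κ (κ + ε)) :=
      measureReal_mono Set.Ioo_subset_Icc_self
    rw [real_Icc_eq_sub ν (by linarith)] at h5
    have h6 : ν.real (Set.Iio (κ + ε)) = ν.real (Set.Iic (κ + ε)) :=
      measureReal_congr Iio_ae_eq_Iic
    have h7 := measureReal_union_le (μ := ν) (Set.Iic (-(κ + ε))) (Set.Ici (κ + ε))
    rw [real_neg_Iic hsymm, real_Ici_eq_one_sub, h6] at h7
    rw [h3]
    linarith

theorem measurable_comp_norm_sq {E : Type*} [NormedAddCommGroup E] [MeasurableSpace E]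
    [OpensMeasurableSpace E] {g : ℝ → ℝ} (hg : AntitoneOn g (Set.Ici 0)) :
    Measurable fun x : E => g (‖x‖ ^ 2) := by
  have h1 : Antitone fun t : ℝ => g (max t 0) := fun s t hst =>
    hg (Set.mem_Ici.2 (le_max_right _ _)) (Set.mem_Ici.2 (le_max_right _ _))
      (max_le_max_right 0 hst)
  have h2 : (fun x : E => g (‖x‖ ^ 2)) = (fun t : ℝ => g (max t 0)) ∘ fun x : E => ‖x‖ ^ 2 := by
    ext x
    simp
  rw [h2]
  exact h1.measurable.comp (by fun_prop)

namespace IsSpherical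

variable {E : Type*} [NormedAddCommGroup E] [InnerProductSpace ℝ E]
    [FiniteDimensional ℝ E] [MeasurableSpace E] [BorelSpace E] {g : ℝ → ℝ} {P : Measure E}

theorem measurable_density (hP : IsSpherical g P) : Measurable fun x : E => g (‖x‖ ^ 2) :=
  measurable_comp_norm_sq hP.antitone

theorem absolutelyContinuous (hP : IsSpherical g P) : P ≪ volume := by
  rw [hP.density]; exact withDensity_absolutelyContinuous _ _

theorem measure_pos_of_isOpen (hP : IsSpherical g P) {U : Set E} (hU : IsOpen U)
    (hne : U.Nonempty) (hg : ∀ x ∈ U, 0 < g (‖x‖ ^ 2)) : 0 < P U := by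
  rw [pos_iff_ne_zero]
  intro h0
  rw [hP.density, withDensity_apply _ hU.measurableSet,
    setLIntegral_eq_zero_iff hU.measurableSet hP.measurable_density.ennreal_ofReal] at h0
  have h1 : volume U = 0 := by
    refine measure_mono_null (fun x hx => ?_) h0
    simp only [Set.mem_compl_iff, Set.mem_ofPred_eq, Classical.not_imp]
    exact ⟨hx, by simpa using hg x hx⟩
  exact (hU.measure_pos volume hne).ne' h1

theorem map_linearIsometryEquiv (hP : IsSpherical g P) (U : E ≃ₗᵢ[ℝ] E) : P.map U = P := by
  have hU := U.measurePreserving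
  ext s hs
  rw [Measure.map_apply U.continuous.measurable hs]
  conv_lhs => rw [hP.density]
  conv_rhs => rw [hP.density]
  rw [withDensity_apply _ hs, withDensity_apply _ (U.continuous.measurable hs),
    ← hU.setLIntegral_comp_preimage hs hP.measurable_density.ennreal_ofReal]
  simp

/-- All one-dimensional projections of a spherical law on unit vectors agree. -/
theorem map_inner_eq (hP : IsSpherical g P) {u v : E} (h : ‖u‖ = ‖v‖) :
    P.map (fun x => inner ℝ u x) = P.map fun x => inner ℝ v x := by
  set U := (ℝ ∙ (u - v))ᗮ.reflection with hU
  have hUu : U u = v := Submodule.reflection_sub h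
  conv_lhs => rw [← hP.map_linearIsometryEquiv U]
  rw [Measure.map_map (by fun_prop) U.continuous.measurable]
  congr 1
  ext x
  rw [Function.comp_apply, ← hUu, ← U.inner_map_map (U u) x]
  congr 1
  rw [hU, Submodule.reflection_reflection]

theorem map_inner_symm (hP : IsSpherical g P) (u : E) :
    (P.map fun x => inner ℝ u x).map Neg.neg = P.map fun x => inner ℝ u x := by
  rw [Measure.map_map measurable_neg (by fun_prop),
    hP.map_inner_eq (u := u) (v := -u) (by simp)]
  congr 1
  ext x
  simp

theorem nullSingletonClass_map_inner (hP : IsSpherical g P) {u : E} (hu : u ≠ 0) :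
    NullSingletonClass (P.map fun x => inner ℝ u x) := by
  constructor
  intro c
  rw [Measure.map_apply (by fun_prop) (measurableSet_singleton c)]
  refine hP.absolutelyContinuous ?_
  -- the hyperplane is a translate of the kernel of the functional
  obtain ⟨x₀, hx₀⟩ : ∃ x₀ : E, inner ℝ u x₀ = c :=
    ⟨(c / ‖u‖ ^ 2) • u, by
      rw [inner_smul_right, real_inner_self_eq_norm_sq]
      field_simp [norm_ne_zero_iff.2 hu]⟩
  have hpre : (fun x : E => inner ℝ u x) ⁻¹' {c} =
      (fun x => x + -x₀) ⁻¹' ((ℝ ∙ u)ᗮ : Submodule ℝ E) := by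
    ext x
    simp only [Set.mem_preimage, Set.mem_singleton_iff, SetLike.mem_coe,
      Submodule.mem_orthogonal_singleton_iff_inner_right, inner_add_right, inner_neg_right, hx₀]
    constructor <;> intro h <;> linarith
  rw [hpre, measure_preimage_add_right]
  refine Measure.addHaar_submodule _ _ fun htop => hu ?_
  have : u ∈ (ℝ ∙ u)ᗮ := htop ▸ Submodule.mem_top
  rwa [Submodule.mem_orthogonal_singleton_iff_inner_right, inner_self_eq_zero] at this

/-- The support of a one-dimensional marginal has no gaps on the positive half-line. -/
theorem map_inner_gap (hP : IsSpherical g P) {u : E} (hu : ‖u‖ = 1) (a b : ℝ) (ha : 0 ≤ a)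
    (hab : a < b) (hpos : 0 < (P.map fun x => inner ℝ u x) (Set.Ioi a)) :
    0 < (P.map fun x => inner ℝ u x) (Set.Ioo a b) := by
  have hmeas : Measurable fun x : E => inner ℝ u x := by fun_prop
  rw [Measure.map_apply hmeas measurableSet_Ioi] at hpos
  rw [Measure.map_apply hmeas measurableSet_Ioo]
  -- some point of the half-space carries positive density
  obtain ⟨x, hxa, hxg⟩ : ∃ x : E, a < inner ℝ u x ∧ 0 < g (‖x‖ ^ 2) := by
    by_contra! hno
    refine hpos.ne' ?_
    rw [hP.density, withDensity_apply _ (hmeas measurableSet_Ioi),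
      setLIntegral_eq_zero_iff (hmeas measurableSet_Ioi) hP.measurable_density.ennreal_ofReal]
    exact ae_of_all _ fun x hx => by simpa using hno x hx
  have hxn : inner ℝ u x ≤ ‖x‖ := by simpa [hu] using real_inner_le_norm u x
  have hsub : (fun y : E => inner ℝ u y) ⁻¹' Set.Ioo a b ∩ Metric.ball 0 ‖x‖ ⊆
      (fun y : E => inner ℝ u y) ⁻¹' Set.Ioo a b := Set.inter_subset_left
  refine lt_of_lt_of_le (hP.measure_pos_of_isOpen ?_ ?_ ?_) (measure_mono hsub)
  · exact (isOpen_Ioo.preimage (by fun_prop)).inter Metric.isOpen_ball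
  · obtain ⟨t, hat, htb⟩ := exists_between (lt_min hab (hxa.trans_le hxn))
    refine ⟨t • u, ⟨?_, ?_⟩⟩
    · simp only [Set.mem_preimage, inner_smul_right, real_inner_self_eq_norm_sq, hu]
      exact ⟨by linarith, by linarith [htb.trans_le (min_le_left b ‖x‖)]⟩
    · rw [mem_ball_zero_iff, norm_smul, hu, mul_one, Real.norm_eq_abs,
        abs_of_nonneg (ha.trans hat.le)]
      exact htb.trans_le (min_le_right _ _)
  · rintro y ⟨-, hy⟩
    rw [mem_ball_zero_iff] at hy
    refine hxg.trans_le (hP.antitone ?_ ?_ ?_)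
    · exact Set.mem_Ici.2 (by positivity)
    · exact Set.mem_Ici.2 (by positivity)
    · gcongr

theorem nullSingletonClass [Nontrivial E] (hP : IsSpherical g P) : NullSingletonClass P :=
  ⟨fun x => hP.absolutelyContinuous (measure_singleton x)⟩

theorem nullSingletonClass_map_norm [Nontrivial E] (hP : IsSpherical g P) :
    NullSingletonClass (P.map fun x => ‖x‖) := by
  constructor
  intro c
  rw [Measure.map_apply (by fun_prop) (measurableSet_singleton c)]
  refine hP.absolutelyContinuous ?_
  have : (fun x : E => ‖x‖) ⁻¹' {c} = Metric.sphere 0 c := by ext x; simp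
  rw [this]
  exact Measure.addHaar_sphere _ _ _

theorem real_sphere_eq_zero [Nontrivial E] (hP : IsSpherical g P) (ρ : ℝ) :
    P (Metric.sphere 0 ρ) = 0 :=
  hP.absolutelyContinuous (Measure.addHaar_sphere _ _ _)

/-- Every probability in `(0, 1)` is that of a ball about the centre. -/
theorem exists_real_closedBall_eq [Nontrivial E] (hP : IsSpherical g P) {β : ℝ} (h0 : 0 < β)
    (h1 : β < 1) : ∃ ρ > 0, P.real (Metric.closedBall 0 ρ) = β := by
  have := hP.prob
  have := hP.nullSingletonClass_map_norm
  have := hP.nullSingletonClass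
  have hm : Measurable fun x : E => ‖x‖ := by fun_prop
  have : IsProbabilityMeasure (P.map fun x : E => ‖x‖) :=
    Measure.isProbabilityMeasure_map hm.aemeasurable
  obtain ⟨ρ, hρ⟩ := exists_real_Iic_eq (P.map fun x : E => ‖x‖) h0 h1
  have hpre : (fun x : E => ‖x‖) ⁻¹' Set.Iic ρ = Metric.closedBall 0 ρ := by ext x; simp
  rw [measureReal_def, Measure.map_apply hm measurableSet_Iic, hpre, ← measureReal_def] at hρ
  refine ⟨ρ, ?_, hρ⟩
  by_contra hneg
  have hz : P.real (Metric.closedBall (0 : E) ρ) ≤ P.real {(0 : E)} := by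
    refine measureReal_mono fun x hx => ?_
    have h3 : ‖x‖ ≤ ρ := by simpa using hx
    have h4 : ‖x‖ = 0 := le_antisymm (by linarith) (norm_nonneg x)
    simpa using h4
  rw [measureReal_def, measureReal_def, measure_singleton, ← measureReal_def, hρ] at hz
  simp at hz
  linarith

end IsSpherical

/-! ### Projection depth under weak convergence to a spherical law -/

theorem thickening_preimage_inner_subset {E : Type*} [NormedAddCommGroup E]
    [InnerProductSpace ℝ E] {u : E} (hu : ‖u‖ = 1) (δ : ℝ) (A : Set ℝ) :
    Metric.thickening δ ((fun x => inner ℝ u x) ⁻¹' A) ⊆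
      (fun x => inner ℝ u x) ⁻¹' Metric.thickening δ A := by
  intro x hx
  rw [Metric.mem_thickening_iff] at hx
  obtain ⟨z, hz, hxz⟩ := hx
  rw [Set.mem_preimage, Metric.mem_thickening_iff]
  refine ⟨inner ℝ u z, hz, lt_of_le_of_lt ?_ hxz⟩
  rw [Real.dist_eq, ← inner_sub_right, dist_eq_norm]
  simpa [hu] using abs_real_inner_le_norm u (x - z)

/-- Under weak convergence to a spherical law, all one-dimensional projections satisfy the
Lévy-Prokhorov bound simultaneously. -/
theorem eventually_map_inner_real_le {E : Type*} [NormedAddCommGroup E] [InnerProductSpace ℝ E]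
    [FiniteDimensional ℝ E] [MeasurableSpace E] [BorelSpace E] {g : ℝ → ℝ}
    {P : ProbabilityMeasure E} (hP : IsSpherical g (P : Measure E)) {μ : ℕ → ProbabilityMeasure E}
    (hμ : Tendsto μ atTop (𝓝 P)) {e : E} (he : ‖e‖ = 1) {δ : ℝ} (hδ : 0 < δ) :
    ∀ᶠ n in atTop, ∀ u : E, ‖u‖ = 1 → ∀ A : Set ℝ, MeasurableSet A →
      ((μ n : Measure E).map fun x => inner ℝ u x).real A ≤
        ((P : Measure E).map fun x => inner ℝ e x).real (Metric.thickening δ A) + δ := by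
  filter_upwards [eventually_real_le_thickening_add hμ hδ] with n hn u hu A hA
  have hm : Measurable fun x : E => inner ℝ u x := by fun_prop
  rw [hP.map_inner_eq (he.trans hu.symm), map_measureReal_apply hm hA,
    map_measureReal_apply hm Metric.isOpen_thickening.measurableSet]
  refine (hn _ (hm hA)).trans (add_le_add ?_ le_rfl)
  exact measureReal_mono (thickening_preimage_inner_subset hu δ A)

theorem mem_thickening_real {δ t : ℝ} {A : Set ℝ} :
    t ∈ Metric.thickening δ A ↔ ∃ s ∈ A, |t - s| < δ := by
  simp [Metric.mem_thickening_iff, Real.dist_eq]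

section
variable {E : Type*} [NormedAddCommGroup E] [InnerProductSpace ℝ E]
  [FiniteDimensional ℝ E] [MeasurableSpace E] [BorelSpace E]

theorem isProbabilityMeasure_map_inner (Q : Measure E) [IsProbabilityMeasure Q] (u : E) :
    IsProbabilityMeasure (Q.map fun x => inner ℝ u x) :=
  Measure.isProbabilityMeasure_map (by fun_prop)

theorem eventually_abs_median_le {g : ℝ → ℝ} {P : ProbabilityMeasure E}
    (hP : IsSpherical g (P : Measure E)) {μ : ℕ → ProbabilityMeasure E}
    (hμ : Tendsto μ atTop (𝓝 P)) {ε : ℝ} (hε : 0 < ε) :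
    ∀ᶠ n in atTop, ∀ u : E, ‖u‖ = 1 →
      |median ((μ n : Measure E).map fun x => inner ℝ u x)| ≤ ε := by
  by_cases hne : ∃ e : E, ‖e‖ = 1
  swap
  · exact Eventually.of_forall fun n u hu => absurd ⟨u, hu⟩ hne
  obtain ⟨e, he⟩ := hne
  have he0 : e ≠ 0 := by rintro rfl; simp at he
  have := isProbabilityMeasure_map_inner (P : Measure E) e
  have := hP.nullSingletonClass_map_inner he0
  have hq := real_Ici_lt_half (hP.map_inner_symm e) (hP.map_inner_gap he) (half_pos hε)
  set ν := (P : Measure E).map fun x => inner ℝ e x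
  set q := ν.real (Set.Ici (ε / 2))
  have hδ : 0 < min (ε / 2) ((1 / 2 - q) / 2) := lt_min (by positivity) (by linarith)
  have hupper : ∀ᶠ n in atTop, ∀ u : E, ‖u‖ = 1 →
      ((μ n : Measure E).map fun x => inner ℝ u x).real (Set.Ici ε) < 1 / 2 := by
    filter_upwards [eventually_map_inner_real_le hP hμ he hδ] with n hn u hu
    have h1 := hn u hu (Set.Ici ε) measurableSet_Ici
    have h2 : ν.real (Metric.thickening (min (ε / 2) ((1 / 2 - q) / 2)) (Set.Ici ε)) ≤ q := by
      refine measureReal_mono fun t ht => ?_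
      obtain ⟨s, hs, hts⟩ := mem_thickening_real.1 ht
      have h3 := (abs_lt.1 hts).1
      have h4 := min_le_left (ε / 2) ((1 / 2 - q) / 2)
      rw [Set.mem_Ici] at hs ⊢
      linarith
    have h4 := min_le_right (ε / 2) ((1 / 2 - q) / 2)
    linarith
  filter_upwards [hupper] with n hn u hu
  have := isProbabilityMeasure_map_inner (μ n : Measure E) u
  rw [abs_le]
  refine ⟨le_median ?_, median_le (hn u hu)⟩
  have h1 := hn (-u) (by simpa using hu)
  rw [map_measureReal_apply (by fun_prop) measurableSet_Ici] at h1
  rw [map_measureReal_apply (by fun_prop) measurableSet_Iic]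
  have hset : (fun x : E => inner ℝ u x) ⁻¹' Set.Iic (-ε) =
      (fun x : E => inner ℝ (-u) x) ⁻¹' Set.Ici ε := by
    ext x
    simp only [Set.mem_preimage, Set.mem_Iic, Set.mem_Ici, inner_neg_left]
    constructor <;> intro h <;> linarith
  rwa [hset]

/-- Bounds for the median absolute deviation, in terms of the masses of two symmetric sets. -/
theorem abs_mad_sub_le {ν : Measure ℝ} [IsProbabilityMeasure ν] {κ ε : ℝ}
    (h1 : ν.real {t | |t - median ν| ≤ κ - ε} < 1 / 2)
    (h2 : ν.real {t | κ + ε ≤ |t - median ν|} < 1 / 2) : |mad ν - κ| ≤ ε := by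
  have hm : Measurable fun t : ℝ => |t - median ν| := by fun_prop
  have : IsProbabilityMeasure (ν.map fun t => |t - median ν|) :=
    Measure.isProbabilityMeasure_map hm.aemeasurable
  have h3 : κ - ε ≤ mad ν := le_median (by
    rw [map_measureReal_apply hm measurableSet_Iic]; exact h1)
  have h4 : mad ν ≤ κ + ε := median_le (by
    rw [map_measureReal_apply hm measurableSet_Ici]; exact h2)
  rw [abs_le]
  constructor <;> linarith

/-- The median absolute deviations of all one-dimensional projections converge uniformly to the
common value `κ` of the spherical limit. -/
theorem exists_eventually_abs_mad_sub_le [Nontrivial E] {g : ℝ → ℝ} {P : ProbabilityMeasure E}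
    (hP : IsSpherical g (P : Measure E)) :
    ∃ κ > 0, ∀ μ : ℕ → ProbabilityMeasure E, Tendsto μ atTop (𝓝 P) → ∀ ε > 0,
      ∀ᶠ n in atTop, ∀ u : E, ‖u‖ = 1 →
        |mad ((μ n : Measure E).map fun x => inner ℝ u x) - κ| ≤ ε := by
  obtain ⟨e, he⟩ := exists_norm_eq E (zero_le_one (α := ℝ))
  have he0 : e ≠ 0 := by rintro rfl; simp at he
  have := isProbabilityMeasure_map_inner (P : Measure E) e
  have := hP.nullSingletonClass_map_inner he0
  obtain ⟨κ, hκ0, hκ⟩ := exists_median_abs (hP.map_inner_symm e) (hP.map_inner_gap he)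
  set ν := (P : Measure E).map fun x => inner ℝ e x
  refine ⟨κ, hκ0, fun μ hμ ε hε => ?_⟩
  obtain ⟨hq1, hq2⟩ := hκ (ε / 2) (half_pos hε)
  set q1 := ν.real {t | |t| ≤ κ - ε / 2}
  set q2 := ν.real {t | κ + ε / 2 ≤ |t|}
  set δ := min (ε / 4) (min ((1 / 2 - q1) / 2) ((1 / 2 - q2) / 2)) with hδdef
  have hδ : 0 < δ := lt_min (by positivity) (lt_min (by linarith) (by linarith))
  have hδ0 : δ ≤ ε / 4 := min_le_left _ _
  have hδ1 : δ ≤ (1 / 2 - q1) / 2 := (min_le_right _ _).trans (min_le_left _ _)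
  have hδ2 : δ ≤ (1 / 2 - q2) / 2 := (min_le_right _ _).trans (min_le_right _ _)
  filter_upwards [eventually_map_inner_real_le hP hμ he hδ,
    eventually_abs_median_le hP hμ (show 0 < ε / 4 by positivity)] with n hn hmed u hu
  have := isProbabilityMeasure_map_inner (μ n : Measure E) u
  have hm := abs_le.1 (hmed u hu)
  set ν' := (μ n : Measure E).map fun x => inner ℝ u x
  refine abs_mad_sub_le ?_ ?_
  · have h1 := hn u hu {t | |t - median ν'| ≤ κ - ε} (measurableSet_le (by fun_prop) (by fun_prop))
    have h2 : ν.real (Metric.thickening δ {t | |t - median ν'| ≤ κ - ε}) ≤ q1 := by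
      refine measureReal_mono fun t ht => ?_
      obtain ⟨s, hs, hts⟩ := mem_thickening_real.1 ht
      rw [abs_lt] at hts
      simp only [Set.mem_ofPred_eq, abs_le] at hs ⊢
      constructor <;> linarith
    linarith
  · have h1 := hn u hu {t | κ + ε ≤ |t - median ν'|} (measurableSet_le (by fun_prop) (by fun_prop))
    have h2 : ν.real (Metric.thickening δ {t | κ + ε ≤ |t - median ν'|}) ≤ q2 := by
      refine measureReal_mono fun t ht => ?_
      obtain ⟨s, hs, hts⟩ := mem_thickening_real.1 ht
      rw [abs_lt] at hts
      simp only [Set.mem_ofPred_eq, le_abs] at hs ⊢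
      rcases hs with hs | hs
      · left; linarith
      · right; linarith
    linarith

end

section
variable {p : ℕ} {Q : Measure (EuclideanSpace ℝ (Fin p))} {x : EuclideanSpace ℝ (Fin p)} {o : ℝ}

theorem inv_le_projDepth (ho : 0 ≤ o) (h : projOutlyingness Q x ≤ ENNReal.ofReal o) :
    (1 + o)⁻¹ ≤ projDepth Q x := by
  unfold projDepth
  rw [ENNReal.toReal_inv]
  have h1 : (1 + projOutlyingness Q x).toReal ≤ 1 + o := by
    refine ENNReal.toReal_le_of_le_ofReal (by linarith) ?_
    rw [ENNReal.ofReal_add zero_le_one ho, ENNReal.ofReal_one]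
    gcongr
  have h2 : 0 < (1 + projOutlyingness Q x).toReal :=
    ENNReal.toReal_pos (by simp)
      (ENNReal.add_ne_top.2 ⟨ENNReal.one_ne_top, ne_top_of_le_ne_top ENNReal.ofReal_ne_top h⟩)
  gcongr

theorem projDepth_le_inv (ho : 0 ≤ o) (h : ENNReal.ofReal o ≤ projOutlyingness Q x) :
    projDepth Q x ≤ (1 + o)⁻¹ := by
  unfold projDepth
  refine ENNReal.toReal_le_of_le_ofReal (by positivity) ?_
  rw [ENNReal.ofReal_inv_of_pos (by positivity), ENNReal.ofReal_add zero_le_one ho,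
    ENNReal.ofReal_one]
  gcongr

theorem projOutlyingness_le {κ ε : ℝ} (hε : ε < κ)
    (hmed : ∀ u : EuclideanSpace ℝ (Fin p), ‖u‖ = 1 →
      |median (Q.map fun y => inner ℝ u y)| ≤ ε)
    (hmad : ∀ u : EuclideanSpace ℝ (Fin p), ‖u‖ = 1 →
      |mad (Q.map fun y => inner ℝ u y) - κ| ≤ ε) :
    projOutlyingness Q x ≤ ENNReal.ofReal ((‖x‖ + ε) / (κ - ε)) := by
  refine iSup₂_le fun u hu => ?_
  have hu1 : ‖u‖ = 1 := by simpa using hu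
  have h1 := abs_le.1 (hmad u hu1)
  rw [← ENNReal.ofReal_div_of_pos (by linarith)]
  refine ENNReal.ofReal_le_ofReal ?_
  have h2 : |inner ℝ u x - median (Q.map fun y => inner ℝ u y)| ≤ ‖x‖ + ε := by
    refine (abs_sub _ _).trans (add_le_add ?_ (hmed u hu1))
    simpa [hu1] using abs_real_inner_le_norm u x
  have hε0 : 0 ≤ ε := (abs_nonneg _).trans (hmed u hu1)
  have h3 : 0 < κ - ε := by linarith
  have h4 : κ - ε ≤ mad (Q.map fun y => inner ℝ u y) := by linarith
  gcongr

theorem le_projOutlyingness {κ ε : ℝ} (hε : ε < κ) (hx : x ≠ 0)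
    (hmed : ∀ u : EuclideanSpace ℝ (Fin p), ‖u‖ = 1 →
      |median (Q.map fun y => inner ℝ u y)| ≤ ε)
    (hmad : ∀ u : EuclideanSpace ℝ (Fin p), ‖u‖ = 1 →
      |mad (Q.map fun y => inner ℝ u y) - κ| ≤ ε) :
    ENNReal.ofReal ((‖x‖ - ε) / (κ + ε)) ≤ projOutlyingness Q x := by
  have hu1 : ‖(‖x‖⁻¹ • x)‖ = 1 := norm_smul_inv_norm (𝕜 := ℝ) hx
  have hux : inner ℝ (‖x‖⁻¹ • x) x = ‖x‖ := by
    rw [real_inner_smul_left, real_inner_self_eq_norm_sq]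
    field_simp [norm_ne_zero_iff.2 hx]
  set u := ‖x‖⁻¹ • x
  refine le_trans ?_ (le_iSup₂ (f := fun u (_ : u ∈ Metric.sphere (0 : EuclideanSpace ℝ (Fin p)) 1) =>
    ENNReal.ofReal |inner ℝ u x - median (Q.map (fun y => inner ℝ u y))| /
      ENNReal.ofReal (mad (Q.map (fun y => inner ℝ u y)))) u (by simpa using hu1))
  have h1 := abs_le.1 (hmad u hu1)
  have hm := abs_le.1 (hmed u hu1)
  rw [← ENNReal.ofReal_div_of_pos (by linarith)]
  refine ENNReal.ofReal_le_ofReal ?_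
  have h2 : ‖x‖ - ε ≤ |inner ℝ u x - median (Q.map fun y => inner ℝ u y)| := by
    refine le_trans ?_ (le_abs_self _)
    rw [hux]
    linarith
  have h3 : 0 < mad (Q.map fun y => inner ℝ u y) := by linarith
  have h4 : mad (Q.map fun y => inner ℝ u y) ≤ κ + ε := by linarith
  exact div_le_div₀ (abs_nonneg _) h2 h3 h4

/-- The projection depth at a spherical law is a strictly decreasing function of the norm, and it
is approximated by the depths at any sequence of laws that converges weakly to it. -/
theorem exists_projDepth_eq (hp : 0 < p) {g : ℝ → ℝ}
    {P : ProbabilityMeasure (EuclideanSpace ℝ (Fin p))}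
    (hP : IsSpherical g (P : Measure (EuclideanSpace ℝ (Fin p)))) :
    ∃ κ > 0, (∀ x, projDepth (P : Measure (EuclideanSpace ℝ (Fin p))) x = (1 + ‖x‖ / κ)⁻¹) ∧
      ∀ μ : ℕ → ProbabilityMeasure (EuclideanSpace ℝ (Fin p)), Tendsto μ atTop (𝓝 P) →
        ∀ ρ ρ' : ℝ, 0 < ρ → ρ < ρ' →
          (∀ᶠ n in atTop, ∀ x, ‖x‖ ≤ ρ →
            (1 + ρ' / κ)⁻¹ ≤ projDepth (μ n : Measure (EuclideanSpace ℝ (Fin p))) x) ∧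
          (∀ᶠ n in atTop, ∀ x, ρ' ≤ ‖x‖ →
            projDepth (μ n : Measure (EuclideanSpace ℝ (Fin p))) x ≤ (1 + ρ / κ)⁻¹) := by
  have : Nonempty (Fin p) := ⟨⟨0, hp⟩⟩
  obtain ⟨κ, hκ0, hκ⟩ := exists_eventually_abs_mad_sub_le hP
  refine ⟨κ, hκ0, fun x => ?_, fun μ hμ ρ ρ' hρ hρ' => ?_⟩
  · have hmed : ∀ u : EuclideanSpace ℝ (Fin p), ‖u‖ = 1 →
        |median ((P : Measure (EuclideanSpace ℝ (Fin p))).map fun y => inner ℝ u y)| ≤ 0 :=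
      fun u hu => le_of_forall_pos_le_add fun ε hε => by
        obtain ⟨n, hn⟩ := (eventually_abs_median_le hP tendsto_const_nhds hε (μ := fun _ => P)).exists
        simpa using hn u hu
    have hmad : ∀ u : EuclideanSpace ℝ (Fin p), ‖u‖ = 1 →
        |mad ((P : Measure (EuclideanSpace ℝ (Fin p))).map fun y => inner ℝ u y) - κ| ≤ 0 :=
      fun u hu => le_of_forall_pos_le_add fun ε hε => by
        obtain ⟨n, hn⟩ := (hκ (fun _ => P) tendsto_const_nhds ε hε).exists
        simpa using hn u hu
    have hx0 : 0 ≤ ‖x‖ / κ := by positivity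
    refine le_antisymm (projDepth_le_inv hx0 ?_) (inv_le_projDepth hx0 ?_)
    · by_cases hx : x = 0
      · simp [hx]
      · simpa using le_projOutlyingness hκ0 hx hmed hmad
    · simpa using projOutlyingness_le (x := x) hκ0 hmed hmad
  · -- a uniform error `ε` that keeps `(ρ + ε) / (κ - ε) ≤ ρ' / κ` and `ρ / κ ≤ (ρ' - ε) / (κ + ε)`
    set ε := κ * (ρ' - ρ) / (κ + ρ') with hεdef
    have hρ'0 : 0 < ρ' := hρ.trans hρ'
    have hε : 0 < ε := by
      have : 0 < ρ' - ρ := by linarith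
      positivity
    have hmul : ε * (κ + ρ') = κ * (ρ' - ρ) := by rw [hεdef]; field_simp
    have hεκ : ε < κ := by
      by_contra hcon
      push Not at hcon
      nlinarith
    have hev := (eventually_abs_median_le hP hμ hε).and (hκ μ hμ ε hε)
    constructor
    · filter_upwards [hev] with n hn x hx
      refine inv_le_projDepth (by positivity) ((projOutlyingness_le hεκ hn.1 hn.2).trans ?_)
      refine ENNReal.ofReal_le_ofReal ?_
      rw [div_le_div_iff₀ (by linarith) hκ0]
      nlinarith
    · filter_upwards [hev] with n hn x hx
      have hx0 : x ≠ 0 := by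
        rintro rfl
        simp at hx
        linarith
      refine projDepth_le_inv (by positivity)
        (le_trans ?_ (le_projOutlyingness hεκ hx0 hn.1 hn.2))
      refine ENNReal.ofReal_le_ofReal ?_
      rw [div_le_div_iff₀ hκ0 (by linarith)]
      nlinarith

end

/-! ### Truncated quadratic losses over volume-preserving affine maps -/

theorem isOpen_setOf_lt_and_lt {X : Type*} [TopologicalSpace X] {f h : X → ℝ} (hf : Continuous f)
    (hh : Continuous h) (a c : ℝ) : IsOpen {x | f x < a ∧ c < h x} :=
  (isOpen_lt hf continuous_const).inter (isOpen_lt continuous_const hh)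

section
variable {E : Type*} [NormedAddCommGroup E] [InnerProductSpace ℝ E]

theorem norm_le_of_forall_norm_lt_imp {A B : E →L[ℝ] E} {ρ : ℝ} (hρ : 0 < ρ)
    (h : ∀ z, ‖A z‖ < ρ → ‖B z‖ ≤ ρ) (z : E) : ‖B z‖ ≤ ‖A z‖ := by
  by_contra! hlt
  obtain ⟨s, hs1, hs2⟩ := exists_between hlt
  have hs : 0 < s := (norm_nonneg _).trans_lt hs1
  have h1 := h ((ρ / s) • z) (by
    rw [map_smul, norm_smul, Real.norm_of_nonneg (by positivity), div_mul_eq_mul_div,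
      div_lt_iff₀ hs]
    gcongr)
  rw [map_smul, norm_smul, Real.norm_of_nonneg (by positivity), div_mul_eq_mul_div,
    div_le_iff₀ hs] at h1
  have := (mul_le_mul_iff_right₀ hρ).1 h1
  linarith

/-- An affine map `x ↦ L x - b` for which the ball of radius `ρ` and its preimage contain each
other (up to boundaries) is a linear isometry. -/
theorem isometry_of_ball_preimage [FiniteDimensional ℝ E] [Nontrivial E] {L : E →L[ℝ] E} {b : E}
    (hL : L.det ≠ 0) {ρ : ℝ} (hρ : 0 < ρ) (h1 : ∀ x, ‖x‖ < ρ → ‖L x - b‖ ≤ ρ)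
    (h2 : ∀ x, ‖L x - b‖ < ρ → ‖x‖ ≤ ρ) : (∀ x, ‖L x‖ = ‖x‖) ∧ b = 0 := by
  have hpar : ∀ y c : E, ‖y - c‖ ≤ ρ → ‖-y - c‖ ≤ ρ → ‖y‖ ^ 2 + ‖c‖ ^ 2 ≤ ρ ^ 2 := by
    intro y c hy hy'
    have e1 : ‖-y - c‖ = ‖y + c‖ := by rw [← norm_neg]; congr 1; abel
    rw [e1] at hy'
    have := parallelogram_law_with_norm ℝ y c
    nlinarith [norm_nonneg (y - c), norm_nonneg (y + c)]
  have h1' : ∀ x, ‖x‖ ≤ ρ → ‖L x - b‖ ≤ ρ := by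
    have hcl : IsClosed {x : E | ‖L x - b‖ ≤ ρ} := isClosed_le (by fun_prop) continuous_const
    have hsub : Metric.ball (0 : E) ρ ⊆ {x : E | ‖L x - b‖ ≤ ρ} :=
      fun x hx => h1 x (by simpa using hx)
    have := hcl.closure_subset_iff.2 hsub
    rw [closure_ball _ hρ.ne'] at this
    exact fun x hx => this (by simpa using hx)
  have h3 : ∀ x, ‖x‖ ≤ ρ → ‖L x‖ ^ 2 + ‖b‖ ^ 2 ≤ ρ ^ 2 := fun x hx =>
    hpar _ _ (h1' x hx) (by simpa using h1' (-x) (by simpa using hx))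
  have hsurj : Function.Surjective L :=
    (LinearMap.equivOfDetNeZero (L : E →ₗ[ℝ] E) hL).surjective
  obtain ⟨a, ha⟩ := hsurj b
  have h4 : ∀ x, ‖L x‖ < ρ → ‖x‖ ≤ ρ := fun x hx => by
    have e1 := h2 (x + a) (by simpa [ha] using hx)
    have e2 := h2 (-x + a) (by simpa [ha] using hx)
    have e3 := hpar x (-a) (by simpa using e1) (by simpa using e2)
    exact le_of_sq_le_sq (by nlinarith [norm_nonneg (-a)]) hρ.le
  have hiso : ∀ x, ‖L x‖ = ‖x‖ := fun x => by
    refine le_antisymm ?_ ?_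
    · simpa using norm_le_of_forall_norm_lt_imp (A := ContinuousLinearMap.id ℝ E) (B := L) hρ
        (fun z hz => by
          have := h3 z (by simpa using hz.le)
          exact le_of_sq_le_sq (by nlinarith [norm_nonneg b]) hρ.le) x
    · simpa using norm_le_of_forall_norm_lt_imp (A := L) (B := ContinuousLinearMap.id ℝ E) hρ
        (fun z hz => by simpa using h4 z hz) x
  refine ⟨hiso, ?_⟩
  obtain ⟨z, hz⟩ := exists_norm_eq E hρ.le
  have h5 := h3 z hz.le
  rw [hiso, hz] at h5
  have : ‖b‖ ^ 2 ≤ 0 := by linarith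
  have : ‖b‖ = 0 := by nlinarith [norm_nonneg b]
  simpa using this

theorem setOf_norm_sub_lt_eq_preimage (L : E →L[ℝ] E) (b : E) (ρ : ℝ) :
    {x | ‖L x - b‖ < ρ} = L ⁻¹' Metric.ball b ρ := by
  ext x; simp [dist_eq_norm]

variable [FiniteDimensional ℝ E] [MeasurableSpace E] [BorelSpace E]

theorem volume_preimage_affine {L : E →L[ℝ] E} (hL : |L.det| = 1) (s : Set E) :
    volume (L ⁻¹' s) = volume s := by
  have h0 : LinearMap.det (L : E →ₗ[ℝ] E) ≠ 0 := by
    intro h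
    rw [show L.det = LinearMap.det (L : E →ₗ[ℝ] E) from rfl, h] at hL
    simp at hL
  rw [Measure.addHaar_preimage_continuousLinearMap volume h0, abs_inv,
    show |LinearMap.det (L : E →ₗ[ℝ] E)| = 1 from hL]
  simp

theorem volume_norm_sub_lt {L : E →L[ℝ] E} (hL : |L.det| = 1) (b : E) (ρ : ℝ) :
    volume {x | ‖L x - b‖ < ρ} = volume (Metric.ball (0 : E) ρ) := by
  rw [setOf_norm_sub_lt_eq_preimage, volume_preimage_affine hL, Measure.addHaar_ball_center]

/-- The preimage of a ball under a volume-preserving affine map that is not a linear isometry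
neither contains the ball nor is contained in it. -/
theorem exists_mem_ball_and_exists_notMem [Nontrivial E] {L : E →L[ℝ] E} {b : E}
    (hL : |L.det| = 1) (hne : ¬ ((∀ x, ‖L x‖ = ‖x‖) ∧ b = 0)) {ρ : ℝ} (hρ : 0 < ρ) :
    (∃ x, ‖x‖ < ρ ∧ ρ < ‖L x - b‖) ∧ ∃ x, ‖L x - b‖ < ρ ∧ ρ < ‖x‖ := by
  have hL0 : L.det ≠ 0 := by intro h; simp [h] at hL
  have hvol : volume (Metric.ball (0 : E) ρ) ≠ ∞ := measure_ball_lt_top.ne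
  -- two disjoint sets, one of full volume and one open, inside a set of the same volume
  have key : ∀ B U C : Set E, Disjoint B U → IsOpen U → B ⊆ C → U ⊆ C →
      volume B = volume (Metric.ball (0 : E) ρ) → volume C = volume (Metric.ball (0 : E) ρ) →
      U = ∅ := by
    intro B U C hd hU hBC hUC hB hC
    by_contra hUne
    have h1 : volume B + volume U ≤ volume C := by
      rw [← measure_union hd hU.measurableSet]
      exact measure_mono (Set.union_subset hBC hUC)
    rw [hB, hC] at h1
    have h2 : volume U ≤ 0 :=
      (ENNReal.add_le_add_iff_left hvol).1 (by simpa using h1)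
    exact (hU.measure_pos volume (Set.nonempty_iff_ne_empty.2 hUne)).not_ge h2
  have hopen1 : IsOpen {x : E | ‖x‖ < ρ ∧ ρ < ‖L x - b‖} :=
    isOpen_setOf_lt_and_lt (by fun_prop) (by fun_prop) _ _
  have hopen2 : IsOpen {x : E | ‖L x - b‖ < ρ ∧ ρ < ‖x‖} :=
    isOpen_setOf_lt_and_lt (by fun_prop) (by fun_prop) _ _
  by_contra hcon
  have hiff : (¬ ∃ x, ‖x‖ < ρ ∧ ρ < ‖L x - b‖) ∧ ¬ ∃ x, ‖L x - b‖ < ρ ∧ ρ < ‖x‖ := by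
    rcases not_and_or.1 hcon with h | h
    · refine ⟨h, ?_⟩
      push Not at h
      have := key (Metric.ball (0 : E) ρ) {x | ‖L x - b‖ < ρ ∧ ρ < ‖x‖} {x | ‖L x - b‖ ≤ ρ}
        (by rw [Set.disjoint_left]; intro x hx hx'
            exact absurd (by simpa using hx) (not_lt.2 hx'.2.le))
        hopen2 (fun x hx => h x (by simpa using hx)) (fun x hx => hx.1.le) rfl
        (by
          have : {x : E | ‖L x - b‖ ≤ ρ} = L ⁻¹' Metric.closedBall b ρ := by
            ext x; simp [dist_eq_norm]
          rw [this, volume_preimage_affine hL, Measure.addHaar_closedBall_eq_addHaar_ball,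
            Measure.addHaar_ball_center])
      rintro ⟨x, hx⟩
      exact Set.notMem_empty x (this ▸ hx)
    · refine ⟨?_, h⟩
      push Not at h
      have := key {x | ‖L x - b‖ < ρ} {x | ‖x‖ < ρ ∧ ρ < ‖L x - b‖} (Metric.closedBall 0 ρ)
        (by rw [Set.disjoint_left]; intro x hx hx'
            exact absurd hx (not_lt.2 hx'.2.le))
        hopen1 (fun x hx => by simpa using h x hx) (fun x hx => by simpa using hx.1.le)
        (volume_norm_sub_lt hL b ρ) (Measure.addHaar_closedBall_eq_addHaar_ball _ _ _)
      rintro ⟨x, hx⟩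
      exact Set.notMem_empty x (this ▸ hx)
  push Not at hiff
  exact hne (isometry_of_ball_preimage hL0 hρ hiff.1 hiff.2)

namespace IsSpherical
variable {g : ℝ → ℝ} {P : Measure E}

theorem integrable_density (hP : IsSpherical g P) : Integrable fun x : E => g (‖x‖ ^ 2) := by
  have hprob := hP.prob
  refine ⟨hP.measurable_density.aestronglyMeasurable, ?_⟩
  rw [hasFiniteIntegral_iff_ofReal (ae_of_all _ fun x => hP.nonneg _ (by positivity))]
  have h1 : P Set.univ = 1 := measure_univ
  rw [hP.density, withDensity_apply _ MeasurableSet.univ, Measure.restrict_univ] at h1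
  rw [h1]; exact ENNReal.one_lt_top

theorem real_eq_integral (hP : IsSpherical g P) {s : Set E} (hs : MeasurableSet s) :
    P.real s = ∫ x in s, g (‖x‖ ^ 2) := by
  rw [integral_eq_lintegral_of_nonneg_ae (ae_of_all _ fun x => hP.nonneg _ (by positivity))
    hP.measurable_density.aestronglyMeasurable, measureReal_def]
  conv_lhs => rw [hP.density, withDensity_apply _ hs]

/-- Among the preimages of a ball under volume-preserving affine maps, the ball itself has the
largest probability; it is the only one if the density strictly decreases across its boundary. -/
theorem real_norm_sub_lt_le [Nontrivial E] (hP : IsSpherical g P) {L : E →L[ℝ] E} {b : E}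
    (hL : |L.det| = 1) {ρ : ℝ} (hρ : 0 < ρ) :
    P.real {x | ‖L x - b‖ < ρ} ≤ P.real {x | ‖x‖ < ρ} ∧
      (¬ ((∀ x, ‖L x‖ = ‖x‖) ∧ b = 0) → (∀ s t, 0 ≤ s → s < ρ ^ 2 → ρ ^ 2 < t → g t < g s) →
        P.real {x | ‖L x - b‖ < ρ} < P.real {x | ‖x‖ < ρ}) := by
  set A : Set E := {x | ‖x‖ < ρ} with hA
  set B : Set E := {x | ‖L x - b‖ < ρ} with hB
  have hAo : IsOpen A := isOpen_lt (by fun_prop) continuous_const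
  have hBo : IsOpen B := isOpen_lt (by fun_prop) continuous_const
  have hAm := hAo.measurableSet
  have hBm := hBo.measurableSet
  have hAball : A = Metric.ball 0 ρ := by ext; simp [hA]
  have hAvol : volume A ≠ ∞ := by rw [hAball]; exact measure_ball_lt_top.ne
  have hvol : volume B = volume A := by rw [hAball]; exact volume_norm_sub_lt hL b ρ
  have hBvol : volume B ≠ ∞ := hvol ▸ hAvol
  set k := g (ρ ^ 2) with hk
  set F : E → ℝ := fun x => A.indicator (fun x => g (‖x‖ ^ 2) - k) x -
    B.indicator (fun x => g (‖x‖ ^ 2) - k) x with hF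
  have hint : ∀ s : Set E, MeasurableSet s → volume s ≠ ∞ →
      IntegrableOn (fun x : E => g (‖x‖ ^ 2) - k) s := fun s hs hsv =>
    hP.integrable_density.integrableOn.sub (integrableOn_const hsv)
  have hIA := (hint A hAm hAvol).integrable_indicator hAm
  have hIB := (hint B hBm hBvol).integrable_indicator hBm
  have hval : ∀ s : Set E, MeasurableSet s → volume s ≠ ∞ →
      ∫ x, s.indicator (fun x => g (‖x‖ ^ 2) - k) x = P.real s - volume.real s * k := by
    intro s hs hsv
    rw [integral_indicator hs, integral_sub hP.integrable_density.integrableOn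
      (integrableOn_const hsv), ← hP.real_eq_integral hs]
    simp
  have hFint : ∫ x, F x = P.real A - P.real B := by
    rw [hF, integral_sub hIA hIB, hval A hAm hAvol, hval B hBm hBvol, measureReal_def,
      measureReal_def volume, measureReal_def volume, hvol]
    simp only [measureReal_def]
    ring
  have hle : ∀ x ∈ A, k ≤ g (‖x‖ ^ 2) := fun x hx =>
    hP.antitone (Set.mem_Ici.2 (by positivity)) (Set.mem_Ici.2 (by positivity)) (by
      have : ‖x‖ < ρ := hx
      gcongr)
  have hge : ∀ x ∉ A, g (‖x‖ ^ 2) ≤ k := fun x hx =>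
    hP.antitone (Set.mem_Ici.2 (by positivity)) (Set.mem_Ici.2 (by positivity)) (by
      have : ρ ≤ ‖x‖ := not_lt.1 hx
      gcongr)
  have hF0 : ∀ x, 0 ≤ F x := by
    intro x
    simp only [hF, Set.indicator_apply]
    by_cases hxA : x ∈ A <;> by_cases hxB : x ∈ B <;> simp only [hxA, hxB, if_true, if_false]
    · simp
    · have := hle x hxA; linarith
    · have := hge x hxA; linarith
    · simp
  have h0 : 0 ≤ ∫ x, F x := integral_nonneg hF0
  refine ⟨by linarith, fun hne hstrict => ?_⟩
  obtain ⟨⟨x₁, hx₁⟩, x₂, hx₂⟩ := exists_mem_ball_and_exists_notMem hL hne hρ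
  by_contra hcon
  have hFz : ∫ x, F x = 0 := le_antisymm (by linarith) h0
  rw [integral_eq_zero_iff_of_nonneg hF0 (hIA.sub hIB)] at hFz
  have hmeet : ∀ U : Set E, IsOpen U → U.Nonempty → ∃ x ∈ U, F x = 0 := by
    intro U hU hUne
    by_contra! hno
    exact (hU.measure_pos volume hUne).ne' (measure_mono_null (fun x hx => hno x hx) hFz)
  obtain ⟨y₁, hy₁, hFy₁⟩ := hmeet {x : E | ‖x‖ < ρ ∧ ρ < ‖L x - b‖}
    (isOpen_setOf_lt_and_lt (by fun_prop) (by fun_prop) _ _) ⟨x₁, hx₁⟩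
  obtain ⟨y₂, hy₂, hFy₂⟩ := hmeet {x : E | ‖L x - b‖ < ρ ∧ ρ < ‖x‖}
    (isOpen_setOf_lt_and_lt (by fun_prop) (by fun_prop) _ _) ⟨x₂, hx₂⟩
  have e1 : y₁ ∈ A := hy₁.1
  have e2 : y₁ ∉ B := not_lt.2 hy₁.2.le
  have e3 : y₂ ∈ B := hy₂.1
  have e4 : y₂ ∉ A := not_lt.2 hy₂.2.le
  simp only [hF, Set.indicator_apply, e1, e2, e3, e4, if_true, if_false] at hFy₁ hFy₂
  have := hstrict (‖y₁‖ ^ 2) (‖y₂‖ ^ 2) (by positivity)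
    (pow_lt_pow_left₀ hy₁.1 (norm_nonneg _) two_ne_zero)
    (pow_lt_pow_left₀ hy₂.2 hρ.le two_ne_zero)
  linarith

/-- The function `ρ ↦ P(‖x‖ < ρ)` is continuous from the left. -/
theorem exists_lt_real_norm_lt [Nontrivial E] (hP : IsSpherical g P) {ρ c : ℝ} (hρ : 0 < ρ)
    (hc : c < P.real {x | ‖x‖ < ρ}) : ∃ ρ', 0 < ρ' ∧ ρ' < ρ ∧ c < P.real {x | ‖x‖ < ρ'} := by
  have := hP.prob
  have := hP.nullSingletonClass_map_norm
  have hm : Measurable fun x : E => ‖x‖ := by fun_prop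
  have : IsProbabilityMeasure (P.map fun x : E => ‖x‖) :=
    Measure.isProbabilityMeasure_map hm.aemeasurable
  have hcongr : ∀ t, (P.map fun x : E => ‖x‖).real (Set.Iic t) = P.real {x | ‖x‖ < t} := fun t => by
    rw [← measureReal_congr (Iio_ae_eq_Iic (a := t)), map_measureReal_apply hm measurableSet_Iio]
    rfl
  have hcont := continuous_real_Iic (P.map fun x : E => ‖x‖)
  simp only [hcongr] at hcont
  have hev := hcont.continuousAt.eventually_const_lt hc
  have hev' : ∀ᶠ t in 𝓝[<] ρ, c < P.real {x : E | ‖x‖ < t} := hev.filter_mono nhdsWithin_le_nhds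
  obtain ⟨t, ht, ht2⟩ := (hev'.and (Ioo_mem_nhdsLT hρ)).exists
  exact ⟨t, ht2.1, ht2.2, ht⟩

/-- If the density strictly decreases across some sphere of radius at most `r`, the truncated
quadratic loss `∫ (r² - ‖L x - b‖²)₊ dP` over volume-preserving affine maps is maximal only at
linear isometries. -/
theorem integral_truncated_lt [Nontrivial E] (hP : IsSpherical g P) {L : E →L[ℝ] E} {b : E}
    (hL : |L.det| = 1) (hne : ¬ ((∀ x, ‖L x‖ = ‖x‖) ∧ b = 0)) {ρ r : ℝ} (hρ : 0 < ρ) (hρr : ρ ≤ r)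
    (hstrict : ∀ s t, 0 ≤ s → s < ρ ^ 2 → ρ ^ 2 < t → g t < g s) :
    ∫ x, max (r ^ 2 - ‖L x - b‖ ^ 2) 0 ∂P < ∫ x, max (r ^ 2 - ‖x‖ ^ 2) 0 ∂P := by
  have hprob := hP.prob
  have hlayer : ∀ (T : E → E), Continuous T →
      ∫⁻ x, ENNReal.ofReal (max (r ^ 2 - ‖T x‖ ^ 2) 0) ∂P =
        ∫⁻ t in Set.Ioi 0, P {x | ‖T x‖ < √(r ^ 2 - t)} := by
    intro T hT
    rw [lintegral_eq_lintegral_meas_lt (f := fun x => max (r ^ 2 - ‖T x‖ ^ 2) 0) P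
      (ae_of_all _ fun x => le_max_right _ _) (Continuous.aemeasurable (by fun_prop))]
    refine setLIntegral_congr_fun measurableSet_Ioi fun t ht => ?_
    congr 1
    ext x
    simp only [Set.mem_ofPred_eq, lt_max_iff, Real.lt_sqrt (norm_nonneg (T x))]
    constructor
    · rintro (h | h)
      · linarith
      · exact absurd h (not_lt.2 (le_of_lt ht))
    · intro h; left; linarith
  have hfin : ∀ (T : E → E), ∫⁻ x, ENNReal.ofReal (max (r ^ 2 - ‖T x‖ ^ 2) 0) ∂P ≠ ∞ := by
    intro T
    refine ne_top_of_le_ne_top (b := ∫⁻ _, ENNReal.ofReal (r ^ 2) ∂P) (by simp) ?_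
    refine lintegral_mono fun x => ENNReal.ofReal_le_ofReal (max_le ?_ (by positivity))
    nlinarith [sq_nonneg ‖T x‖]
  have hle : ∀ t, P {x | ‖L x - b‖ < √(r ^ 2 - t)} ≤ P {x | ‖x‖ < √(r ^ 2 - t)} := by
    intro t
    rcases (Real.sqrt_nonneg (r ^ 2 - t)).eq_or_lt with h | h
    · have : {x | ‖L x - b‖ < √(r ^ 2 - t)} = ∅ := by
        ext x
        simp only [← h, Set.mem_ofPred_eq, Set.mem_empty_iff_false, iff_false, not_lt]
        exact norm_nonneg _
      rw [this]; simp
    · exact (ENNReal.toReal_le_toReal (by finiteness) (by finiteness)).1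
        (hP.real_norm_sub_lt_le hL h).1
  obtain ⟨ρ', hρ'0, hρ'ρ, hρ'⟩ :=
    hP.exists_lt_real_norm_lt hρ ((hP.real_norm_sub_lt_le (b := b) hL hρ).2 hne hstrict)
  have hlt : ∀ t ∈ Set.Ioo (r ^ 2 - ρ ^ 2) (r ^ 2 - ρ' ^ 2),
      P {x | ‖L x - b‖ < √(r ^ 2 - t)} < P {x | ‖x‖ < √(r ^ 2 - t)} := by
    rintro t ⟨ht1, ht2⟩
    have h1 : √(r ^ 2 - t) ≤ ρ := by
      rw [Real.sqrt_le_left hρ.le]; linarith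
    have h2 : ρ' ≤ √(r ^ 2 - t) := by
      rw [Real.le_sqrt hρ'0.le (by nlinarith)]; linarith
    calc P {x | ‖L x - b‖ < √(r ^ 2 - t)} ≤ P {x | ‖L x - b‖ < ρ} :=
          measure_mono fun x hx => lt_of_lt_of_le hx h1
      _ < P {x | ‖x‖ < ρ'} := (ENNReal.toReal_lt_toReal (by finiteness) (by finiteness)).1 hρ'
      _ ≤ _ := measure_mono fun x hx => lt_of_lt_of_le hx h2
  have hmain : ∫⁻ x, ENNReal.ofReal (max (r ^ 2 - ‖L x - b‖ ^ 2) 0) ∂P <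
      ∫⁻ x, ENNReal.ofReal (max (r ^ 2 - ‖x‖ ^ 2) 0) ∂P := by
    have hf := hfin (fun x => L x - b)
    rw [hlayer (fun x => L x - b) (by fun_prop)] at hf ⊢
    rw [hlayer (fun x => x) continuous_id]
    refine lintegral_strict_mono_of_ae_le_of_ae_lt_on
      (s := Set.Ioo (r ^ 2 - ρ ^ 2) (r ^ 2 - ρ' ^ 2)) ?_ hf (ae_of_all _ hle) ?_
      (ae_of_all _ hlt)
    · have hanti : Antitone fun t => P {x | ‖x‖ < √(r ^ 2 - t)} := fun s t hst =>
        measure_mono fun x (hx : ‖x‖ < √(r ^ 2 - t)) =>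
          lt_of_lt_of_le hx (Real.sqrt_le_sqrt (by linarith))
      exact hanti.measurable.aemeasurable
    · have hsub : Set.Ioo (r ^ 2 - ρ ^ 2) (r ^ 2 - ρ' ^ 2) ⊆ Set.Ioi 0 := fun t ht => by
        have : 0 ≤ r ^ 2 - ρ ^ 2 := by nlinarith
        exact lt_of_le_of_lt this ht.1
      rw [Measure.restrict_eq_self _ hsub, Real.volume_Ioo]
      have : ρ' ^ 2 < ρ ^ 2 := pow_lt_pow_left₀ hρ'ρ hρ'0.le two_ne_zero
      simp; linarith
  have hint : ∀ T : E → E, Continuous T → ∫ x, max (r ^ 2 - ‖T x‖ ^ 2) 0 ∂P =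
      (∫⁻ x, ENNReal.ofReal (max (r ^ 2 - ‖T x‖ ^ 2) 0) ∂P).toReal := fun T hT =>
    integral_eq_lintegral_of_nonneg_ae (ae_of_all _ fun x => le_max_right _ _)
      (Continuous.aestronglyMeasurable (by fun_prop))
  rw [hint (fun x => L x - b) (by fun_prop), hint (fun x => x) continuous_id]
  exact (ENNReal.toReal_lt_toReal (hfin fun x => L x - b) (hfin fun x => x)).2 hmain

/-- If the density is constant on no ball of probability more than `α`, it strictly decreases
across some sphere in the ball of probability `α`. -/
theorem exists_strict_radius [Nontrivial E] (hP : IsSpherical g P) {α r : ℝ} (hr : 0 < r)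
    (hrα : P.real (Metric.closedBall 0 r) = α)
    (hflat : ∀ s : ℝ, 0 < s → (∀ t ∈ Set.Ioo 0 s, ∀ t' ∈ Set.Ioo 0 s, g t = g t') →
      P.real {x | ‖x‖ ^ 2 ≤ s} ≤ α) :
    ∃ ρ, 0 < ρ ∧ ρ ≤ r ∧ ∀ s t, 0 ≤ s → s < ρ ^ 2 → ρ ^ 2 < t → g t < g s := by
  have hprob := hP.prob
  have hanti : ∀ {s t : ℝ}, 0 ≤ s → s ≤ t → g t ≤ g s := fun hs hst =>
    hP.antitone (Set.mem_Ici.2 hs) (Set.mem_Ici.2 (hs.trans hst)) hst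
  by_cases hconst : ∀ t ∈ Set.Ioo 0 (r ^ 2), ∀ t' ∈ Set.Ioo 0 (r ^ 2), g t = g t'
  · refine ⟨r, hr, le_rfl, fun s t hs hsr hrt => ?_⟩
    by_contra! hle
    -- otherwise the density is constant up to `t`, hence vanishes between `r²` and `t`
    have hm : (s + r ^ 2) / 2 ∈ Set.Ioo 0 (r ^ 2) := ⟨by linarith [sq_nonneg r, pow_pos hr 2], by linarith⟩
    set m := (s + r ^ 2) / 2
    have hgt : g t = g m := le_antisymm (hanti hm.1.le (by linarith [hm.2]))
      ((hanti hs (by simp only [m]; linarith)).trans hle)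
    have hall : ∀ v ∈ Set.Ioo 0 t, g v = g m := by
      rintro v ⟨hv0, hvt⟩
      by_cases hvr : v < r ^ 2
      · exact hconst v ⟨hv0, hvr⟩ m hm
      · push Not at hvr
        exact le_antisymm (hanti hm.1.le (hm.2.le.trans hvr)) (hgt ▸ hanti hv0.le hvt.le)
    have ht0 : 0 < t := by linarith [pow_pos hr 2]
    have h1 := hflat t ht0 fun v hv v' hv' => (hall v hv).trans (hall v' hv').symm
    have hsub : {x : E | ‖x‖ ^ 2 < t ∧ r < ‖x‖} ∪ Metric.closedBall 0 r ⊆ {x : E | ‖x‖ ^ 2 ≤ t} := by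
      rintro x (hx | hx)
      · exact hx.1.le
      · have : ‖x‖ ≤ r := by simpa using hx
        have : ‖x‖ ^ 2 ≤ r ^ 2 := by gcongr
        exact this.trans hrt.le
    have hopen : IsOpen {x : E | ‖x‖ ^ 2 < t ∧ r < ‖x‖} :=
      isOpen_setOf_lt_and_lt (by fun_prop) (by fun_prop) _ _
    have hdisj : Disjoint {x : E | ‖x‖ ^ 2 < t ∧ r < ‖x‖} (Metric.closedBall 0 r) := by
      rw [Set.disjoint_left]
      intro x hx hx'
      exact absurd hx.2 (not_lt.2 (by simpa using hx'))
    have h2 := measureReal_mono (μ := P) hsub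
    rw [measureReal_union hdisj Metric.isClosed_closedBall.measurableSet, hrα] at h2
    have h3 : P.real {x : E | ‖x‖ ^ 2 < t ∧ r < ‖x‖} = 0 :=
      le_antisymm (by linarith) measureReal_nonneg
    have hgm : g m ≤ 0 := by
      by_contra! hpos
      have h4 : r < √t := Real.lt_sqrt_of_sq_lt hrt
      obtain ⟨z, hz1, hz2⟩ := exists_between h4
      obtain ⟨x, hx⟩ := exists_norm_eq E (hr.le.trans hz1.le)
      have h5 : 0 < P {x : E | ‖x‖ ^ 2 < t ∧ r < ‖x‖} := by
        refine hP.measure_pos_of_isOpen hopen ⟨x, ?_, ?_⟩ fun y hy => ?_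
        · rw [hx]; exact (Real.lt_sqrt (hr.le.trans hz1.le)).1 hz2
        · rw [hx]; exact hz1
        · have : 0 < ‖y‖ := hr.trans hy.2
          rw [hall _ ⟨by positivity, hy.1⟩]; exact hpos
      exact (ENNReal.toReal_pos h5.ne' (by finiteness)).ne' h3
    have h6 : P Set.univ = 0 := by
      rw [hP.density, withDensity_apply _ MeasurableSet.univ, Measure.restrict_univ,
        lintegral_eq_zero_iff hP.measurable_density.ennreal_ofReal]
      filter_upwards [compl_mem_ae_iff.2 (measure_singleton (μ := (volume : Measure E)) 0)] with x hx
      have hx0 : 0 < ‖x‖ ^ 2 := by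
        have : 0 < ‖x‖ := norm_pos_iff.2 (by simpa using hx)
        positivity
      simp only [Pi.zero_apply, ENNReal.ofReal_eq_zero]
      by_cases hxt : ‖x‖ ^ 2 < t
      · rw [hall _ ⟨hx0, hxt⟩]; exact hgm
      · exact (hanti ht0.le (not_lt.1 hxt)).trans (hgt ▸ hgm)
    simp at h6
  · push Not at hconst
    obtain ⟨a, c, ha, hac, hcr, hg⟩ : ∃ a c, 0 < a ∧ a < c ∧ c < r ^ 2 ∧ g c < g a := by
      obtain ⟨t, ht, t', ht', hne⟩ := hconst
      rcases lt_trichotomy t t' with h | h | h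
      · exact ⟨t, t', ht.1, h, ht'.2, lt_of_le_of_ne (hanti ht.1.le h.le) hne.symm⟩
      · exact absurd (by rw [h]) hne
      · exact ⟨t', t, ht'.1, h, ht.2, lt_of_le_of_ne (hanti ht'.1.le h.le) hne⟩
    set V : Set ℝ := {v | 0 ≤ v ∧ g a ≤ g v} with hV
    have hVc : ∀ v ∈ V, v ≤ c := fun v hv => by
      by_contra! hcv
      have := hanti (ha.le.trans hac.le) hcv.le
      linarith [hv.2]
    have hVb : BddAbove V := ⟨c, hVc⟩
    have haV : a ∈ V := ⟨ha.le, le_rfl⟩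
    have hsa : a ≤ sSup V := le_csSup hVb haV
    have hsc : sSup V ≤ c := csSup_le ⟨a, haV⟩ hVc
    have hs0 : 0 ≤ sSup V := ha.le.trans hsa
    refine ⟨√(sSup V), Real.sqrt_pos.2 (ha.trans_le hsa), ?_, fun s t hs hst htt => ?_⟩
    · rw [Real.sqrt_le_left hr.le]; linarith
    · rw [Real.sq_sqrt hs0] at hst htt
      obtain ⟨v, hv, hsv⟩ := exists_lt_of_lt_csSup ⟨a, haV⟩ hst
      have h1 : g v ≤ g s := hanti hs hsv.le
      have h2 : t ∉ V := fun htV => absurd (le_csSup hVb htV) (not_le.2 htt)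
      have h3 : g t < g a := by
        by_contra! hcon
        exact h2 ⟨hs0.trans htt.le, hcon⟩
      exact h3.trans_le (hv.2.trans h1)

end IsSpherical
end

/-! ### Near-maximizers of the truncated loss -/

section
variable {E : Type*} [NormedAddCommGroup E] [InnerProductSpace ℝ E]
  [FiniteDimensional ℝ E] [MeasurableSpace E] [BorelSpace E] [Nontrivial E] {g : ℝ → ℝ}
  {P : ProbabilityMeasure E} {μ : ℕ → ProbabilityMeasure E}

/-- Thin slabs have uniformly small mass along a sequence converging to a spherical law. -/
theorem exists_eventually_slab_le (hP : IsSpherical g (P : Measure E))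
    (hμ : Tendsto μ atTop (𝓝 P)) {r : ℝ} (hr : 0 ≤ r) {ε : ℝ} (hε : 0 < ε) :
    ∃ M > 0, ∀ᶠ n in atTop, ∀ v : E, M ≤ ‖v‖ → ∀ c : ℝ,
      (μ n : Measure E).real {x | |inner ℝ v x - c| ≤ r} ≤ ε := by
  obtain ⟨e, he⟩ := exists_norm_eq E (zero_le_one (α := ℝ))
  have he0 : e ≠ 0 := by rintro rfl; simp at he
  have := isProbabilityMeasure_map_inner (P : Measure E) e
  have := hP.nullSingletonClass_map_inner he0
  obtain ⟨δ₀, hδ₀, hsmall⟩ := exists_forall_real_Icc_le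
    ((P : Measure E).map fun x => inner ℝ e x) (half_pos hε)
  have hδ : 0 < min (δ₀ / 2) (ε / 2) := lt_min (by positivity) (by positivity)
  refine ⟨2 * r / δ₀ + 1, by positivity, ?_⟩
  filter_upwards [eventually_map_inner_real_le hP hμ he hδ] with n hn v hv c
  have hv0 : 0 < ‖v‖ := lt_of_lt_of_le (by positivity) hv
  have hη : r / ‖v‖ ≤ δ₀ / 2 := by
    rw [div_le_iff₀ hv0]
    have : 2 * r / δ₀ ≤ ‖v‖ := by linarith
    rw [div_le_iff₀ hδ₀] at this
    linarith
  have hu : ‖(‖v‖⁻¹ • v)‖ = 1 := norm_smul_inv_norm (𝕜 := ℝ) (norm_pos_iff.1 hv0)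
  have hset : {x : E | |inner ℝ v x - c| ≤ r} =
      (fun x : E => inner ℝ (‖v‖⁻¹ • v) x) ⁻¹'
        Set.Icc (c / ‖v‖ - r / ‖v‖) (c / ‖v‖ + r / ‖v‖) := by
    ext x
    simp only [Set.mem_ofPred_eq, Set.mem_preimage, Set.mem_Icc, real_inner_smul_left, abs_le,
      ← sub_div, ← add_div]
    rw [div_le_iff₀ hv0, le_div_iff₀ hv0, mul_assoc, mul_comm _ ‖v‖, ← mul_assoc,
      inv_mul_cancel₀ hv0.ne', one_mul]
    constructor <;> rintro ⟨h1, h2⟩ <;> constructor <;> linarith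
  have h1 := hn _ hu (Set.Icc (c / ‖v‖ - r / ‖v‖) (c / ‖v‖ + r / ‖v‖)) measurableSet_Icc
  rw [map_measureReal_apply (by fun_prop) measurableSet_Icc, ← hset] at h1
  have h2 : ((P : Measure E).map fun x => inner ℝ e x).real (Metric.thickening
      (min (δ₀ / 2) (ε / 2)) (Set.Icc (c / ‖v‖ - r / ‖v‖) (c / ‖v‖ + r / ‖v‖))) ≤ ε / 2 := by
    refine (measureReal_mono fun t ht => ?_).trans (hsmall (c / ‖v‖))
    obtain ⟨s, hs, hts⟩ := mem_thickening_real.1 ht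
    rw [abs_lt] at hts
    have := min_le_left (δ₀ / 2) (ε / 2)
    constructor <;> linarith [hs.1, hs.2]
  have := min_le_right (δ₀ / 2) (ε / 2)
  linarith

omit [Nontrivial E] in
theorem exists_eventually_norm_ge_le (hμ : Tendsto μ atTop (𝓝 P)) {ε : ℝ} (hε : 0 < ε) :
    ∃ M > 0, ∀ᶠ n in atTop, (μ n : Measure E).real {x | M ≤ ‖x‖} ≤ ε := by
  have hm : Measurable fun x : E => ‖x‖ := by fun_prop
  have : IsProbabilityMeasure ((P : Measure E).map fun x : E => ‖x‖) :=
    Measure.isProbabilityMeasure_map hm.aemeasurable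
  obtain ⟨t, ht⟩ := exists_lt_real_Iic ((P : Measure E).map fun x : E => ‖x‖)
    (c := 1 - ε / 2) (by linarith)
  refine ⟨max t 0 + 1, by positivity, ?_⟩
  filter_upwards [eventually_real_le_thickening_add hμ (δ := min 1 (ε / 2))
    (lt_min one_pos (by positivity))] with n hn
  have h1 := hn {x | max t 0 + 1 ≤ ‖x‖} (measurableSet_le (by fun_prop) (by fun_prop))
  have h2 : (P : Measure E).real (Metric.thickening (min 1 (ε / 2)) {x | max t 0 + 1 ≤ ‖x‖}) ≤
      ((P : Measure E).map fun x : E => ‖x‖).real (Set.Ioi t) := by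
    rw [map_measureReal_apply hm measurableSet_Ioi]
    refine measureReal_mono fun x hx => ?_
    obtain ⟨z, hz, hxz⟩ := Metric.mem_thickening_iff.1 hx
    have h3 : max t 0 + 1 ≤ ‖z‖ := hz
    rw [dist_eq_norm] at hxz
    have h4 := norm_sub_norm_le z x
    rw [norm_sub_rev] at h4
    have h5 := min_le_left 1 (ε / 2)
    have h6 := le_max_left t 0
    rw [Set.mem_preimage, Set.mem_Ioi]
    linarith
  rw [real_Ioi_eq_one_sub] at h2
  have := min_le_right 1 (ε / 2)
  linarith

omit [InnerProductSpace ℝ E] [FiniteDimensional ℝ E] [MeasurableSpace E] [BorelSpace E]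
  [Nontrivial E] in
/-- The truncated loss is `2 r`-Lipschitz. -/
theorem abs_truncated_sub_le {r : ℝ} (hr : 0 ≤ r) (y z : E) :
    |max (r ^ 2 - ‖y‖ ^ 2) 0 - max (r ^ 2 - ‖z‖ ^ 2) 0| ≤ 2 * r * ‖y - z‖ := by
  have hrew : ∀ w : E, max (r ^ 2 - ‖w‖ ^ 2) 0 = r ^ 2 - min ‖w‖ r ^ 2 := by
    intro w
    rcases le_total ‖w‖ r with h | h
    · rw [min_eq_left h, max_eq_left]
      nlinarith [norm_nonneg w]
    · rw [min_eq_right h, max_eq_right, sub_self]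
      nlinarith
  rw [hrew, hrew]
  have h1 : |min ‖y‖ r - min ‖z‖ r| ≤ ‖y - z‖ :=
    (abs_min_sub_min_le_max _ _ _ _).trans (by simpa using abs_norm_sub_norm_le y z)
  have h2 : |min ‖y‖ r + min ‖z‖ r| ≤ 2 * r := by
    rw [abs_of_nonneg (add_nonneg (le_min (norm_nonneg _) hr) (le_min (norm_nonneg _) hr))]
    linarith [min_le_right ‖y‖ r, min_le_right ‖z‖ r]
  calc |r ^ 2 - min ‖y‖ r ^ 2 - (r ^ 2 - min ‖z‖ r ^ 2)|
      = |min ‖y‖ r + min ‖z‖ r| * |min ‖y‖ r - min ‖z‖ r| := by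
        rw [← abs_mul, ← abs_neg]; congr 1; ring
    _ ≤ 2 * r * ‖y - z‖ := by gcongr

omit [InnerProductSpace ℝ E] [FiniteDimensional ℝ E] [MeasurableSpace E] [BorelSpace E]
  [Nontrivial E] in
theorem truncated_mem_Icc (r : ℝ) (y : E) : max (r ^ 2 - ‖y‖ ^ 2) 0 ∈ Set.Icc 0 (r ^ 2) :=
  ⟨le_max_right _ _, max_le (by nlinarith [norm_nonneg y]) (by positivity)⟩

omit [Nontrivial E] [FiniteDimensional ℝ E] in
theorem integrable_truncated (Q : Measure E) [IsFiniteMeasure Q] (r : ℝ) (L : E →L[ℝ] E) (b : E) :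
    Integrable (fun x => max (r ^ 2 - ‖L x - b‖ ^ 2) 0) Q := by
  refine Integrable.of_bound (Continuous.aestronglyMeasurable (by fun_prop)) (r ^ 2)
    (ae_of_all _ fun x => ?_)
  rw [Real.norm_eq_abs, abs_of_nonneg (truncated_mem_Icc r _).1]
  exact (truncated_mem_Icc r _).2

omit [Nontrivial E] [FiniteDimensional ℝ E] in
theorem integral_truncated_le (Q : Measure E) [IsFiniteMeasure Q] {r : ℝ} (hr : 0 ≤ r)
    (L : E →L[ℝ] E) (b : E) :
    ∫ x, max (r ^ 2 - ‖L x - b‖ ^ 2) 0 ∂Q ≤ r ^ 2 * Q.real {x | ‖L x - b‖ ≤ r} := by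
  have hm : MeasurableSet {x | ‖L x - b‖ ≤ r} := measurableSet_le (by fun_prop) (by fun_prop)
  have h1 : ∫ x, {x | ‖L x - b‖ ≤ r}.indicator (fun _ => r ^ 2) x ∂Q =
      r ^ 2 * Q.real {x | ‖L x - b‖ ≤ r} := by
    rw [integral_indicator_const _ hm, smul_eq_mul, mul_comm]
  rw [← h1]
  refine integral_mono (integrable_truncated Q r L b) ((integrable_const _).indicator hm)
    fun x => ?_
  simp only [Set.indicator_apply, Set.mem_ofPred_eq]
  split_ifs with h
  · exact (truncated_mem_Icc r _).2
  · refine max_le ?_ le_rfl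
    push Not at h
    nlinarith

omit [Nontrivial E] in
/-- The truncated loss is jointly continuous in the affine map and the law. -/
theorem tendsto_integral_truncated (hμ : Tendsto μ atTop (𝓝 P)) {r : ℝ} (hr : 0 ≤ r)
    {L : ℕ → E →L[ℝ] E} {b : ℕ → E} {L' : E →L[ℝ] E} {b' : E} (hL : Tendsto L atTop (𝓝 L'))
    (hb : Tendsto b atTop (𝓝 b')) :
    Tendsto (fun n => ∫ x, max (r ^ 2 - ‖L n x - b n‖ ^ 2) 0 ∂(μ n : Measure E)) atTop
      (𝓝 (∫ x, max (r ^ 2 - ‖L' x - b'‖ ^ 2) 0 ∂(P : Measure E))) := by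
  set F : BoundedContinuousFunction E ℝ := BoundedContinuousFunction.ofNormedAddCommGroup
    (fun x => max (r ^ 2 - ‖L' x - b'‖ ^ 2) 0) (by fun_prop) (r ^ 2) (fun x => by
      rw [Real.norm_eq_abs, abs_of_nonneg (truncated_mem_Icc r _).1]
      exact (truncated_mem_Icc r _).2)
  have hF := ProbabilityMeasure.tendsto_iff_forall_integral_tendsto.1 hμ F
  have hFx : ∀ x, F x = max (r ^ 2 - ‖L' x - b'‖ ^ 2) 0 := fun x => rfl
  simp only [hFx] at hF
  suffices hdiff : Tendsto (fun n => ∫ x, max (r ^ 2 - ‖L n x - b n‖ ^ 2) 0 ∂(μ n : Measure E) -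
      ∫ x, max (r ^ 2 - ‖L' x - b'‖ ^ 2) 0 ∂(μ n : Measure E)) atTop (𝓝 0) by
    simpa using hdiff.add hF
  rw [Metric.tendsto_atTop']
  intro ε hε
  obtain ⟨M, hM, htail⟩ := exists_eventually_norm_ge_le hμ
    (show 0 < ε / (2 * (r ^ 2 + 1)) by positivity)
  have hlim : Tendsto (fun n => 2 * r * (‖L n - L'‖ * M + ‖b n - b'‖)) atTop (𝓝 0) := by
    have h1 := tendsto_iff_norm_sub_tendsto_zero.1 hL
    have h2 := tendsto_iff_norm_sub_tendsto_zero.1 hb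
    simpa using ((h1.mul_const M).add h2).const_mul (2 * r)
  obtain ⟨N, hN⟩ := eventually_atTop.1
    (htail.and (hlim.eventually_lt_const (show 0 < ε / 2 by positivity)))
  refine ⟨N, fun n hn => ?_⟩
  obtain ⟨h1, h2⟩ := hN n hn.le
  set s := 2 * r * (‖L n - L'‖ * M + ‖b n - b'‖) with hs
  have hm : MeasurableSet {x : E | M ≤ ‖x‖} := measurableSet_le (by fun_prop) (by fun_prop)
  have hs0 : 0 ≤ s := by positivity
  rw [dist_zero_right, ← integral_sub (integrable_truncated _ r _ _) (integrable_truncated _ r _ _)]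
  have hbound : ∀ x, ‖max (r ^ 2 - ‖L n x - b n‖ ^ 2) 0 - max (r ^ 2 - ‖L' x - b'‖ ^ 2) 0‖ ≤
      s + {x : E | M ≤ ‖x‖}.indicator (fun _ => r ^ 2) x := by
    intro x
    rw [Real.norm_eq_abs]
    by_cases hx : M ≤ ‖x‖
    · rw [Set.indicator_of_mem (by exact hx), abs_le]
      have e1 := truncated_mem_Icc r (L n x - b n)
      have e2 := truncated_mem_Icc r (L' x - b')
      constructor <;> linarith [e1.1, e1.2, e2.1, e2.2]
    · rw [Set.indicator_of_notMem (by exact hx), add_zero]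
      push Not at hx
      refine (abs_truncated_sub_le hr _ _).trans ?_
      have e1 : L n x - b n - (L' x - b') = (L n - L') x - (b n - b') := by
        simp only [sub_apply]; abel
      rw [e1, hs]
      have e2 : ‖(L n - L') x - (b n - b')‖ ≤ ‖L n - L'‖ * M + ‖b n - b'‖ :=
        (norm_sub_le _ _).trans (add_le_add (((L n - L').le_opNorm x).trans (by gcongr)) le_rfl)
      gcongr
  refine lt_of_le_of_lt (norm_integral_le_of_norm_le
    ((integrable_const s).add ((integrable_const (r ^ 2)).indicator hm))
    (ae_of_all _ hbound)) ?_
  simp only [Pi.add_apply]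
  rw [integral_add (integrable_const s) ((integrable_const (r ^ 2)).indicator hm),
    integral_indicator_const _ hm]
  simp only [integral_const, probReal_univ, smul_eq_mul, one_mul]
  have h3 : (μ n : Measure E).real {x | M ≤ ‖x‖} * r ^ 2 ≤ ε / (2 * (r ^ 2 + 1)) * r ^ 2 := by
    gcongr
  have h4 : ε / (2 * (r ^ 2 + 1)) * r ^ 2 ≤ ε / 2 := by
    rw [div_mul_eq_mul_div, div_le_div_iff₀ (by positivity) (by positivity)]
    nlinarith [sq_nonneg r]
  linarith

/-- Volume-preserving affine maps whose truncated losses are asymptotically maximal subconverge to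
a linear isometry. A divergent linear part would squeeze the set where the loss is positive into a
thin slab, and a divergent shift would move it to infinity. -/
theorem exists_subseq_tendsto_isometry (hP : IsSpherical g (P : Measure E))
    (hμ : Tendsto μ atTop (𝓝 P)) {ρ r : ℝ} (hρ : 0 < ρ) (hρr : ρ ≤ r)
    (hstrict : ∀ s t, 0 ≤ s → s < ρ ^ 2 → ρ ^ 2 < t → g t < g s)
    {L : ℕ → E →L[ℝ] E} {b : ℕ → E} (hdet : ∀ n, |(L n).det| = 1)
    (hlow : ∀ ε > 0, ∀ᶠ n in atTop, ∫ x, max (r ^ 2 - ‖x‖ ^ 2) 0 ∂(P : Measure E) - ε ≤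
      ∫ x, max (r ^ 2 - ‖L n x - b n‖ ^ 2) 0 ∂(μ n : Measure E)) :
    ∃ θ : ℕ → ℕ, StrictMono θ ∧ ∃ L' : E →L[ℝ] E, (∀ x, ‖L' x‖ = ‖x‖) ∧
      Tendsto (L ∘ θ) atTop (𝓝 L') ∧ Tendsto (b ∘ θ) atTop (𝓝 0) := by
  have hr : 0 < r := hρ.trans_le hρr
  set c₀ := ∫ x, max (r ^ 2 - ‖x‖ ^ 2) 0 ∂(P : Measure E) with hc₀
  have hc₀pos : 0 < c₀ := by
    obtain ⟨v, hv⟩ := exists_ne (0 : E)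
    refine lt_of_le_of_lt ?_ (hP.integral_truncated_lt (L := ContinuousLinearMap.id ℝ E) (b := v)
      (by simp [ContinuousLinearMap.det]) (fun h => hv h.2) hρ hρr hstrict)
    exact integral_nonneg fun x => le_max_right _ _
  set ε₁ := c₀ / (2 * r ^ 2) with hε₁
  have hε₁pos : 0 < ε₁ := by positivity
  have hmass : ∀ᶠ n in atTop, ε₁ ≤ (μ n : Measure E).real {x | ‖L n x - b n‖ ≤ r} := by
    filter_upwards [hlow (c₀ / 2) (by positivity)] with n hn
    have h1 := integral_truncated_le (μ n : Measure E) hr.le (L n) (b n)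
    rw [hε₁, div_le_iff₀ (by positivity)]
    linarith
  obtain ⟨M₁, hM₁, hslab⟩ := exists_eventually_slab_le hP hμ hr.le (half_pos hε₁pos)
  have hLb : ∀ᶠ n in atTop, ‖L n‖ ≤ M₁ := by
    filter_upwards [hmass, hslab] with n h1 h2
    by_contra! hcon
    rw [← LinearIsometryEquiv.norm_map ContinuousLinearMap.adjoint] at hcon
    obtain ⟨v, hv1, hv2⟩ := ContinuousLinearMap.exists_lt_apply_of_lt_opNorm _ hcon
    have h3 := h2 _ hv2.le (inner ℝ v (b n))
    have h4 : (μ n : Measure E).real {x | ‖L n x - b n‖ ≤ r} ≤ (μ n : Measure E).real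
        {x | |inner ℝ (ContinuousLinearMap.adjoint (L n) v) x - inner ℝ v (b n)| ≤ r} := by
      refine measureReal_mono fun x (hx : ‖L n x - b n‖ ≤ r) => ?_
      rw [Set.mem_ofPred_eq, ContinuousLinearMap.adjoint_inner_left, ← inner_sub_right]
      refine (abs_real_inner_le_norm _ _).trans ?_
      nlinarith [norm_nonneg (L n x - b n), norm_nonneg v]
    linarith
  obtain ⟨M₂, hM₂, htail⟩ := exists_eventually_norm_ge_le hμ (half_pos hε₁pos)
  have hbb : ∀ᶠ n in atTop, ‖b n‖ ≤ M₁ * M₂ + r := by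
    filter_upwards [hmass, htail, hLb] with n h1 h2 h3
    by_contra! hcon
    have h4 : (μ n : Measure E).real {x | ‖L n x - b n‖ ≤ r} ≤
        (μ n : Measure E).real {x | M₂ ≤ ‖x‖} := by
      refine measureReal_mono fun x (hx : ‖L n x - b n‖ ≤ r) => ?_
      by_contra! hx2
      have hx3 : ‖x‖ < M₂ := by simpa using hx2
      have h5 : ‖L n x‖ ≤ M₁ * M₂ := ((L n).le_opNorm x).trans (by gcongr)
      have h6 := norm_sub_norm_le (b n) (L n x)
      rw [norm_sub_rev] at h6
      linarith
    linarith
  have : ProperSpace (E →L[ℝ] E) := FiniteDimensional.proper ℝ _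
  have : ProperSpace E := FiniteDimensional.proper ℝ _
  have hbdd : Bornology.IsBounded
      (Metric.closedBall (0 : E →L[ℝ] E) M₁ ×ˢ Metric.closedBall (0 : E) (M₁ * M₂ + r)) :=
    Metric.isBounded_closedBall.prod Metric.isBounded_closedBall
  obtain ⟨⟨L', b'⟩, -, θ, hθ, hlim⟩ := tendsto_subseq_of_frequently_bounded hbdd
    (x := fun n => (L n, b n)) (by
      refine Eventually.frequently ?_
      filter_upwards [hLb, hbb] with n h1 h2
      exact ⟨by simpa using h1, by simpa using h2⟩)
  rw [nhds_prod_eq] at hlim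
  have hL' : Tendsto (L ∘ θ) atTop (𝓝 L') := tendsto_fst.comp hlim
  have hb' : Tendsto (b ∘ θ) atTop (𝓝 b') := tendsto_snd.comp hlim
  have hdet' : |L'.det| = 1 := by
    have h1 : Tendsto (fun k => |((L ∘ θ) k).det|) atTop (𝓝 |L'.det|) :=
      ((ContinuousLinearMap.continuous_det.tendsto L').comp hL').abs
    simp only [Function.comp_apply, hdet] at h1
    exact tendsto_nhds_unique h1 tendsto_const_nhds |>.symm ▸ rfl
  have hint := tendsto_integral_truncated (hμ.comp hθ.tendsto_atTop) hr.le hL' hb'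
  have hiso : (∀ x, ‖L' x‖ = ‖x‖) ∧ b' = 0 := by
    by_contra hne
    have hlt := hP.integral_truncated_lt hdet' hne hρ hρr hstrict
    rw [← hc₀] at hlt
    have h1 : c₀ ≤ ∫ x, max (r ^ 2 - ‖L' x - b'‖ ^ 2) 0 ∂(P : Measure E) := by
      refine le_of_forall_pos_le_add fun ε hε => ?_
      have h2 := ge_of_tendsto hint (hθ.tendsto_atTop.eventually (hlow ε hε))
      linarith
    linarith
  exact ⟨θ, hθ, L', hiso.1, hL', hiso.2 ▸ hb'⟩

/-- Volume-preserving affine maps whose truncated losses are asymptotically maximal are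
asymptotically isometric, uniformly on bounded sets, and their losses converge to the maximum. -/
theorem eventually_near_isometry (hP : IsSpherical g (P : Measure E))
    (hμ : Tendsto μ atTop (𝓝 P)) {ρ r : ℝ} (hρ : 0 < ρ) (hρr : ρ ≤ r)
    (hstrict : ∀ s t, 0 ≤ s → s < ρ ^ 2 → ρ ^ 2 < t → g t < g s)
    {L : ℕ → E →L[ℝ] E} {b : ℕ → E} (hdet : ∀ n, |(L n).det| = 1)
    (hlow : ∀ ε > 0, ∀ᶠ n in atTop, ∫ x, max (r ^ 2 - ‖x‖ ^ 2) 0 ∂(P : Measure E) - ε ≤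
      ∫ x, max (r ^ 2 - ‖L n x - b n‖ ^ 2) 0 ∂(μ n : Measure E)) {M ε : ℝ}
    (hε : 0 < ε) :
    ∀ᶠ n in atTop, (∀ x, ‖x‖ ≤ M → ‖L n x - b n‖ ≤ ‖x‖ + ε) ∧
      ∫ x, max (r ^ 2 - ‖L n x - b n‖ ^ 2) 0 ∂(μ n : Measure E) ≤
        ∫ x, max (r ^ 2 - ‖x‖ ^ 2) 0 ∂(P : Measure E) + ε := by
  by_contra hcon
  obtain ⟨φ, hφ, hφn⟩ := extraction_of_frequently_atTop (not_eventually.1 hcon)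
  have hr : 0 < r := hρ.trans_le hρr
  obtain ⟨θ, hθ, L', hiso, hL', hb'⟩ := exists_subseq_tendsto_isometry hP
    (hμ.comp hφ.tendsto_atTop) hρ hρr hstrict (L := L ∘ φ) (b := b ∘ φ) (fun n => hdet _)
    (fun ε hε => hφ.tendsto_atTop.eventually (hlow ε hε))
  have hint := tendsto_integral_truncated ((hμ.comp hφ.tendsto_atTop).comp hθ.tendsto_atTop)
    hr.le hL' hb'
  simp only [sub_zero, hiso] at hint
  have hlim : Tendsto (fun k => ‖((L ∘ φ) ∘ θ) k - L'‖ * M + ‖((b ∘ φ) ∘ θ) k - 0‖) atTop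
      (𝓝 0) := by
    have h1 := tendsto_iff_norm_sub_tendsto_zero.1 hL'
    have h2 := tendsto_iff_norm_sub_tendsto_zero.1 hb'
    simpa using (h1.mul_const M).add h2
  obtain ⟨k, hk1, hk2⟩ := ((hint.eventually_lt_const (lt_add_of_pos_right _ hε)).and
    (hlim.eventually_lt_const hε)).exists
  refine hφn (θ k) ⟨fun x hx => ?_, hk1.le⟩
  have e1 : L (φ (θ k)) x - b (φ (θ k)) = L' x + ((L (φ (θ k)) - L') x - (b (φ (θ k)) - 0)) := by
    simp only [sub_apply]; abel
  rw [e1]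
  refine (norm_add_le _ _).trans ?_
  rw [hiso]
  refine add_le_add le_rfl (le_trans ?_ hk2.le)
  exact (norm_sub_le _ _).trans
    (add_le_add (((L (φ (θ k)) - L').le_opNorm x).trans (by simp only [Function.comp_apply]; gcongr)) le_rfl)

end

/-! ### Sample covariance matrices and the truncated loss -/

section
variable {p n : ℕ}

theorem real_inner_eq_dotProduct (v w : EuclideanSpace ℝ (Fin p)) :
    inner ℝ v w = v.ofLp ⬝ᵥ w.ofLp := by
  rw [EuclideanSpace.inner_eq_star_dotProduct, dotProduct_comm]
  simp

theorem norm_sq_eq_dotProduct (v : EuclideanSpace ℝ (Fin p)) : ‖v‖ ^ 2 = v.ofLp ⬝ᵥ v.ofLp := by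
  rw [← real_inner_self_eq_norm_sq, real_inner_eq_dotProduct]

theorem norm_sq_toEuclideanCLM (N : Matrix (Fin p) (Fin p) ℝ) (v : EuclideanSpace ℝ (Fin p)) :
    ‖Matrix.toEuclideanCLM (𝕜 := ℝ) N v‖ ^ 2 = v.ofLp ⬝ᵥ ((Nᵀ * N) *ᵥ v.ofLp) := by
  rw [norm_sq_eq_dotProduct, Matrix.ofLp_toEuclideanCLM, ← Matrix.mulVec_mulVec,
    Matrix.dotProduct_mulVec v.ofLp, Matrix.vecMul_transpose]

theorem det_toEuclideanCLM (N : Matrix (Fin p) (Fin p) ℝ) :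
    (Matrix.toEuclideanCLM (𝕜 := ℝ) N).det = N.det := by
  rw [ContinuousLinearMap.det, Matrix.coe_toEuclideanCLM_eq_toEuclideanLin,
    Matrix.toEuclideanLin_eq_toLin_orthonormal, LinearMap.det_toLin]

/-- A positive semidefinite real matrix is a Gram matrix. -/
theorem exists_eq_transpose_mul_self {A : Matrix (Fin p) (Fin p) ℝ} (hA : A.PosSemidef) :
    ∃ N : Matrix (Fin p) (Fin p) ℝ, A = Nᵀ * N := by
  open scoped MatrixOrder in
  obtain ⟨N, hN⟩ := CStarAlgebra.nonneg_iff_eq_star_mul_self.1 hA.nonneg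
  exact ⟨N, by simpa [Matrix.star_eq_conjTranspose] using hN⟩

theorem sum_norm_sq_toEuclideanCLM (x : Fin n → EuclideanSpace ℝ (Fin p)) {H : Finset (Fin n)}
    (hH : 1 < H.card) (N : Matrix (Fin p) (Fin p) ℝ) :
    ∑ i ∈ H, ‖Matrix.toEuclideanCLM (𝕜 := ℝ) N (x i - sampleMean x H)‖ ^ 2 =
      ((H.card : ℝ) - 1) * (Nᵀ * N * sampleCov x H).trace := by
  have hc : ((H.card : ℝ) - 1) ≠ 0 := by
    have : (1 : ℝ) < H.card := by exact_mod_cast hH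
    linarith
  rw [sampleCov, Matrix.mul_smul, Matrix.trace_smul, smul_eq_mul, mul_inv_cancel_left₀ hc,
    Matrix.mul_sum, Matrix.trace_sum]
  refine Finset.sum_congr rfl fun i _ => ?_
  rw [norm_sq_toEuclideanCLM, Matrix.mul_vecMulVec, Matrix.trace_vecMulVec, dotProduct_comm]

theorem posSemidef_sampleCov (x : Fin n → EuclideanSpace ℝ (Fin p)) {H : Finset (Fin n)}
    (hH : 1 < H.card) : (sampleCov x H).PosSemidef := by
  have hc : 0 ≤ ((H.card : ℝ) - 1)⁻¹ := by
    have : (1 : ℝ) < H.card := by exact_mod_cast hH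
    exact inv_nonneg.2 (by linarith)
  refine Matrix.PosSemidef.smul (Matrix.posSemidef_sum _ fun i _ => ?_) hc
  simpa using Matrix.posSemidef_vecMulVec_self_star (x i - sampleMean x H).ofLp

theorem posDef_sampleCov (x : Fin n → EuclideanSpace ℝ (Fin p)) {H : Finset (Fin n)}
    (hH : 1 < H.card)
    (hgen : ∀ v : EuclideanSpace ℝ (Fin p), v ≠ 0 → ∀ c : ℝ, ∃ i ∈ H, inner ℝ v (x i) ≠ c) :
    (sampleCov x H).PosDef := by
  refine Matrix.PosDef.of_dotProduct_mulVec_pos (posSemidef_sampleCov x hH).1 fun v hv => ?_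
  have hc : 0 < ((H.card : ℝ) - 1)⁻¹ := by
    have : (1 : ℝ) < H.card := by exact_mod_cast hH
    exact inv_pos.2 (by linarith)
  obtain ⟨i, hi, hne⟩ := hgen (WithLp.toLp 2 v) (by simpa using hv)
    (inner ℝ (WithLp.toLp 2 v) (sampleMean x H))
  have hterm : ∀ j, v ⬝ᵥ (Matrix.vecMulVec (x j - sampleMean x H).ofLp
      (x j - sampleMean x H).ofLp *ᵥ v) =
      (inner ℝ (WithLp.toLp 2 v) (x j) - inner ℝ (WithLp.toLp 2 v) (sampleMean x H)) ^ 2 := by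
    intro j
    rw [← inner_sub_right, real_inner_eq_dotProduct, Matrix.vecMulVec_mulVec, op_smul_eq_smul,
      dotProduct_smul, smul_eq_mul, dotProduct_comm _ v, sq]
  rw [sampleCov, Matrix.smul_mulVec, Matrix.sum_mulVec, dotProduct_smul, dotProduct_sum,
    smul_eq_mul, star_trivial]
  refine mul_pos hc (Finset.sum_pos' (fun j _ => ?_) ⟨i, hi, ?_⟩)
  · rw [hterm]; positivity
  · rw [hterm]
    have := sub_ne_zero.2 hne
    positivity

/-- The arithmetic-geometric mean inequality for the eigenvalues of a matrix. -/
theorem card_mul_det_rpow_le_trace (hp : 0 < p) {A : Matrix (Fin p) (Fin p) ℝ}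
    (hA : A.PosSemidef) : p * A.det ^ (1 / p : ℝ) ≤ A.trace := by
  have hp' : (0 : ℝ) < p := by exact_mod_cast hp
  have h := Real.geom_mean_le_arith_mean Finset.univ (fun _ => (1 : ℝ)) hA.1.eigenvalues
    (fun _ _ => zero_le_one) (by simpa using hp') (fun i _ => hA.eigenvalues_nonneg i)
  simp only [Real.rpow_one, Finset.sum_const, Finset.card_univ, Fintype.card_fin, nsmul_eq_mul,
    mul_one, one_mul] at h
  rw [hA.1.det_eq_prod_eigenvalues, hA.1.trace_eq_sum_eigenvalues]
  simp only [RCLike.ofReal_real_eq_id, id_eq, one_div]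
  rw [le_div_iff₀ hp'] at h
  linarith

theorem sum_norm_sub_sampleMean_sq_le (x : Fin n → EuclideanSpace ℝ (Fin p))
    {K : Finset (Fin n)} (hK : 0 < K.card) :
    ∑ i ∈ K, ‖x i - sampleMean x K‖ ^ 2 ≤ ∑ i ∈ K, ‖x i‖ ^ 2 := by
  have hc : (K.card : ℝ) ≠ 0 := by exact_mod_cast hK.ne'
  have h1 : ∑ i ∈ K, inner ℝ (x i) (sampleMean x K) = K.card * ‖sampleMean x K‖ ^ 2 := by
    have h2 : ∑ i ∈ K, x i = (K.card : ℝ) • sampleMean x K := by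
      rw [sampleMean, smul_inv_smul₀ hc]
    rw [← sum_inner, h2, real_inner_smul_left, real_inner_self_eq_norm_sq]
  simp only [norm_sub_sq_real, Finset.sum_add_distrib, Finset.sum_sub_distrib, ← Finset.mul_sum,
    h1, Finset.sum_const, nsmul_eq_mul]
  have : 0 ≤ (K.card : ℝ) * ‖sampleMean x K‖ ^ 2 := by positivity
  linarith

/-- If the covariance determinant over `H` is at most that over `K`, some volume-preserving
affine map makes the total squared norm over `H` at most the one over `K`: the map whitens the
observations in `H`, rescaled to determinant one. -/
theorem exists_affine_sum_norm_sq_le (hp : 0 < p) (x : Fin n → EuclideanSpace ℝ (Fin p))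
    {H : Finset (Fin n)} (hH : 1 < H.card) (hpos : (sampleCov x H).PosDef) :
    ∃ (L : EuclideanSpace ℝ (Fin p) →L[ℝ] EuclideanSpace ℝ (Fin p))
      (b : EuclideanSpace ℝ (Fin p)), |L.det| = 1 ∧ ∀ K : Finset (Fin n), K.card = H.card →
        (sampleCov x H).det ≤ (sampleCov x K).det →
        ∑ i ∈ H, ‖L (x i) - b‖ ^ 2 ≤ ∑ i ∈ K, ‖x i‖ ^ 2 := by
  have hp' : (0 : ℝ) < p := by exact_mod_cast hp
  have hc : 0 < (H.card : ℝ) - 1 := by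
    have : (1 : ℝ) < H.card := by exact_mod_cast hH
    linarith
  obtain ⟨N, hN⟩ := exists_eq_transpose_mul_self hpos.inv.posSemidef
  have hδ : 0 < (sampleCov x H).det := hpos.det_pos
  set δ := (sampleCov x H).det with hδdef
  set s : ℝ := δ ^ (1 / (2 * p) : ℝ) with hs
  have hs2 : s ^ 2 = δ ^ (1 / p : ℝ) := by
    rw [hs, ← Real.rpow_natCast, ← Real.rpow_mul hδ.le]
    congr 1
    push_cast
    field_simp
  have hsp : (s ^ p) ^ 2 = δ := by
    rw [← pow_mul, mul_comm, pow_mul, hs2, ← Real.rpow_natCast, ← Real.rpow_mul hδ.le,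
      one_div_mul_cancel hp'.ne', Real.rpow_one]
  have hNdet : N.det ^ 2 = δ⁻¹ := by
    have h1 : (sampleCov x H)⁻¹.det = N.det ^ 2 := by
      rw [hN, Matrix.det_mul, Matrix.det_transpose, sq]
    rw [← h1, Matrix.det_nonsing_inv, Ring.inverse_eq_inv']
  refine ⟨Matrix.toEuclideanCLM (𝕜 := ℝ) (s • N),
    Matrix.toEuclideanCLM (𝕜 := ℝ) (s • N) (sampleMean x H), ?_, fun K hK hdet => ?_⟩
  · have hsq : (s • N).det ^ 2 = 1 := by
      rw [Matrix.det_smul, Fintype.card_fin, mul_pow, hsp, hNdet, mul_inv_cancel₀ hδ.ne']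
    rw [det_toEuclideanCLM, ← sq_eq_sq₀ (abs_nonneg _) zero_le_one, sq_abs, hsq, one_pow]
  · have hK1 : 1 < K.card := hK ▸ hH
    have e1 : ∑ i ∈ H, ‖Matrix.toEuclideanCLM (𝕜 := ℝ) (s • N) (x i) -
        Matrix.toEuclideanCLM (𝕜 := ℝ) (s • N) (sampleMean x H)‖ ^ 2 =
        ((H.card : ℝ) - 1) * (p * δ ^ (1 / p : ℝ)) := by
      simp only [← map_sub]
      rw [sum_norm_sq_toEuclideanCLM x hH, Matrix.transpose_smul, Matrix.smul_mul,
        Matrix.mul_smul, ← hN, smul_smul, Matrix.smul_mul,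
        Matrix.nonsing_inv_mul _ (isUnit_iff_ne_zero.2 hδ.ne'), Matrix.trace_smul,
        Matrix.trace_one, ← sq, hs2, Fintype.card_fin, smul_eq_mul]
      ring
    have e2 : ∑ i ∈ K, ‖x i - sampleMean x K‖ ^ 2 =
        ((H.card : ℝ) - 1) * (sampleCov x K).trace := by
      have := sum_norm_sq_toEuclideanCLM x hK1 1
      rw [hK] at this
      simpa using this
    have e3 := card_mul_det_rpow_le_trace hp (posSemidef_sampleCov x hK1)
    have e4 : δ ^ (1 / p : ℝ) ≤ (sampleCov x K).det ^ (1 / p : ℝ) := by gcongr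
    calc _ = ((H.card : ℝ) - 1) * (p * δ ^ (1 / p : ℝ)) := e1
      _ ≤ ((H.card : ℝ) - 1) * (p * (sampleCov x K).det ^ (1 / p : ℝ)) := by gcongr
      _ ≤ ((H.card : ℝ) - 1) * (sampleCov x K).trace := by gcongr
      _ = ∑ i ∈ K, ‖x i - sampleMean x K‖ ^ 2 := e2.symm
      _ ≤ _ := sum_norm_sub_sampleMean_sq_le x (by omega)

end

/-! ### The minimum covariance determinant subset near a spherical law -/

section
variable {E : Type*} [NormedAddCommGroup E] [InnerProductSpace ℝ E]
  [FiniteDimensional ℝ E] [MeasurableSpace E] [BorelSpace E] {g : ℝ → ℝ}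

/-- Ball probabilities are strictly increasing in the radius until they reach one. -/
theorem IsSpherical.real_closedBall_lt [Nontrivial E] {P : Measure E} (hP : IsSpherical g P)
    {r₁ r₂ : ℝ} (h0 : 0 ≤ r₁) (h12 : r₁ < r₂) (h1 : P.real (Metric.closedBall 0 r₁) < 1) :
    P.real (Metric.closedBall 0 r₁) < P.real (Metric.closedBall 0 r₂) := by
  have := hP.prob
  -- some point outside the small ball carries positive density
  obtain ⟨x, hx, hxg⟩ : ∃ x : E, r₁ < ‖x‖ ∧ 0 < g (‖x‖ ^ 2) := by
    by_contra! hno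
    have hm : MeasurableSet (Metric.closedBall (0 : E) r₁)ᶜ :=
      Metric.isClosed_closedBall.measurableSet.compl
    have h2 : P (Metric.closedBall 0 r₁)ᶜ = 0 := by
      rw [hP.density, withDensity_apply _ hm,
        setLIntegral_eq_zero_iff hm hP.measurable_density.ennreal_ofReal]
      exact ae_of_all _ fun x hx => by simpa using hno x (by simpa using hx)
    have h3 := probReal_compl_eq_one_sub (μ := P)
      (Metric.isClosed_closedBall (x := (0 : E)) (ε := r₁)).measurableSet
    rw [measureReal_def, h2, ENNReal.toReal_zero] at h3
    linarith
  have hopen : IsOpen {y : E | ‖y‖ < min r₂ ‖x‖ ∧ r₁ < ‖y‖} :=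
    isOpen_setOf_lt_and_lt (by fun_prop) (by fun_prop) _ _
  obtain ⟨t, ht1, ht2⟩ := exists_between (lt_min h12 hx)
  obtain ⟨z, hz⟩ := exists_norm_eq E (h0.trans ht1.le)
  have hpos : 0 < P {y : E | ‖y‖ < min r₂ ‖x‖ ∧ r₁ < ‖y‖} := by
    refine hP.measure_pos_of_isOpen hopen ⟨z, by rw [hz]; exact ht2, by rw [hz]; exact ht1⟩
      fun y hy => hxg.trans_le (hP.antitone ?_ ?_ ?_)
    · exact Set.mem_Ici.2 (by positivity)
    · exact Set.mem_Ici.2 (by positivity)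
    · have := hy.1.trans_le (min_le_right _ _)
      gcongr
  have hdisj : Disjoint (Metric.closedBall (0 : E) r₁) {y : E | ‖y‖ < min r₂ ‖x‖ ∧ r₁ < ‖y‖} := by
    rw [Set.disjoint_left]
    intro y hy hy'
    exact absurd hy'.2 (not_lt.2 (by simpa using hy))
  have hsub : Metric.closedBall (0 : E) r₁ ∪ {y : E | ‖y‖ < min r₂ ‖x‖ ∧ r₁ < ‖y‖} ⊆
      Metric.closedBall 0 r₂ := by
    rintro y (hy | hy)
    · exact Metric.closedBall_subset_closedBall h12.le hy
    · simpa using (hy.1.trans_le (min_le_left _ _)).le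
  have h4 := measureReal_mono (μ := P) hsub
  rw [measureReal_union hdisj hopen.measurableSet] at h4
  have h5 : 0 < P.real {y : E | ‖y‖ < min r₂ ‖x‖ ∧ r₁ < ‖y‖} :=
    ENNReal.toReal_pos hpos.ne' (by finiteness)
  linarith

theorem IsSpherical.tendsto_real_closedBall [Nontrivial E] {P : ProbabilityMeasure E}
    (hP : IsSpherical g (P : Measure E)) {μ : ℕ → ProbabilityMeasure E}
    (hμ : Tendsto μ atTop (𝓝 P)) (ρ : ℝ) :
    Tendsto (fun n => (μ n : Measure E).real (Metric.closedBall 0 ρ)) atTop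
      (𝓝 ((P : Measure E).real (Metric.closedBall 0 ρ))) := by
  have hfr : (P : Measure E) (frontier (Metric.closedBall (0 : E) ρ)) = 0 :=
    measure_mono_null Metric.frontier_closedBall_subset_sphere (hP.real_sphere_eq_zero ρ)
  have h := ProbabilityMeasure.tendsto_measure_of_null_frontier_of_tendsto hμ
    (E := Metric.closedBall (0 : E) ρ) (by
      rw [ProbabilityMeasure.null_iff_toMeasure_null]; exact hfr)
  exact (NNReal.tendsto_coe.2 h)

end

section
variable {p : ℕ}

theorem card_filter_norm_le_div (x : ℕ → EuclideanSpace ℝ (Fin p)) {n : ℕ} (hn : 0 < n) (ρ : ℝ) :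
    ((Finset.univ.filter fun i : Fin n => ‖x i‖ ≤ ρ).card : ℝ) / n =
      (empiricalProb x n : Measure (EuclideanSpace ℝ (Fin p))).real (Metric.closedBall 0 ρ) := by
  classical
  rw [coe_empiricalProb x hn, empiricalMeasure_real_apply]
  simp

/-- If `r` is the radius of the ball of limiting probability `α`, some subsets of the prescribed
sizes have total squared norm at most the value predicted by the truncated loss, up to `o(n)`. -/
theorem eventually_exists_sum_norm_sq_le (hp : 0 < p) {g : ℝ → ℝ}
    {P : ProbabilityMeasure (EuclideanSpace ℝ (Fin p))}
    (hP : IsSpherical g (P : Measure (EuclideanSpace ℝ (Fin p))))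
    {x : ℕ → EuclideanSpace ℝ (Fin p)} (hμ : Tendsto (empiricalProb x) atTop (𝓝 P))
    {h : ℕ → ℕ} (hle : ∀ᶠ n in atTop, h n ≤ n) {α : ℝ}
    (hlim : Tendsto (fun n => (h n : ℝ) / n) atTop (𝓝 α)) (hα1 : α < 1) {r : ℝ} (hr : 0 < r)
    (hrα : (P : Measure (EuclideanSpace ℝ (Fin p))).real (Metric.closedBall 0 r) = α) {η : ℝ}
    (hη : 0 < η) :
    ∀ᶠ n in atTop, ∃ K : Finset (Fin n), K.card = h n ∧
      ∑ i ∈ K, ‖x i‖ ^ 2 ≤ h n * r ^ 2 - ∑ i : Fin n, max (r ^ 2 - ‖x i‖ ^ 2) 0 + n * η := by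
  have : Nonempty (Fin p) := ⟨⟨0, hp⟩⟩
  obtain ⟨r₁, hr10, hr1, hr1η⟩ : ∃ r₁, 0 ≤ r₁ ∧ r₁ < r ∧ r ^ 2 - r₁ ^ 2 ≤ η / 2 := by
    have h1 : √(max (r ^ 2 - η / 2) 0) < r := by
      rw [Real.sqrt_lt' hr]
      exact max_lt (by linarith) (by positivity)
    refine ⟨_, Real.sqrt_nonneg _, h1, ?_⟩
    rw [Real.sq_sqrt (le_max_right _ _)]
    linarith [le_max_left (r ^ 2 - η / 2) 0]
  obtain ⟨r₂, hr2, hr2η⟩ : ∃ r₂, r < r₂ ∧ r₂ ^ 2 - r ^ 2 ≤ η / 2 := by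
    refine ⟨√(r ^ 2 + η / 2), Real.lt_sqrt_of_sq_lt (by linarith), ?_⟩
    rw [Real.sq_sqrt (by positivity)]
    linarith
  have hlt1 := hP.real_closedBall_lt hr10 hr1 (lt_of_le_of_lt
    (measureReal_mono (Metric.closedBall_subset_closedBall hr1.le)) (hrα.trans_lt hα1))
  have hlt2 := hP.real_closedBall_lt hr.le hr2 (hrα.trans_lt hα1)
  rw [hrα] at hlt1 hlt2
  obtain ⟨c₁, hc11, hc12⟩ := exists_between hlt1
  obtain ⟨c₂, hc21, hc22⟩ := exists_between hlt2
  filter_upwards [hle, eventually_gt_atTop 0, hlim.eventually_const_lt hc12,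
    hlim.eventually_lt_const hc21,
    (hP.tendsto_real_closedBall hμ r₁).eventually_lt_const hc11,
    (hP.tendsto_real_closedBall hμ r₂).eventually_const_lt hc22] with n hhn hn h1 h2 h3 h4
  rw [← card_filter_norm_le_div x hn] at h3 h4
  have hn' : (0 : ℝ) < n := by exact_mod_cast hn
  have hb1 : (Finset.univ.filter fun i : Fin n => ‖x i‖ ≤ r₁).card ≤ h n := by
    have := h3.trans h1
    rw [div_lt_div_iff_of_pos_right hn'] at this
    exact_mod_cast this.le
  have hb2 : h n ≤ (Finset.univ.filter fun i : Fin n => ‖x i‖ ≤ r₂).card := by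
    have := h2.trans h4
    rw [div_lt_div_iff_of_pos_right hn'] at this
    exact_mod_cast this.le
  have hsub : (Finset.univ.filter fun i : Fin n => ‖x i‖ ≤ r₁) ⊆
      Finset.univ.filter fun i : Fin n => ‖x i‖ ≤ r₂ :=
    Finset.monotone_filter_right _ fun i _ hi => hi.trans (hr1.trans hr2).le
  obtain ⟨K, hK1, hK2, hK⟩ := Finset.exists_subsuperset_card_eq hsub hb1 hb2
  refine ⟨K, hK, ?_⟩
  have hin : ∑ i ∈ K, ‖x i‖ ^ 2 ≤ ∑ i ∈ K, (r ^ 2 - max (r ^ 2 - ‖x i‖ ^ 2) 0 + η / 2) := by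
    refine Finset.sum_le_sum fun i hi => ?_
    have hi2 : ‖x i‖ ≤ r₂ := (Finset.mem_filter.1 (hK2 hi)).2
    have hi3 : ‖x i‖ ^ 2 ≤ r₂ ^ 2 := by gcongr
    rcases max_cases (r ^ 2 - ‖x i‖ ^ 2) 0 with ⟨e, -⟩ | ⟨e, -⟩ <;> rw [e] <;> linarith
  have hout : ∑ i ∈ Kᶜ, max (r ^ 2 - ‖x i‖ ^ 2) 0 ≤ ∑ i ∈ Kᶜ, η / 2 := by
    refine Finset.sum_le_sum fun i hi => max_le ?_ (by positivity)
    have hi1 : ¬ ‖x i‖ ≤ r₁ := fun hcon =>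
      (Finset.mem_compl.1 hi) (hK1 (Finset.mem_filter.2 ⟨Finset.mem_univ _, hcon⟩))
    push Not at hi1
    have : r₁ ^ 2 ≤ ‖x i‖ ^ 2 := by gcongr
    linarith
  rw [Finset.sum_add_distrib, Finset.sum_sub_distrib, Finset.sum_const, Finset.sum_const,
    nsmul_eq_mul, nsmul_eq_mul, hK] at hin
  rw [Finset.sum_const, nsmul_eq_mul] at hout
  have hsplit := Finset.sum_add_sum_compl K fun i : Fin n => max (r ^ 2 - ‖x i‖ ^ 2) 0
  have hc1 : (h n : ℝ) * (η / 2) ≤ n * (η / 2) := by gcongr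
  have hc2 : (Kᶜ.card : ℝ) * (η / 2) ≤ n * (η / 2) := by
    have : (Kᶜ.card : ℝ) ≤ n := by
      exact_mod_cast (Finset.card_le_univ _).trans_eq (Fintype.card_fin n)
    gcongr
  linarith

/-- The determinant-minimizing subsets asymptotically contain all observations in any ball that is
smaller than the one of probability `α`. The whitening affine map of the subset is an asymptotic
maximizer of the truncated loss, hence an asymptotic isometry, and the loss over the observations
outside of the subset is asymptotically negligible. -/
theorem tendsto_card_notMem_mcd (hp : 0 < p) {g : ℝ → ℝ}
    {P : ProbabilityMeasure (EuclideanSpace ℝ (Fin p))}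
    (hP : IsSpherical g (P : Measure (EuclideanSpace ℝ (Fin p))))
    {x : ℕ → EuclideanSpace ℝ (Fin p)} (hμ : Tendsto (empiricalProb x) atTop (𝓝 P))
    {h : ℕ → ℕ} (hle : ∀ᶠ n in atTop, h n ≤ n) {α : ℝ}
    (hlim : Tendsto (fun n => (h n : ℝ) / n) atTop (𝓝 α)) (hα : 0 < α) (hα1 : α < 1)
    (hflat : ∀ s : ℝ, 0 < s → (∀ t ∈ Set.Ioo 0 s, ∀ t' ∈ Set.Ioo 0 s, g t = g t') →
      (P : Measure (EuclideanSpace ℝ (Fin p))).real {x | ‖x‖ ^ 2 ≤ s} ≤ α)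
    {H : ∀ n : ℕ, Finset (Fin n)}
    (hH : ∀ᶠ n in atTop, IsMCDIndexSet (fun i : Fin n => x i) (h n) (H n)) {r : ℝ} (hr : 0 < r)
    (hrα : (P : Measure (EuclideanSpace ℝ (Fin p))).real (Metric.closedBall 0 r) = α) {r₀ : ℝ}
    (hr₀ : 0 ≤ r₀) (hr₀r : r₀ < r) :
    Tendsto (fun n : ℕ => ((Finset.univ.filter fun i : Fin n => ‖x i‖ ≤ r₀ ∧ i ∉ H n).card : ℝ) / n)
      atTop (𝓝 0) := by
  have : Nonempty (Fin p) := ⟨⟨0, hp⟩⟩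
  obtain ⟨ρ, hρ, hρr, hstrict⟩ := hP.exists_strict_radius hr hrα hflat
  -- the subsets have at least two elements and a nonsingular covariance matrix
  have hgood : ∀ᶠ n in atTop, 1 < (H n).card ∧ (sampleCov (fun i : Fin n => x i) (H n)).PosDef := by
    obtain ⟨M, hM, hslab⟩ := exists_eventually_slab_le hP hμ le_rfl (show 0 < α / 3 by positivity)
    have hbig : ∀ᶠ n : ℕ in atTop, 1 < α / 2 * n :=
      (tendsto_natCast_atTop_atTop.const_mul_atTop (show 0 < α / 2 by positivity)).eventually_gt_atTop 1
    filter_upwards [hslab, hH, hbig, eventually_gt_atTop 0,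
      hlim.eventually_const_lt (show α / 2 < α by linarith)] with n h1 h2 h3 hn h4
    have hn' : (0 : ℝ) < n := by exact_mod_cast hn
    have h5 : 1 < (H n).card := by
      rw [lt_div_iff₀ hn'] at h4
      rw [h2.1]
      exact_mod_cast h3.trans h4
    refine ⟨h5, posDef_sampleCov _ h5 fun v hv c => ?_⟩
    by_contra! hcon
    have hv0 : 0 < ‖v‖ := norm_pos_iff.2 hv
    have h6 := h1 ((M / ‖v‖) • v) (by
      rw [norm_smul, Real.norm_of_nonneg (by positivity), div_mul_cancel₀ _ hv0.ne'])
      (M / ‖v‖ * c)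
    classical
    rw [coe_empiricalProb x hn, empiricalMeasure_real_apply] at h6
    have h7 : (H n).card ≤ (Finset.univ.filter fun i : Fin n => x i ∈
        {y | |inner ℝ ((M / ‖v‖) • v) y - M / ‖v‖ * c| ≤ 0}).card := by
      refine Finset.card_le_card fun i hi => Finset.mem_filter.2 ⟨Finset.mem_univ _, ?_⟩
      rw [Set.mem_ofPred_eq, real_inner_smul_left, hcon i hi, sub_self, abs_zero]
    have h8 : (h n : ℝ) / n ≤ α / 3 := by
      refine le_trans ?_ h6
      rw [← h2.1]
      gcongr
    linarith
  -- the whitening maps; the identity serves where the covariance matrix is singular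
  have hex : ∀ n : ℕ, ∃ (L : EuclideanSpace ℝ (Fin p) →L[ℝ] EuclideanSpace ℝ (Fin p))
      (b : EuclideanSpace ℝ (Fin p)), |L.det| = 1 ∧
        (1 < (H n).card ∧ (sampleCov (fun i : Fin n => x i) (H n)).PosDef →
          ∀ K : Finset (Fin n), K.card = (H n).card →
            (sampleCov (fun i : Fin n => x i) (H n)).det ≤
              (sampleCov (fun i : Fin n => x i) K).det →
            ∑ i ∈ H n, ‖L (x i) - b‖ ^ 2 ≤ ∑ i ∈ K, ‖x i‖ ^ 2) := by
    intro n
    by_cases hg : 1 < (H n).card ∧ (sampleCov (fun i : Fin n => x i) (H n)).PosDef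
    · obtain ⟨L, b, hL, hK⟩ := exists_affine_sum_norm_sq_le hp (fun i : Fin n => x i) hg.1 hg.2
      exact ⟨L, b, hL, fun _ => hK⟩
    · exact ⟨ContinuousLinearMap.id ℝ _, 0, by simp [ContinuousLinearMap.det],
        fun h => absurd h hg⟩
  choose L b hdet hLb using hex
  set c₀ := ∫ y, max (r ^ 2 - ‖y‖ ^ 2) 0 ∂(P : Measure (EuclideanSpace ℝ (Fin p))) with hc₀
  have hint : Tendsto (fun n => ∫ y, max (r ^ 2 - ‖y‖ ^ 2) 0
      ∂(empiricalProb x n : Measure (EuclideanSpace ℝ (Fin p)))) atTop (𝓝 c₀) := by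
    simpa using tendsto_integral_truncated hμ hr.le
      (tendsto_const_nhds (x := ContinuousLinearMap.id ℝ (EuclideanSpace ℝ (Fin p))))
      (tendsto_const_nhds (x := (0 : EuclideanSpace ℝ (Fin p))))
  -- the loss outside of the subset is bounded by the loss deficit
  have hkey : ∀ η > 0, ∀ᶠ n : ℕ in atTop,
      (∑ i ∈ (H n)ᶜ, max (r ^ 2 - ‖L n (x i) - b n‖ ^ 2) 0) / n ≤
        ∫ y, max (r ^ 2 - ‖L n y - b n‖ ^ 2) 0
          ∂(empiricalProb x n : Measure (EuclideanSpace ℝ (Fin p))) - c₀ + η := by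
    intro η hη
    filter_upwards [hgood, hH, eventually_gt_atTop 0,
      eventually_exists_sum_norm_sq_le hp hP hμ hle hlim hα1 hr hrα (half_pos hη),
      hint.eventually_const_lt (show c₀ - η / 2 < c₀ by linarith)] with n h1 h2 hn h3 h4
    obtain ⟨K, hK, hsum⟩ := h3
    have hn' : (0 : ℝ) < n := by exact_mod_cast hn
    have h5 := hLb n h1 K (hK.trans h2.1.symm) (h2.2 K hK)
    rw [coe_empiricalProb x hn, integral_empiricalMeasure] at h4 ⊢
    have h6 := Finset.sum_add_sum_compl (H n)
      fun i : Fin n => max (r ^ 2 - ‖L n (x i) - b n‖ ^ 2) 0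
    have h7 : ∑ i ∈ H n, (r ^ 2 - ‖L n (x i) - b n‖ ^ 2) ≤
        ∑ i ∈ H n, max (r ^ 2 - ‖L n (x i) - b n‖ ^ 2) 0 :=
      Finset.sum_le_sum fun i _ => le_max_left _ _
    rw [Finset.sum_sub_distrib, Finset.sum_const, nsmul_eq_mul, h2.1] at h7
    rw [lt_div_iff₀ hn'] at h4
    rw [← h6, div_le_iff₀ hn']
    have h8 : ((∑ i ∈ H n, max (r ^ 2 - ‖L n (x i) - b n‖ ^ 2) 0 +
        ∑ i ∈ (H n)ᶜ, max (r ^ 2 - ‖L n (x i) - b n‖ ^ 2) 0) / n - c₀ + η) * n =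
        ∑ i ∈ H n, max (r ^ 2 - ‖L n (x i) - b n‖ ^ 2) 0 +
        ∑ i ∈ (H n)ᶜ, max (r ^ 2 - ‖L n (x i) - b n‖ ^ 2) 0 - c₀ * n + η * n := by
      field_simp
    rw [h8]
    linarith
  have hlow : ∀ ε > 0, ∀ᶠ n in atTop, c₀ - ε ≤ ∫ y, max (r ^ 2 - ‖L n y - b n‖ ^ 2) 0
      ∂(empiricalProb x n : Measure (EuclideanSpace ℝ (Fin p))) := by
    intro ε hε
    filter_upwards [hkey ε hε] with n hn
    have : 0 ≤ (∑ i ∈ (H n)ᶜ, max (r ^ 2 - ‖L n (x i) - b n‖ ^ 2) 0) / n :=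
      div_nonneg (Finset.sum_nonneg fun i _ => le_max_right _ _) (Nat.cast_nonneg n)
    linarith
  -- the observations in the small ball that are missed carry a loss bounded below
  set q := r ^ 2 - ((r₀ + r) / 2) ^ 2 with hq
  have hq0 : 0 < q := by nlinarith
  rw [Metric.tendsto_atTop']
  intro ε hε
  have hη : 0 < min ((r - r₀) / 2) (q * ε / 4) := lt_min (by linarith) (by positivity)
  obtain ⟨N, hN⟩ := eventually_atTop.1 ((eventually_near_isometry hP hμ hρ hρr hstrict hdet hlow
    (M := r₀) hη).and ((hkey (q * ε / 4) (by positivity)).and (eventually_gt_atTop 0)))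
  refine ⟨N, fun n hnN => ?_⟩
  obtain ⟨⟨h1, h2⟩, h3, hn⟩ := hN n hnN.le
  have hn' : (0 : ℝ) < n := by exact_mod_cast hn
  have h4 : ((Finset.univ.filter fun i : Fin n => ‖x i‖ ≤ r₀ ∧ i ∉ H n).card : ℝ) * q ≤
      ∑ i ∈ (H n)ᶜ, max (r ^ 2 - ‖L n (x i) - b n‖ ^ 2) 0 := by
    rw [← nsmul_eq_mul, ← Finset.sum_const]
    refine (Finset.sum_le_sum fun i hi => ?_).trans (Finset.sum_le_sum_of_subset_of_nonneg
      (fun i hi => Finset.mem_compl.2 (Finset.mem_filter.1 hi).2.2) fun i _ _ => le_max_right _ _)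
    have hi0 := (Finset.mem_filter.1 hi).2.1
    have h5 : ‖L n (x i) - b n‖ ≤ (r₀ + r) / 2 := by
      refine (h1 _ hi0).trans ?_
      linarith [min_le_left ((r - r₀) / 2) (q * ε / 4)]
    refine le_trans ?_ (le_max_left _ _)
    rw [hq]
    gcongr
  rw [dist_zero_right, Real.norm_of_nonneg (by positivity), ← mul_lt_mul_iff_left₀ hq0,
    div_mul_eq_mul_div]
  calc _ ≤ (∑ i ∈ (H n)ᶜ, max (r ^ 2 - ‖L n (x i) - b n‖ ^ 2) 0) / n := by gcongr
    _ ≤ q * ε / 2 := by linarith [min_le_right ((r - r₀) / 2) (q * ε / 4)]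
    _ < ε * q := by nlinarith

end

/-! ### Sample depth regions and determinant-minimizing subsets -/

section
variable {p : ℕ}

theorem IsSpherical.lt_of_real_closedBall_lt {E : Type*} [NormedAddCommGroup E]
    [InnerProductSpace ℝ E] [FiniteDimensional ℝ E] [MeasurableSpace E] [BorelSpace E] {g : ℝ → ℝ}
    {P : Measure E} (hP : IsSpherical g P) {r₁ r₂ : ℝ}
    (h : P.real (Metric.closedBall 0 r₁) < P.real (Metric.closedBall 0 r₂)) : r₁ < r₂ := by
  have := hP.prob
  by_contra! hcon
  exact absurd (measureReal_mono (μ := P) (Metric.closedBall_subset_closedBall (x := (0 : E)) hcon))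
    (not_le.2 h)

/-- The sample depth regions eventually contain every ball of probability less than `α`. -/
theorem exists_eventually_closedBall_subset_depthRegion (hp : 0 < p) {g : ℝ → ℝ}
    {P : ProbabilityMeasure (EuclideanSpace ℝ (Fin p))}
    (hP : IsSpherical g (P : Measure (EuclideanSpace ℝ (Fin p))))
    {μ : ℕ → ProbabilityMeasure (EuclideanSpace ℝ (Fin p))} (hμ : Tendsto μ atTop (𝓝 P))
    {a d : ℕ → ℝ} {α : ℝ} (hlim : Tendsto a atTop (𝓝 α))
    (hd : ∀ᶠ n in atTop,
      (P : Measure (EuclideanSpace ℝ (Fin p))).real (depthRegion P (d n)) = a n)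
    {β : ℝ} (hβ0 : 0 < β) (hβα : β < α) (hβ1 : β < 1) :
    ∃ r₀ > 0, (P : Measure (EuclideanSpace ℝ (Fin p))).real (Metric.closedBall 0 r₀) = β ∧
      ∀ᶠ n in atTop, Metric.closedBall 0 r₀ ⊆
        depthRegion (μ n : Measure (EuclideanSpace ℝ (Fin p))) (d n) := by
  have : Nonempty (Fin p) := ⟨⟨0, hp⟩⟩
  obtain ⟨κ, hκ, hpop, hsamp⟩ := exists_projDepth_eq hp hP
  obtain ⟨γ, hγ1, hγ2⟩ := exists_between (lt_min hβα hβ1)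
  have hγα := hγ2.trans_le (min_le_left _ _)
  obtain ⟨r₀, hr₀, hrβ⟩ := hP.exists_real_closedBall_eq hβ0 hβ1
  obtain ⟨ρ, hρ, hργ⟩ := hP.exists_real_closedBall_eq (hβ0.trans hγ1) (hγ2.trans_le (min_le_right _ _))
  have hr₀ρ : r₀ < ρ := hP.lt_of_real_closedBall_lt (by rw [hrβ, hργ]; exact hγ1)
  refine ⟨r₀, hr₀, hrβ, ?_⟩
  filter_upwards [(hsamp μ hμ r₀ ρ hr₀ hr₀ρ).1, hd, hlim.eventually_const_lt hγα] with n h1 h2 h3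
  -- the population region exceeds the ball of radius `ρ`, which bounds its level
  have hdn : d n ≤ (1 + ρ / κ)⁻¹ := by
    by_contra! hcon
    have hsub : depthRegion (P : Measure (EuclideanSpace ℝ (Fin p))) (d n) ⊆
        Metric.closedBall 0 ρ := by
      intro y (hy : d n ≤ projDepth _ y)
      rw [hpop] at hy
      by_contra hy2
      have hy3 : ρ < ‖y‖ := by simpa using hy2
      have : (1 + ‖y‖ / κ)⁻¹ ≤ (1 + ρ / κ)⁻¹ := by gcongr
      linarith
    have := measureReal_mono (μ := (P : Measure (EuclideanSpace ℝ (Fin p)))) hsub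
    rw [h2, hργ] at this
    linarith
  intro y hy
  exact hdn.trans (h1 y (by simpa using hy))

/-- The sample depth regions are eventually contained in every ball of probability more than
`α`. -/
theorem exists_eventually_depthRegion_subset_closedBall (hp : 0 < p) {g : ℝ → ℝ}
    {P : ProbabilityMeasure (EuclideanSpace ℝ (Fin p))}
    (hP : IsSpherical g (P : Measure (EuclideanSpace ℝ (Fin p))))
    {μ : ℕ → ProbabilityMeasure (EuclideanSpace ℝ (Fin p))} (hμ : Tendsto μ atTop (𝓝 P))
    {a d : ℕ → ℝ} {α : ℝ} (hlim : Tendsto a atTop (𝓝 α))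
    (hd : ∀ᶠ n in atTop,
      (P : Measure (EuclideanSpace ℝ (Fin p))).real (depthRegion P (d n)) = a n)
    {β : ℝ} (hα0 : 0 < α) (hβα : α < β) (hβ1 : β < 1) :
    ∃ r₀ > 0, (P : Measure (EuclideanSpace ℝ (Fin p))).real (Metric.closedBall 0 r₀) = β ∧
      ∀ᶠ n in atTop, depthRegion (μ n : Measure (EuclideanSpace ℝ (Fin p))) (d n) ⊆
        Metric.closedBall 0 r₀ := by
  have : Nonempty (Fin p) := ⟨⟨0, hp⟩⟩
  obtain ⟨κ, hκ, hpop, hsamp⟩ := exists_projDepth_eq hp hP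
  obtain ⟨γ, hγ1, hγ2⟩ := exists_between hβα
  obtain ⟨r₀, hr₀, hrβ⟩ := hP.exists_real_closedBall_eq (hα0.trans hβα) hβ1
  obtain ⟨ρ, hρ, hργ⟩ := hP.exists_real_closedBall_eq (hα0.trans hγ1) (hγ2.trans hβ1)
  have hr₀ρ : ρ < r₀ := hP.lt_of_real_closedBall_lt (by rw [hrβ, hργ]; exact hγ2)
  refine ⟨r₀, hr₀, hrβ, ?_⟩
  filter_upwards [(hsamp μ hμ ρ r₀ hρ hr₀ρ).2, hd, hlim.eventually_lt_const hγ1] with n h1 h2 h3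
  have hdn : (1 + ρ / κ)⁻¹ < d n := by
    by_contra! hcon
    have hsub : Metric.closedBall 0 ρ ⊆
        depthRegion (P : Measure (EuclideanSpace ℝ (Fin p))) (d n) := by
      intro y hy
      have hy3 : ‖y‖ ≤ ρ := by simpa using hy
      change d n ≤ projDepth _ y
      rw [hpop]
      refine hcon.trans ?_
      gcongr
    have := measureReal_mono (μ := (P : Measure (EuclideanSpace ℝ (Fin p)))) hsub
    rw [h2, hργ] at this
    linarith
  intro y (hy : d n ≤ projDepth _ y)
  by_contra hy2
  have hy3 : r₀ < ‖y‖ := by simpa using hy2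
  have := h1 y hy3.le
  linarith

theorem card_symmDiff_le {ι : Type*} [DecidableEq ι] {B D : Finset ι} (hBD : B ⊆ D)
    (H : Finset ι) :
    (symmDiff D H).card + 2 * B.card ≤ D.card + H.card + 2 * (B \ H).card := by
  have h1 : (symmDiff D H).card = (D \ H).card + (H \ D).card :=
    Finset.card_union_of_disjoint disjoint_sdiff_sdiff
  have h2 := Finset.card_sdiff_add_card_inter D H
  have h3 := Finset.card_sdiff_add_card_inter H D
  have h4 := Finset.card_sdiff_add_card_inter B H
  have h5 : (B ∩ H).card ≤ (D ∩ H).card := Finset.card_le_card (Finset.inter_subset_inter_right hBD)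
  rw [Finset.inter_comm H D] at h3
  omega

theorem empiricalMeasure_symmDiff_obsSubset {n : ℕ} {x : Fin n → EuclideanSpace ℝ (Fin p)}
    (hx : Function.Injective x) (A : Set (EuclideanSpace ℝ (Fin p))) (H : Finset (Fin n))
    [DecidablePred fun i => x i ∈ A] :
    (empiricalMeasure x).real (symmDiff A (obsSubset x H)) =
      ((symmDiff (Finset.univ.filter fun i => x i ∈ A) H).card : ℝ) / n := by
  classical
  rw [empiricalMeasure_real_apply]
  congr 3
  ext i
  have : x i ∈ obsSubset x H ↔ i ∈ H :=
    ⟨fun ⟨j, hj, hji⟩ => hx hji ▸ hj, fun hi => ⟨i, hi, rfl⟩⟩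
  simp [Set.mem_symmDiff, Finset.mem_symmDiff, this]

/-- Along a sequence without ties whose empirical distributions converge weakly to a spherical
law, the depth regions and the determinant-minimizing subsets are asymptotically equivalent: both
asymptotically have empirical mass `α`, and both contain almost all observations of any ball of
probability less than `α`. -/
theorem tendsto_real_symmDiff_of_isSpherical (hp : 0 < p) {g : ℝ → ℝ}
    {P : ProbabilityMeasure (EuclideanSpace ℝ (Fin p))}
    (hP : IsSpherical g (P : Measure (EuclideanSpace ℝ (Fin p))))
    {x : ℕ → EuclideanSpace ℝ (Fin p)} (hx : Function.Injective x)
    (hμ : Tendsto (empiricalProb x) atTop (𝓝 P))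
    {h : ℕ → ℕ} (hle : ∀ᶠ n in atTop, h n ≤ n) {α : ℝ}
    (hlim : Tendsto (fun n => (h n : ℝ) / n) atTop (𝓝 α)) (hα : 0 < α)
    (hflat : ∀ s : ℝ, 0 < s → (∀ t ∈ Set.Ioo 0 s, ∀ t' ∈ Set.Ioo 0 s, g t = g t') →
      (P : Measure (EuclideanSpace ℝ (Fin p))).real {x | ‖x‖ ^ 2 ≤ s} ≤ α)
    {d : ℕ → ℝ} (hd : ∀ᶠ n in atTop,
      (P : Measure (EuclideanSpace ℝ (Fin p))).real (depthRegion P (d n)) = (h n : ℝ) / n)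
    {H : ∀ n : ℕ, Finset (Fin n)}
    (hH : ∀ᶠ n in atTop, IsMCDIndexSet (fun i : Fin n => x i) (h n) (H n)) :
    Tendsto (fun n : ℕ => (empiricalMeasure fun i : Fin n => x i).real
      (symmDiff (depthRegion (empiricalMeasure fun i : Fin n => x i) (d n))
        (obsSubset (fun i : Fin n => x i) (H n)))) atTop (𝓝 0) := by
  classical
  have : Nonempty (Fin p) := ⟨⟨0, hp⟩⟩
  have hα1 : α ≤ 1 := by
    refine le_of_tendsto hlim ?_
    filter_upwards [hle] with n hn
    exact div_le_one_of_le₀ (by exact_mod_cast hn) (Nat.cast_nonneg n)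
  -- an upper bound for the empirical mass of the depth region
  have hD : ∀ ε > 0, ∀ᶠ n : ℕ in atTop, ((Finset.univ.filter fun i : Fin n =>
      x i ∈ depthRegion (empiricalMeasure fun i : Fin n => x i) (d n)).card : ℝ) / n < α + ε := by
    intro ε hε
    rcases hα1.lt_or_eq with hlt | rfl
    · obtain ⟨β, hβ1, hβ2⟩ := exists_between (lt_min hlt (show α < α + ε by linarith))
      obtain ⟨r, hr, hrβ, hsub⟩ := exists_eventually_depthRegion_subset_closedBall hp hP hμ hlim hd
        hα hβ1 (hβ2.trans_le (min_le_left _ _))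
      have hball := hP.tendsto_real_closedBall hμ r
      rw [hrβ] at hball
      filter_upwards [hsub, eventually_gt_atTop 0,
        hball.eventually_lt_const (hβ2.trans_le (min_le_right _ _))] with n h1 hn h2
      rw [← card_filter_norm_le_div x hn] at h2
      refine lt_of_le_of_lt ?_ h2
      rw [coe_empiricalProb x hn] at h1
      gcongr with i _
      intro hi
      simpa using h1 hi
    · filter_upwards with n
      have h1 : ((Finset.univ.filter fun i : Fin n =>
          x i ∈ depthRegion (empiricalMeasure fun i : Fin n => x i) (d n)).card : ℝ) ≤ n := by
        exact_mod_cast (Finset.card_le_univ _).trans_eq (Fintype.card_fin n)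
      linarith [div_le_one_of_le₀ h1 (Nat.cast_nonneg n)]
  rw [Metric.tendsto_atTop']
  intro ε hε
  have hmax : max (α - ε / 8) (α / 2) < α := max_lt (by linarith) (by linarith)
  obtain ⟨β, hβ1, hβα⟩ := exists_between hmax
  have hβ0 : 0 < β := lt_of_lt_of_le (by positivity) ((le_max_right _ _).trans hβ1.le)
  have hβε : α - ε / 8 < β := (le_max_left _ _).trans_lt hβ1
  obtain ⟨r₀, hr₀, hrβ, hsub⟩ := exists_eventually_closedBall_subset_depthRegion hp hP hμ hlim hd
    hβ0 hβα (hβα.trans_le hα1)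
  -- the subset misses few observations in the ball of probability `β`
  have hmiss : ∀ᶠ n : ℕ in atTop,
      ((Finset.univ.filter fun i : Fin n => ‖x i‖ ≤ r₀ ∧ i ∉ H n).card : ℝ) / n < ε / 8 := by
    rcases hα1.lt_or_eq with hlt | rfl
    · obtain ⟨r, hr, hrα⟩ := hP.exists_real_closedBall_eq hα hlt
      have hr₀r : r₀ < r := hP.lt_of_real_closedBall_lt (by rw [hrβ, hrα]; exact hβα)
      exact (tendsto_card_notMem_mcd hp hP hμ hle hlim hα hlt hflat hH hr hrα hr₀.le
        hr₀r).eventually_lt_const (by positivity)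
    · filter_upwards [hH, eventually_gt_atTop 0,
        hlim.eventually_const_lt (show 1 - ε / 8 < 1 by linarith)] with n h1 hn h2
      have hn' : (0 : ℝ) < n := by exact_mod_cast hn
      have h3 : (Finset.univ.filter fun i : Fin n => ‖x i‖ ≤ r₀ ∧ i ∉ H n).card ≤ (H n)ᶜ.card :=
        Finset.card_le_card fun i hi => Finset.mem_compl.2 (Finset.mem_filter.1 hi).2.2
      have h4 := Finset.card_add_card_compl (H n)
      rw [Fintype.card_fin, h1.1] at h4
      have h5 : ((Finset.univ.filter fun i : Fin n => ‖x i‖ ≤ r₀ ∧ i ∉ H n).card : ℝ) + h n ≤ n := by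
        exact_mod_cast (by omega)
      rw [lt_div_iff₀ hn'] at h2
      rw [div_lt_iff₀ hn']
      linarith
  have hball := hP.tendsto_real_closedBall hμ r₀
  rw [hrβ] at hball
  obtain ⟨N, hN⟩ := eventually_atTop.1 (hsub.and ((hD (ε / 8) (by positivity)).and (hmiss.and
    ((hball.eventually_const_lt (show β - ε / 8 < β by linarith)).and
    ((hlim.eventually_lt_const (show α < α + ε / 8 by linarith)).and
      (hH.and (eventually_gt_atTop 0)))))))
  refine ⟨N, fun n hnN => ?_⟩
  obtain ⟨h1, h2, h3, h4, h5, h6, hn⟩ := hN n hnN.le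
  have hn' : (0 : ℝ) < n := by exact_mod_cast hn
  rw [coe_empiricalProb x hn] at h1
  rw [← card_filter_norm_le_div x hn] at h4
  rw [empiricalMeasure_symmDiff_obsSubset (x := fun i : Fin n => x i)
    (fun i j hij => Fin.ext (hx hij)), dist_zero_right, Real.norm_of_nonneg (by positivity)]
  set D := Finset.univ.filter fun i : Fin n =>
    x i ∈ depthRegion (empiricalMeasure fun i : Fin n => x i) (d n)
  set B := Finset.univ.filter fun i : Fin n => ‖x i‖ ≤ r₀ with hB
  have hBD : B ⊆ D := Finset.monotone_filter_right _ fun i _ hi => h1 (by simpa using hi)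
  have h7 := card_symmDiff_le hBD (H n)
  have h8 : B \ H n = Finset.univ.filter fun i : Fin n => ‖x i‖ ≤ r₀ ∧ i ∉ H n := by
    ext i; simp [hB]
  rw [h8, h6.1] at h7
  have h9 : ((symmDiff D (H n)).card : ℝ) + 2 * B.card ≤ D.card + h n +
      2 * (Finset.univ.filter fun i : Fin n => ‖x i‖ ≤ r₀ ∧ i ∉ H n).card := by exact_mod_cast h7
  rw [div_lt_iff₀ hn'] at h2 h3 h5 ⊢
  rw [lt_div_iff₀ hn'] at h4
  have : α * n < (β + ε / 8) * n := by gcongr; linarith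
  nlinarith

end

/-! ### Affine equivariance -/

section
variable {p : ℕ}

/-- The affine map `x ↦ N (x - m)` of Euclidean space. -/
noncomputable def whiten (N : Matrix (Fin p) (Fin p) ℝ) (m x : EuclideanSpace ℝ (Fin p)) :
    EuclideanSpace ℝ (Fin p) :=
  Matrix.toEuclideanCLM (𝕜 := ℝ) N (x - m)

theorem continuous_whiten (N : Matrix (Fin p) (Fin p) ℝ) (m : EuclideanSpace ℝ (Fin p)) :
    Continuous (whiten N m) := by
  unfold whiten
  fun_prop

theorem bijective_toEuclideanCLM {N : Matrix (Fin p) (Fin p) ℝ} (hN : N.det ≠ 0) :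
    Function.Bijective (Matrix.toEuclideanCLM (𝕜 := ℝ) N) := by
  have h : LinearMap.det (Matrix.toEuclideanCLM (𝕜 := ℝ) N :
      EuclideanSpace ℝ (Fin p) →ₗ[ℝ] EuclideanSpace ℝ (Fin p)) ≠ 0 := by
    rwa [← det_toEuclideanCLM] at hN
  exact (LinearMap.equivOfDetNeZero _ h).bijective

theorem injective_whiten {N : Matrix (Fin p) (Fin p) ℝ} (hN : N.det ≠ 0)
    (m : EuclideanSpace ℝ (Fin p)) : Function.Injective (whiten N m) := fun x y hxy => by
  simpa using (bijective_toEuclideanCLM hN).1 hxy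

theorem measurableEmbedding_whiten {N : Matrix (Fin p) (Fin p) ℝ} (hN : N.det ≠ 0)
    (m : EuclideanSpace ℝ (Fin p)) : MeasurableEmbedding (whiten N m) :=
  (continuous_whiten N m).measurableEmbedding (injective_whiten hN m)

theorem inner_whiten (N : Matrix (Fin p) (Fin p) ℝ) (m u y : EuclideanSpace ℝ (Fin p)) :
    inner ℝ u (whiten N m y) = inner ℝ (Matrix.toEuclideanCLM (𝕜 := ℝ) Nᵀ u) y -
      inner ℝ (Matrix.toEuclideanCLM (𝕜 := ℝ) Nᵀ u) m := by
  rw [← inner_sub_right, whiten, real_inner_eq_dotProduct, real_inner_eq_dotProduct,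
    Matrix.ofLp_toEuclideanCLM, Matrix.ofLp_toEuclideanCLM, Matrix.dotProduct_mulVec,
    Matrix.mulVec_transpose]

/-- The one-dimensional outlyingness is unchanged by an affine transformation of the data if the
direction is transformed accordingly. -/
theorem outlyingness_whiten (N : Matrix (Fin p) (Fin p) ℝ) (m : EuclideanSpace ℝ (Fin p))
    (Q : Measure (EuclideanSpace ℝ (Fin p))) [IsProbabilityMeasure Q]
    (x : EuclideanSpace ℝ (Fin p)) {u v : EuclideanSpace ℝ (Fin p)} {s : ℝ} (hs : 0 < s)
    (huv : Matrix.toEuclideanCLM (𝕜 := ℝ) Nᵀ u = s • v) :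
    ENNReal.ofReal |inner ℝ u (whiten N m x) -
        median ((Q.map (whiten N m)).map fun y => inner ℝ u y)| /
      ENNReal.ofReal (mad ((Q.map (whiten N m)).map fun y => inner ℝ u y)) =
    ENNReal.ofReal |inner ℝ v x - median (Q.map fun y => inner ℝ v y)| /
      ENNReal.ofReal (mad (Q.map fun y => inner ℝ v y)) := by
  have := isProbabilityMeasure_map_inner Q v
  have hmap : (Q.map (whiten N m)).map (fun y => inner ℝ u y) =
      (Q.map fun y => inner ℝ v y).map fun t => s * t + -(s * inner ℝ v m) := by
    rw [Measure.map_map (by fun_prop) (continuous_whiten N m).measurable,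
      Measure.map_map (by fun_prop) (by fun_prop)]
    congr 1
    ext y
    simp only [Function.comp_apply, inner_whiten, huv, real_inner_smul_left]
    ring
  rw [hmap, median_map_affine _ hs, mad_map_affine _ hs, inner_whiten, huv, real_inner_smul_left,
    real_inner_smul_left]
  set M := median (Q.map fun y => inner ℝ v y)
  rw [show s * inner ℝ v x - s * inner ℝ v m - (s * M + -(s * inner ℝ v m)) =
    s * (inner ℝ v x - M) by ring, abs_mul, abs_of_pos hs, ENNReal.ofReal_mul hs.le,
    ENNReal.ofReal_mul hs.le, ENNReal.mul_div_mul_left _ _ (by simpa using hs)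
      ENNReal.ofReal_ne_top]

theorem projOutlyingness_map_whiten {N : Matrix (Fin p) (Fin p) ℝ} (hN : N.det ≠ 0)
    (m : EuclideanSpace ℝ (Fin p)) (Q : Measure (EuclideanSpace ℝ (Fin p)))
    [IsProbabilityMeasure Q] (x : EuclideanSpace ℝ (Fin p)) :
    projOutlyingness (Q.map (whiten N m)) (whiten N m x) = projOutlyingness Q x := by
  have hbij := bijective_toEuclideanCLM (N := Nᵀ) (by rwa [Matrix.det_transpose])
  refine le_antisymm (iSup₂_le fun u hu => ?_) (iSup₂_le fun v hv => ?_)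
  · have hu1 : ‖u‖ = 1 := by simpa using hu
    set w := Matrix.toEuclideanCLM (𝕜 := ℝ) Nᵀ u with hw
    have hw0 : w ≠ 0 := by
      intro h
      have : u = 0 := hbij.1 (by rw [← hw, h, map_zero])
      simp [this] at hu1
    have hwn : 0 < ‖w‖ := norm_pos_iff.2 hw0
    rw [outlyingness_whiten N m Q x hwn (v := ‖w‖⁻¹ • w) (by rw [smul_inv_smul₀ hwn.ne'])]
    exact le_iSup₂ (f := fun u (_ : u ∈ Metric.sphere (0 : EuclideanSpace ℝ (Fin p)) 1) =>
      ENNReal.ofReal |inner ℝ u x - median (Q.map (fun y => inner ℝ u y))| /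
        ENNReal.ofReal (mad (Q.map (fun y => inner ℝ u y)))) _
      (by simpa using norm_smul_inv_norm (𝕜 := ℝ) hw0)
  · have hv1 : ‖v‖ = 1 := by simpa using hv
    obtain ⟨z, hz⟩ := hbij.2 v
    have hz0 : z ≠ 0 := by
      rintro rfl
      rw [map_zero] at hz
      simp [← hz] at hv1
    have hzn : 0 < ‖z‖ := norm_pos_iff.2 hz0
    rw [← outlyingness_whiten N m Q x (u := ‖z‖⁻¹ • z) (inv_pos.2 hzn) (by rw [map_smul, hz])]
    exact le_iSup₂ (f := fun u (_ : u ∈ Metric.sphere (0 : EuclideanSpace ℝ (Fin p)) 1) =>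
      ENNReal.ofReal |inner ℝ u (whiten N m x) -
        median ((Q.map (whiten N m)).map (fun y => inner ℝ u y))| /
        ENNReal.ofReal (mad ((Q.map (whiten N m)).map (fun y => inner ℝ u y)))) _
      (by simpa using norm_smul_inv_norm (𝕜 := ℝ) hz0)

theorem whiten_mem_depthRegion_iff {N : Matrix (Fin p) (Fin p) ℝ} (hN : N.det ≠ 0)
    (m : EuclideanSpace ℝ (Fin p)) (Q : Measure (EuclideanSpace ℝ (Fin p)))
    [IsProbabilityMeasure Q] (d : ℝ) (x : EuclideanSpace ℝ (Fin p)) :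
    whiten N m x ∈ depthRegion (Q.map (whiten N m)) d ↔ x ∈ depthRegion Q d := by
  change d ≤ projDepth _ _ ↔ d ≤ projDepth _ _
  unfold projDepth
  rw [projOutlyingness_map_whiten hN]

theorem empiricalMeasure_whiten {n : ℕ} (N : Matrix (Fin p) (Fin p) ℝ)
    (m : EuclideanSpace ℝ (Fin p)) (x : Fin n → EuclideanSpace ℝ (Fin p)) :
    empiricalMeasure (fun i => whiten N m (x i)) = (empiricalMeasure x).map (whiten N m) := by
  have hm := (continuous_whiten N m).measurable
  rw [empiricalMeasure, empiricalMeasure, Measure.map_smul,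
    ← Measure.mapₗ_apply_of_measurable hm, map_sum]
  simp only [Measure.mapₗ_apply_of_measurable hm, Measure.map_dirac' hm]

theorem sampleMean_whiten {n : ℕ} (N : Matrix (Fin p) (Fin p) ℝ) (m : EuclideanSpace ℝ (Fin p))
    (x : Fin n → EuclideanSpace ℝ (Fin p)) {K : Finset (Fin n)} (hK : K.Nonempty) :
    sampleMean (fun i => whiten N m (x i)) K = whiten N m (sampleMean x K) := by
  have hc : (K.card : ℝ) ≠ 0 := by exact_mod_cast hK.card_pos.ne'
  simp only [sampleMean, whiten]
  rw [← map_sum, ← map_smul, Finset.sum_sub_distrib, Finset.sum_const, smul_sub,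
    ← Nat.cast_smul_eq_nsmul ℝ, inv_smul_smul₀ hc]

theorem sampleCov_whiten {n : ℕ} (N : Matrix (Fin p) (Fin p) ℝ) (m : EuclideanSpace ℝ (Fin p))
    (x : Fin n → EuclideanSpace ℝ (Fin p)) (K : Finset (Fin n)) :
    sampleCov (fun i => whiten N m (x i)) K = N * sampleCov x K * Nᵀ := by
  rcases K.eq_empty_or_nonempty with rfl | hK
  · simp [sampleCov]
  · simp only [sampleCov, sampleMean_whiten N m x hK]
    rw [Matrix.mul_smul, Matrix.smul_mul, Matrix.mul_sum, Matrix.sum_mul]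
    congr 1
    refine Finset.sum_congr rfl fun i _ => ?_
    have : whiten N m (x i) - whiten N m (sampleMean x K) =
        Matrix.toEuclideanCLM (𝕜 := ℝ) N (x i - sampleMean x K) := by
      simp only [whiten, ← map_sub]
      congr 1
      abel
    rw [this, Matrix.mul_vecMulVec, Matrix.vecMulVec_mul, Matrix.vecMul_transpose,
      Matrix.ofLp_toEuclideanCLM]

theorem RobustDepth.IsMCDIndexSet.whiten {n : ℕ} {x : Fin n → EuclideanSpace ℝ (Fin p)} {h : ℕ}
    {H : Finset (Fin n)} (hH : IsMCDIndexSet x h H) (N : Matrix (Fin p) (Fin p) ℝ)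
    (m : EuclideanSpace ℝ (Fin p)) : IsMCDIndexSet (fun i => whiten N m (x i)) h H := by
  refine ⟨hH.1, fun K hK => ?_⟩
  rw [sampleCov_whiten, sampleCov_whiten, Matrix.det_mul, Matrix.det_mul, Matrix.det_mul,
    Matrix.det_mul, Matrix.det_transpose]
  have := mul_le_mul_of_nonneg_left (hH.2 K hK) (mul_self_nonneg N.det)
  linarith

theorem empiricalMeasure_symmDiff_whiten {n : ℕ} (hn : 0 < n) {N : Matrix (Fin p) (Fin p) ℝ}
    (hN : N.det ≠ 0) (m : EuclideanSpace ℝ (Fin p)) (x : Fin n → EuclideanSpace ℝ (Fin p)) (d : ℝ)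
    (H : Finset (Fin n)) :
    (empiricalMeasure fun i => whiten N m (x i)) (symmDiff
        (depthRegion (empiricalMeasure fun i => whiten N m (x i)) d)
        (obsSubset (fun i => whiten N m (x i)) H)) =
      empiricalMeasure x (symmDiff (depthRegion (empiricalMeasure x) d) (obsSubset x H)) := by
  have := isProbabilityMeasure_empiricalMeasure hn x
  rw [empiricalMeasure_whiten, (measurableEmbedding_whiten hN m).map_apply]
  congr 1
  ext y
  have h1 : whiten N m y ∈ obsSubset (fun i => whiten N m (x i)) H ↔ y ∈ obsSubset x H :=
    ⟨fun ⟨i, hi, e⟩ => ⟨i, hi, injective_whiten hN m e⟩, fun ⟨i, hi, e⟩ => ⟨i, hi, congrArg _ e⟩⟩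
  simp only [Set.mem_preimage, Set.mem_symmDiff, whiten_mem_depthRegion_iff hN, h1]

theorem map_whiten_volume {N : Matrix (Fin p) (Fin p) ℝ} (hN : N.det ≠ 0)
    (m : EuclideanSpace ℝ (Fin p)) :
    (volume : Measure (EuclideanSpace ℝ (Fin p))).map (whiten N m) =
      ENNReal.ofReal |N.det⁻¹| • volume := by
  have h0 : LinearMap.det (Matrix.toEuclideanCLM (𝕜 := ℝ) N :
      EuclideanSpace ℝ (Fin p) →ₗ[ℝ] EuclideanSpace ℝ (Fin p)) = N.det := det_toEuclideanCLM N
  have h1 := Measure.map_linearMap_addHaar_eq_smul_addHaar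
    (volume : Measure (EuclideanSpace ℝ (Fin p))) (h0 ▸ hN)
  rw [h0] at h1
  rw [← h1]
  have h2 : whiten N m = (Matrix.toEuclideanCLM (𝕜 := ℝ) N :
      EuclideanSpace ℝ (Fin p) →ₗ[ℝ] EuclideanSpace ℝ (Fin p)) ∘ fun x => x - m := rfl
  have h3 : Measurable (Matrix.toEuclideanCLM (𝕜 := ℝ) N :
      EuclideanSpace ℝ (Fin p) →ₗ[ℝ] EuclideanSpace ℝ (Fin p)) :=
    (Matrix.toEuclideanCLM (𝕜 := ℝ) N).continuous.measurable
  rw [h2, ← Measure.map_map h3 (by fun_prop),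
    (measurePreserving_sub_right volume m).map_eq]

/-- An elliptically symmetric law is an affine image of a spherical one, with a radial function
that is a positive multiple of the given one. -/
theorem RobustDepth.IsES.exists_isSpherical_map {f : ℝ → ℝ} {m : EuclideanSpace ℝ (Fin p)}
    {S : Matrix (Fin p) (Fin p) ℝ} {P : Measure (EuclideanSpace ℝ (Fin p))} (hP : IsES f m S P) :
    ∃ N : Matrix (Fin p) (Fin p) ℝ, N.det ≠ 0 ∧ (∀ x, ‖whiten N m x‖ ^ 2 = mahalSq m S x) ∧
      ∃ k > 0, IsSpherical (fun s => k * f s) (P.map (whiten N m)) := by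
  obtain ⟨N, hN⟩ := exists_eq_transpose_mul_self hP.posDef.inv.posSemidef
  have hdet : N.det ≠ 0 := by
    intro h0
    have h1 := hP.posDef.inv.det_pos
    rw [hN, Matrix.det_mul, h0, mul_zero] at h1
    exact lt_irrefl _ h1
  have hmah : ∀ x, ‖whiten N m x‖ ^ 2 = mahalSq m S x := fun x => by
    rw [whiten, norm_sq_toEuclideanCLM, ← hN, mahalSq]
  obtain ⟨c, hc, hdens⟩ := hP.density
  have hS := hP.posDef.det_pos
  have hk : 0 < |N.det⁻¹| * (c * S.det ^ (-(1 / 2) : ℝ)) := by positivity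
  refine ⟨N, hdet, hmah, _, hk, ⟨fun s hs => mul_nonneg hk.le (hP.nonneg s hs),
    fun s hs t ht hst => mul_le_mul_of_nonneg_left (hP.antitone hs ht hst) hk.le, ?_, ?_⟩⟩
  · have := hP.prob
    exact Measure.isProbabilityMeasure_map (continuous_whiten N m).measurable.aemeasurable
  · have hφ : Measurable fun z : EuclideanSpace ℝ (Fin p) =>
        ENNReal.ofReal (c * S.det ^ (-(1 / 2) : ℝ) * f (‖z‖ ^ 2)) :=
      ((measurable_comp_norm_sq hP.antitone).const_mul _).ennreal_ofReal
    have hm := (continuous_whiten N m).measurable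
    ext s hs
    rw [Measure.map_apply hm hs, hdens, withDensity_apply _ (hm hs), withDensity_apply _ hs]
    simp only [← hmah]
    rw [← setLIntegral_map hs hφ hm, map_whiten_volume hdet, Measure.restrict_smul,
      lintegral_smul_measure, smul_eq_mul, ← lintegral_const_mul _ hφ]
    refine lintegral_congr fun z => ?_
    rw [← ENNReal.ofReal_mul (abs_nonneg _)]
    congr 1
    ring

end

/-! ### Almost sure and mean convergence -/

/-- Dominated convergence for possibly nonmeasurable functions: the lower integrals of functions
that are at most one and tend to zero almost everywhere tend to zero. -/
theorem tendsto_lintegral_of_ae_tendsto_zero {Ω : Type*} [MeasurableSpace Ω] {Pr : Measure Ω}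
    [IsFiniteMeasure Pr] {F : ℕ → Ω → ℝ≥0∞} (hF : ∀ᶠ n in atTop, ∀ ω, F n ω ≤ 1)
    (hlim : ∀ᵐ ω ∂Pr, Tendsto (fun n => F n ω) atTop (𝓝 0)) :
    Tendsto (fun n => ∫⁻ ω, F n ω ∂Pr) atTop (𝓝 0) := by
  choose G hGm hGF hG using fun n => exists_measurable_le_lintegral_eq Pr (F n)
  simp only [hG]
  have h := tendsto_lintegral_filter_of_dominated_convergence (μ := Pr) (l := atTop) (F := G)
    (f := fun _ => 0) (fun _ => 1) (Eventually.of_forall hGm)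
    (hF.mono fun n hn => ae_of_all _ fun ω => (hGF n ω).trans (hn ω)) (by simp) (by
      filter_upwards [hlim] with ω hω
      exact tendsto_of_tendsto_of_tendsto_of_le_of_le tendsto_const_nhds hω (fun _ => bot_le)
        fun n => hGF n ω)
  simpa using h

theorem theorem1 {p : ℕ} (hp : 0 < p)
    (f : ℝ → ℝ) (m : EuclideanSpace ℝ (Fin p)) (S : Matrix (Fin p) (Fin p) ℝ)
    (P : Measure (EuclideanSpace ℝ (Fin p))) (hP : IsES f m S P)
    {Ω : Type*} [MeasurableSpace Ω] (Pr : Measure Ω) [IsProbabilityMeasure Pr]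
    -- an i.i.d. sequence of observations with law `P`
    (X : ℕ → Ω → EuclideanSpace ℝ (Fin p))
    (hXm : ∀ i, Measurable (X i)) (hXlaw : ∀ i, Pr.map (X i) = P) (hXind : iIndepFun X Pr)
    -- the subset sizes `h n`, with `α_n = h n / n → α`
    (h : ℕ → ℕ) (hh : ∀ᶠ n in atTop, (n + p + 1) / 2 ≤ h n ∧ h n ≤ n)
    (α : ℝ) (hα : 0 < α) (hlim : Tendsto (fun n => (h n : ℝ) / n) atTop (𝓝 α))
    -- a central ellipsoid on which the density is constant has probability at most `α`
    (hflat : ∀ s : ℝ, 0 < s → (∀ t ∈ Set.Ioo 0 s, ∀ t' ∈ Set.Ioo 0 s, f t = f t') →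
      P.real {x | mahalSq m S x ≤ s} ≤ α)
    -- the depth levels: the population region of level `d n` has probability `α_n`
    (d : ℕ → ℝ) (hd : ∀ᶠ n in atTop, P.real (depthRegion P (d n)) = (h n : ℝ) / n)
    -- an MCD-optimal index set for each sample
    (H : ∀ n : ℕ, Ω → Finset (Fin n))
    (hH : ∀ᶠ n in atTop, ∀ᵐ ω ∂Pr,
      IsMCDIndexSet (fun i : Fin n => X i ω) (h n) (H n ω)) :
    (∀ᵐ ω ∂Pr, Tendsto (fun n : ℕ =>
        empiricalMeasure (fun i : Fin n => X i ω)
          (symmDiff (depthRegion (empiricalMeasure (fun i : Fin n => X i ω)) (d n))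
            (obsSubset (fun i : Fin n => X i ω) (H n ω))))
      atTop (𝓝 0)) ∧
    Tendsto (fun n : ℕ => ∫⁻ ω,
        empiricalMeasure (fun i : Fin n => X i ω)
          (symmDiff (depthRegion (empiricalMeasure (fun i : Fin n => X i ω)) (d n))
            (obsSubset (fun i : Fin n => X i ω) (H n ω))) ∂Pr)
      atTop (𝓝 0) := by
  have hPprob := hP.prob
  have : Nonempty (Fin p) := ⟨⟨0, hp⟩⟩
  obtain ⟨N, hN, hmah, k, hk, hsph⟩ := hP.exists_isSpherical_map
  have hTm := (continuous_whiten N m).measurable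
  have hTe := measurableEmbedding_whiten hN m
  have hprob' := hsph.prob
  have hatom := hsph.nullSingletonClass
  set P' : ProbabilityMeasure (EuclideanSpace ℝ (Fin p)) := ⟨P.map (whiten N m), hprob'⟩ with hP'
  have hZm : ∀ i, Measurable fun ω => whiten N m (X i ω) := fun i => hTm.comp (hXm i)
  have hZlaw : ∀ i, Pr.map (fun ω => whiten N m (X i ω)) = P.map (whiten N m) := fun i => by
    rw [← hXlaw i, Measure.map_map hTm (hXm i)]
    rfl
  have hZind : iIndepFun (fun i ω => whiten N m (X i ω)) Pr :=
    hXind.comp (fun _ => whiten N m) fun _ => hTm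
  have hreal : ∀ A : Set (EuclideanSpace ℝ (Fin p)),
      (P.map (whiten N m)).real A = P.real (whiten N m ⁻¹' A) := fun A => by
    rw [measureReal_def, hTe.map_apply, measureReal_def]
  have hflat' : ∀ s : ℝ, 0 < s →
      (∀ t ∈ Set.Ioo 0 s, ∀ t' ∈ Set.Ioo 0 s, k * f t = k * f t') →
      (P' : Measure (EuclideanSpace ℝ (Fin p))).real {x | ‖x‖ ^ 2 ≤ s} ≤ α := by
    intro s hs hconst
    refine le_trans (le_of_eq ?_)
      (hflat s hs fun t ht t' ht' => mul_left_cancel₀ hk.ne' (hconst t ht t' ht'))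
    rw [hP', ProbabilityMeasure.coe_mk, hreal]
    simp only [Set.preimage_ofPred_eq, hmah]
  have hd' : ∀ᶠ n in atTop, (P' : Measure (EuclideanSpace ℝ (Fin p))).real
      (depthRegion (P' : Measure (EuclideanSpace ℝ (Fin p))) (d n)) = (h n : ℝ) / n := by
    filter_upwards [hd] with n hn
    rw [← hn, hP', ProbabilityMeasure.coe_mk, hreal]
    congr 1
    ext y
    exact whiten_mem_depthRegion_iff hN m P (d n) y
  have hH' : ∀ᵐ ω ∂Pr, ∀ᶠ n in atTop,
      IsMCDIndexSet (fun i : Fin n => X i ω) (h n) (H n ω) := by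
    obtain ⟨n₀, hn₀⟩ := eventually_atTop.1 hH
    have : ∀ᵐ ω ∂Pr, ∀ n, n₀ ≤ n → IsMCDIndexSet (fun i : Fin n => X i ω) (h n) (H n ω) := by
      simp only [ae_all_iff]
      exact hn₀
    filter_upwards [this] with ω hω
    exact eventually_atTop.2 ⟨n₀, hω⟩
  have hmain : ∀ᵐ ω ∂Pr, Tendsto (fun n : ℕ =>
        empiricalMeasure (fun i : Fin n => X i ω)
          (symmDiff (depthRegion (empiricalMeasure (fun i : Fin n => X i ω)) (d n))
            (obsSubset (fun i : Fin n => X i ω) (H n ω))))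
      atTop (𝓝 0) := by
    filter_upwards [hH', ae_tendsto_empiricalProb (P := P.map (whiten N m)) hZm hZlaw hZind,
      ae_injective_of_nullSingletonClass (P := P.map (whiten N m)) hZm hZlaw hZind] with ω h1 h2 h3
    have h4 := tendsto_real_symmDiff_of_isSpherical hp (P := P') hsph h3 h2
      (hh.mono fun n hn => hn.2) hlim hα hflat' hd' (h1.mono fun n hn => hn.whiten N m)
    have h5 := ENNReal.tendsto_ofReal h4
    rw [ENNReal.ofReal_zero] at h5
    refine h5.congr' ?_
    filter_upwards [eventually_gt_atTop 0] with n hn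
    have := isProbabilityMeasure_empiricalMeasure hn fun i : Fin n => whiten N m (X i ω)
    rw [ofReal_measureReal]
    exact empiricalMeasure_symmDiff_whiten hn hN m (fun i : Fin n => X i ω) (d n) (H n ω)
  refine ⟨hmain, tendsto_lintegral_of_ae_tendsto_zero ?_ hmain⟩
  filter_upwards [eventually_gt_atTop 0] with n hn ω
  have := isProbabilityMeasure_empiricalMeasure hn fun i : Fin n => X i ω
  exact prob_le_one
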